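/- Let $d\in\{2,3\}$ and let $\Omega\subset\mathbb R^d$ be a bounded polygonal (polyhedral) open set. Let $\mathcal T_h$ be a finite conforming simplicial mesh of $\Omega$ with mesh size $h$, let $X_h\subset H^1_0(\Omega)^d$ be a linear space of vector fields that are polynomials of degree at most $k$ on each cell, let $Q_h$ be a linear subspace of $L^2_0(\Omega)$, and put $V_h=\{v\in X_h:(q,\nabla\cdot v)=0\ \ \forall q\in Q_h\}$. Let $\mathrm{Re},C_S,\delta,\Delta t>0$, $s\ge 0$, $r\in\mathbb R$, $M\in\mathbb N$, $t^{n+1/2}=(n+\tfrac12)\Delta t$, and let $f(t)\in H^{-1}(\Omega)^d$ for each $t$, with $\|f\|_{-1}=\sup\{(f,v): v\in H_0^1(\Omega)^d,\ \|\nabla v\|\le 1\}$, where $\|\cdot\|$ and $(\cdot,\cdot)$ are the $L^2(\Omega)$ norm and inner product (or the duality pairing) and matrices carry the Frobenius norm. Write $w^{n+1/2}=\frac12(w^{n+1}+w^n)$ and $$b^*(u,v,w)=\tfrac12\big[(u\cdot\nabla v,w)-(u\cdot\nabla w,v)\big],\qquad c(u,v,w)=2(D(u)v,w)+((\nabla\cdot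 u)v,w),$$ with $D(u)=\frac12(\nabla u+(\nabla u)^T)$. A solution of the fully discrete scheme is a sequence $w_h^0,\dots,w_h^M\in V_h$ such that, for $0\le n<M$ and all $v_h\in V_h$, $$\Big(\tfrac{w_h^{n+1}-w_h^n}{\Delta t},v_h\Big)+\mathrm{Re}^{-1}(\nabla w_h^{n+1/2},\nabla v_h)+(C_S\delta)^r\big(\|\nabla w_h^{n+1/2}\|_F^s\nabla w_h^{n+1/2},\nabla v_h\big)+N(w_h^{n+1/2},w_h^{n+1/2},v_h)=(f(t^{n+1/2}),v_h),$$ where $N=b^*$ (SKEW) or $N=c$ (EMAC). (1) For both schemes and every $\Delta t>0$, each solution satisfies $$\|w_h^M\|^2+\mathrm{Re}^{-1}\Delta t\sum_{n=0}^{M-1}\|\nabla w_h^{n+1/2}\|^2+2(C_S\delta)^r\Delta t\sum_{n=0}^{M-1}\|\nabla w_h^{n+1/2}\|_{s+2}^{s+2}\le\|w_h^0\|^2+\Delta t\,\mathrm{Re}\sum_{n=0}^{M-1}\|f(t^{n+1/2})\|_{-1}^2 .$$ (2) For both schemes, every $\Delta t>0$ and every $w_h^0\in V_h$, a solution with initial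 value $w_h^0$ exists. (3) For all $\sigma>0$ and $B$ there is a constant $c_0>0$, depending only on $\Omega$, $d$, $k$, $\sigma$ and $B$, with the following property. Suppose that every cell of $\mathcal T_h$ contains a ball of radius $\sigma h$, and that $\|w_h^0\|^2+\Delta t\,\mathrm{Re}\sum_{n<M}\|f(t^{n+1/2})\|_{-1}^2\le B$. If $\Delta t<c_0h^{1+d/2}$, then for both schemes there is at most one solution with initial value $w_h^0$. For the SKEW scheme this also holds if $\Delta t\le c_0h^3$. -/

import Mathlib

open MeasureTheory
open scoped ContDiff

noncomputable section

namespace LadyzhenskayaFE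

/-- Points and velocity vectors: `ℝ^d` with its Euclidean norm. -/
abbrev Vec (d : ℕ) := EuclideanSpace ℝ (Fin d)

/-- `d × d` matrices; the norm and the inner product are those of Frobenius. -/
abbrev Mat (d : ℕ) := EuclideanSpace ℝ (Fin d × Fin d)

/-- The classical gradient: the entry `(i, j)` is `∂ φ_i / ∂ x_j`. -/
def classicalGrad {d : ℕ} (φ : Vec d → Vec d) (x : Vec d) : Mat d :=
  WithLp.toLp 2 fun p => fderiv ℝ φ x (EuclideanSpace.single p.2 1) p.1

/-- `L²(Ω)^d`. -/
abbrev L2Vec {d : ℕ} (Ω : Set (Vec d)) := Lp (Vec d) 2 (volume.restrict Ω)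

/-- `L²(Ω)^{d × d}`. -/
abbrev L2Mat {d : ℕ} (Ω : Set (Vec d)) := Lp (Mat d) 2 (volume.restrict Ω)

/-- `L²(Ω)`. -/
abbrev L2Scal {d : ℕ} (Ω : Set (Vec d)) := Lp ℝ 2 (volume.restrict Ω)

/-- The pairs `(φ, ∇φ)` with `φ ∈ C_c^∞(Ω)^d`. -/
def testGraph {d : ℕ} (Ω : Set (Vec d)) : Submodule ℝ (L2Vec Ω × L2Mat Ω) where
  carrier := {u | ∃ φ : Vec d → Vec d, ContDiff ℝ ∞ φ ∧ HasCompactSupport φ ∧ tsupport φ ⊆ Ω ∧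
    u.1 =ᵐ[volume.restrict Ω] φ ∧ u.2 =ᵐ[volume.restrict Ω] classicalGrad φ}
  zero_mem' := by
    refine ⟨0, contDiff_zero_fun, HasCompactSupport.zero, by simp [tsupport],
      Lp.coeFn_zero _ _ _, ?_⟩
    have h : classicalGrad (0 : Vec d → Vec d) = 0 := by
      ext x p
      simp [classicalGrad]
    rw [h]
    exact Lp.coeFn_zero _ _ _
  add_mem' := by
    rintro u v ⟨φ, hφ, cφ, sφ, uφ, gφ⟩ ⟨ψ, hψ, cψ, sψ, vψ, gψ⟩
    refine ⟨φ + ψ, hφ.add hψ, cφ.add cψ,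
      (tsupport_add φ ψ).trans (Set.union_subset sφ sψ), ?_, ?_⟩
    · exact (Lp.coeFn_add _ _).trans (uφ.add vψ)
    · have h : classicalGrad (φ + ψ) = classicalGrad φ + classicalGrad ψ := by
        ext x p
        simp [classicalGrad, fderiv_add (hφ.differentiable (by simp)).differentiableAt
          (hψ.differentiable (by simp)).differentiableAt]
      rw [h]
      exact (Lp.coeFn_add _ _).trans (gφ.add gψ)
  smul_mem' := by
    rintro a u ⟨φ, hφ, cφ, sφ, uφ, gφ⟩
    refine ⟨a • φ, contDiff_const.smul hφ, cφ.smul_left (f := fun _ => a),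
      (tsupport_smul_subset_right (fun _ => a) φ).trans sφ, ?_, ?_⟩
    · exact (Lp.coeFn_smul _ _).trans (uφ.const_smul a)
    · have h : classicalGrad (a • φ) = a • classicalGrad φ := by
        ext x p
        simp [classicalGrad, fderiv_const_smul (hφ.differentiable (by simp)).differentiableAt]
      rw [h]
      exact (Lp.coeFn_smul _ _).trans (gφ.const_smul a)

/-- `X = H¹₀(Ω)^d`: the closure of `C_c^∞(Ω)^d` in `H¹`. An element is recorded as the pair
`(u, ∇u)` in `L² × L²`, so the space is the closure of the graph of the gradient. -/
abbrev H10 {d : ℕ} (Ω : Set (Vec d)) : Submodule ℝ (L2Vec Ω × L2Mat Ω) :=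
  (testGraph Ω).topologicalClosure

section Fields

variable {d : ℕ} {Ω : Set (Vec d)}

/-- The velocity field of an element of `H¹₀`. -/
def vel (u : H10 Ω) : L2Vec Ω := u.1.1

/-- The weak gradient; the entry `(i, j)` is `∂_j u_i`. -/
def grad (u : H10 Ω) : L2Mat Ω := u.1.2

/-- The divergence `∑ ∂_i u_i`. -/
def divg (u : H10 Ω) (x : Vec d) : ℝ := ∑ i, grad u x (i, i)

/-- The deformation tensor `D(u) = (∇u + (∇u)ᵀ) / 2`. -/
def symGrad (u : H10 Ω) (x : Vec d) (i j : Fin d) : ℝ :=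
  (grad u x (i, j) + grad u x (j, i)) / 2

/-- `b(u, v, w) = (u · ∇v, w)`. -/
def bForm (u v w : H10 Ω) : ℝ :=
  ∫ x in Ω, ∑ i, (∑ j, vel u x j * grad v x (i, j)) * vel w x i

/-- `b*(u, v, w) = (b(u, v, w) - b(u, w, v)) / 2`. -/
def bStar (u v w : H10 Ω) : ℝ := (1 / 2) * (bForm u v w - bForm u w v)

/-- `c(u, v, w) = 2 (D(u) v, w) + ((∇ · u) v, w)`. -/
def cForm (u v w : H10 Ω) : ℝ :=
  2 * (∫ x in Ω, ∑ i, (∑ j, symGrad u x i j * vel v x j) * vel w x i)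
    + ∫ x in Ω, divg u x * ∑ i, vel v x i * vel w x i

/-- `(‖∇u‖_F^s ∇u, ∇v)`. -/
def ladForm (s : ℝ) (u v : H10 Ω) : ℝ :=
  ∫ x in Ω, ‖grad u x‖ ^ s * inner ℝ (grad u x) (grad v x)

/-- `‖∇u‖_{s+2}^{s+2}`, the power of the `L^{s+2}` norm of the gradient. -/
def gradPow (s : ℝ) (u : H10 Ω) : ℝ := ∫ x in Ω, ‖grad u x‖ ^ (s + 2)

/-- The norm of `H⁻¹` dual to the norm `‖∇v‖` of `H¹₀`. -/
def hMinusNorm (f : StrongDual ℝ (H10 Ω)) : ℝ :=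
  sSup {y | ∃ v : H10 Ω, ‖grad v‖ ≤ 1 ∧ y = f v}

end Fields

/-- A finite conforming triangulation (tetrahedral mesh for `d = 3`) of the open set `Ω`. -/
structure Triangulation {d : ℕ} (Ω : Set (Vec d)) where
  /-- the vertices, edges, … and cells -/
  complex : Geometry.SimplicialComplex ℝ (Vec d)
  finite_faces : complex.faces.Finite
  /-- every face belongs to a cell -/
  pure : ∀ t ∈ complex.faces, ∃ K ∈ complex.faces, t ⊆ K ∧ K.card = d + 1
  space_eq : complex.space = closure Ω
  /-- open cells lie in the domain -/
  interior_subset : ∀ K ∈ complex.faces, K.card = d + 1 →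
    interior (convexHull ℝ (K : Set (Vec d))) ⊆ Ω

namespace Triangulation

variable {d : ℕ} {Ω : Set (Vec d)}

/-- The `d`-dimensional simplices of the mesh, given by their sets of vertices. -/
def cells (𝒯 : Triangulation Ω) : Set (Finset (Vec d)) :=
  {K | K ∈ 𝒯.complex.faces ∧ K.card = d + 1}

/-- The mesh size `h`, the largest diameter of a cell. -/
def h (𝒯 : Triangulation Ω) : ℝ :=
  sSup {y | ∃ K ∈ 𝒯.cells, y = Metric.diam (convexHull ℝ (K : Set (Vec d)))}

/-- Quasi-uniformity (with shape regularity): every cell contains a ball of radius `σ h`. -/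
def IsQuasiUniform (𝒯 : Triangulation Ω) (σ : ℝ) : Prop :=
  ∀ K ∈ 𝒯.cells, ∃ x, Metric.closedBall x (σ * 𝒯.h) ⊆ convexHull ℝ (K : Set (Vec d))

/-- `Xh` is a conforming finite element space on the mesh: a linear subspace of `H¹₀(Ω)^d` whose
elements are, on every cell, vectors of polynomials of degree at most `k`. (On the bounded set `Ω`
such functions have bounded gradients, whence `Xh` lies in every `W₀^{1,s+2}`.) -/
def IsFESpace (𝒯 : Triangulation Ω) (k : ℕ) (Xh : Submodule ℝ (H10 Ω)) : Prop :=
  ∀ u ∈ Xh, ∀ K ∈ 𝒯.cells, ∃ P : Fin d → MvPolynomial (Fin d) ℝ,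
    (∀ i, (P i).totalDegree ≤ k) ∧
    ∀ᵐ x ∂(volume.restrict Ω), x ∈ convexHull ℝ (K : Set (Vec d)) →
      ∀ i, vel u x i = MvPolynomial.eval (fun j => x j) (P i)

end Triangulation

/-- `Qh ⊆ L²₀(Ω)`: the discrete pressures have mean zero. -/
def IsPressureSpace {d : ℕ} {Ω : Set (Vec d)} (Qh : Submodule ℝ (L2Scal Ω)) : Prop :=
  ∀ q ∈ Qh, ∫ x in Ω, q x = 0

/-- `V_h = {u ∈ X_h : (q, ∇ · u) = 0 for all q ∈ Q_h}`. -/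
def Vh {d : ℕ} {Ω : Set (Vec d)} (Xh : Submodule ℝ (H10 Ω)) (Qh : Submodule ℝ (L2Scal Ω)) :
    Set (H10 Ω) :=
  {u | u ∈ Xh ∧ ∀ q ∈ Qh, ∫ x in Ω, q x * divg u x = 0}

/-- The two formulations of the convective term. -/
inductive Formulation
  | skew
  | emac

/-- The trilinear form of a formulation: `b*` for SKEW and `c` for EMAC. -/
def Formulation.form {d : ℕ} {Ω : Set (Vec d)} : Formulation → H10 Ω → H10 Ω → H10 Ω → ℝ
  | .skew => bStar
  | .emac => cForm

/-- `w^{n+1/2} = (w^{n+1} + w^n) / 2`. -/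
def midpt {d : ℕ} {Ω : Set (Vec d)} (w : ℕ → H10 Ω) (n : ℕ) : H10 Ω :=
  (1 / 2 : ℝ) • (w (n + 1) + w n)

/-- `t^{n+1/2} = (t^{n+1} + t^n) / 2` with `t^n = n Δt`. -/
def tmid (Δt : ℝ) (n : ℕ) : ℝ := ((n + 1 : ℕ) * Δt + n * Δt) / 2

/-- `w^0, …, w^M` solves the fully discrete Crank-Nicolson scheme in `V_h`, with viscosity
coefficients `Re⁻¹` and `ν = (C_S δ)^r`, exponent `s` and forcing `f`. -/
def IsDiscreteSolution {d : ℕ} {Ω : Set (Vec d)} (F : Formulation) (V : Set (H10 Ω))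
    (Re ν s Δt : ℝ) (f : ℝ → StrongDual ℝ (H10 Ω)) (M : ℕ) (w : ℕ → H10 Ω) : Prop :=
  (∀ n ≤ M, w n ∈ V) ∧
  ∀ n < M, ∀ v ∈ V,
    (1 / Δt) * inner ℝ (vel (w (n + 1)) - vel (w n)) (vel v)
      + Re⁻¹ * inner ℝ (grad (midpt w n)) (grad v)
      + ν * ladForm s (midpt w n) v
      + F.form (midpt w n) (midpt w n) v
      = f (tmid Δt n) v

end LadyzhenskayaFE

end

open MeasureTheory
open scoped ContDiff

noncomputable section

set_option maxSynthPendingDepth 3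

namespace LadyzhenskayaFE

/-! ### Zeros of outward-pointing vector fields (Brouwer's theorem) -/

section Brouwer

open Metric Polynomial

variable {m : ℕ}

/-! Everything rests on one cancellation: both convective forms satisfy `F.form u u u = 0` for
bounded `u` with bounded gradient (`form_self`). For SKEW this is antisymmetry. For EMAC it says
that the integral of `div ((u · u) u)` vanishes; this is proved by testing the weak gradient of one
field against the smooth product of two test fields, and then extending by density one argument at a
time (`transport_eq_zero`). Finite element functions are such bounded fields, because on each cell
they are polynomials and the weak gradient is the classical one (`IsFESpace.le_bddSubmodule`).

Stability: in a step tested with its own midpoint, the time difference becomes half the difference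
of `‖w^{n+1}‖²` and `‖w^n‖²`, the convection drops out, and Young's inequality moves half of the
viscous term against the force (`energy_step`). Summation over the steps telescopes.

Existence: with the midpoint `u` as unknown and `w^{n+1} = 2u - w^n`, a step is a finite-dimensional
equation whose residual, paired with `u`, is positive when `‖u‖` is large. A continuous field on
`ℝ^m` that points outwards far from the origin has a zero (`exists_eq_zero_of_inner_pos`). This form
of Brouwer's theorem is proved with integrals: for a compactly supported `C¹` map `g`, the change of
variables under `id + t g` is valid for small `t`, and its left side is a polynomial in `t`, so it
persists at `t = 1`. Densities concentrating at the origin then force `id + g` to vanish somewhere.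

Uniqueness: two solutions with the same previous value have midpoints differing by `e`. Subtract the
two steps and test with `e`. The power-law term is monotone and the viscous term is nonnegative, so
`(2/Δt) ‖e‖²` is at most the difference of the convective terms. By bilinearity that difference is
controlled by `‖e‖`, `‖∇e‖` and sup norms of the midpoints and their gradients
(`abs_form_sub_form_le`). Scaling to a reference ball gives inverse inequalities
(`exists_inverse_estimates`), and the energy bound gives `‖w^n‖ ≤ √B`, so the difference is at most
a constant times `√B h^{-1-d/2} ‖e‖²`. If `Δt` is a small multiple of `h^{1+d/2}`, then `e = 0`. The
condition with `h³` reduces to this one because `h` is at most the diameter of `Ω`. -/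

lemma exists_polynomial_eval_eq_det (A : Vec m →L[ℝ] Vec m) :
    ∃ p : ℝ[X], p.natDegree ≤ m ∧ ∀ t : ℝ,
      p.eval t = (ContinuousLinearMap.id ℝ (Vec m) + t • A).det := by
  let b := (EuclideanSpace.basisFun (Fin m) ℝ).toBasis
  let M := LinearMap.toMatrix b b (A : Vec m →ₗ[ℝ] Vec m)
  refine ⟨Matrix.det ((X : ℝ[X]) • M.map C + (1 : Matrix (Fin m) (Fin m) ℝ).map C), ?_, ?_⟩
  · simpa using Polynomial.natDegree_det_X_add_C_le M 1
  · intro t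
    rw [ContinuousLinearMap.det, ← LinearMap.det_toMatrix b, ← coe_evalRingHom, RingHom.map_det]
    congr 1
    have : LinearMap.toMatrix b b ((ContinuousLinearMap.id ℝ (Vec m) + t • A :
        Vec m →L[ℝ] Vec m) : Vec m →ₗ[ℝ] Vec m) = 1 + t • M := by
      rw [← LinearMap.toMatrix_id b]
      simp [M]
    rw [this]
    ext i j
    simp [Matrix.one_apply]
    split_ifs <;> simp <;> ring

/-- The density is a power of a function quadratic in the point, so along `x + t g` it stays
polynomial in `t`, and its degree is bounded independently of `x`. This uniformity is what lets one
extrapolation formula serve every `x`. -/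
lemma exists_polynomial_eval_eq (x g : Vec m) (A : Vec m →L[ℝ] Vec m) (L : ℝ) (N : ℕ) :
    ∃ p : ℝ[X], p.natDegree ≤ 2 * N + m ∧ ∀ t : ℝ, p.eval t =
      (1 - ‖x + t • g‖ ^ 2 / L ^ 2) ^ N * (ContinuousLinearMap.id ℝ (Vec m) + t • A).det := by
  obtain ⟨q, hq, hq'⟩ := exists_polynomial_eval_eq_det A
  let r : ℝ[X] := C (1 - ‖x‖ ^ 2 / L ^ 2) + C (-(2 * inner ℝ x g / L ^ 2)) * X
    + C (-(‖g‖ ^ 2 / L ^ 2)) * X ^ 2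
  have hr : r.natDegree ≤ 2 := by
    simp only [r]; compute_degree
  refine ⟨r ^ N * q, ?_, fun t => ?_⟩
  · refine natDegree_mul_le.trans (add_le_add (natDegree_pow_le.trans ?_) hq)
    rw [mul_comm]
    exact Nat.mul_le_mul_right _ hr
  · rw [eval_mul, eval_pow, hq']
    congr 2
    rw [norm_add_sq_real, inner_smul_right, norm_smul, mul_pow, Real.norm_eq_abs, sq_abs]
    simp only [r, eval_add, eval_mul, eval_C, eval_X, eval_pow]
    ring

/-- Extrapolation of polynomials of bounded degree from small positive nodes to `1`. -/
lemma exists_extrapolation (D : ℕ) {t₀ : ℝ} (ht₀ : 0 < t₀) :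
    ∃ τ c : Fin (D + 1) → ℝ, (∀ i, 0 ≤ τ i ∧ τ i < t₀) ∧ ∀ p : ℝ[X], p.natDegree ≤ D →
      p.eval 1 = ∑ i, c i * p.eval (τ i) := by
  let τ : Fin (D + 1) → ℝ := fun i => t₀ * (i / (D + 1))
  have hinj : Set.InjOn τ (Finset.univ : Finset (Fin (D + 1))) := by
    intro i _ j _ hij
    have hD : (0 : ℝ) < D + 1 := by positivity
    have : (i : ℝ) = j := by
      have := mul_left_cancel₀ ht₀.ne' hij
      field_simp at this
      exact this
    exact Fin.ext (by exact_mod_cast this)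
  refine ⟨τ, fun i => (Lagrange.basis Finset.univ τ i).eval 1, fun i => ⟨by positivity, ?_⟩, ?_⟩
  · have h1 : (i : ℝ) / (D + 1) < 1 := by
      rw [div_lt_one (by positivity)]
      exact_mod_cast i.2
    exact mul_lt_of_lt_one_right ht₀ h1
  · intro p hp
    have hdeg : p.degree < (Finset.univ : Finset (Fin (D + 1))).card := by
      refine lt_of_le_of_lt degree_le_natDegree ?_
      rw [Finset.card_univ, Fintype.card_fin]
      exact_mod_cast Nat.lt_succ_of_le hp
    have h := Lagrange.eq_interpolate (s := Finset.univ) (v := τ) hinj hdeg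
    rw [Lagrange.interpolate_apply] at h
    conv_lhs => rw [h]
    rw [eval_finsetSum]
    exact Finset.sum_congr rfl fun i _ => by rw [eval_mul, eval_C, mul_comm]

/-- For small `t` the map `id + t g` maps the ball onto itself. -/
lemma image_closedBall_eq {g : Vec m → Vec m} {K : NNReal} (hg : LipschitzWith K g) {R t : ℝ}
    (ht : 0 ≤ t) (htK : t * K < 1) (hsupp : ∀ x, R < ‖x‖ → g x = 0) :
    Function.Injective (fun x => x + t • g x) ∧
      (fun x => x + t • g x) '' closedBall 0 R = closedBall 0 R := by
  let F : Vec m → Vec m := fun x => x + t • g x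
  -- `F` differs from the identity by a map with Lipschitz constant `t K < 1`, so the quantitative
  -- inverse function theorem makes it a bijection of the whole space.
  have happ : ApproximatesLinearOn F
      ((ContinuousLinearEquiv.refl ℝ (Vec m) : Vec m ≃L[ℝ] Vec m) : Vec m →L[ℝ] Vec m)
      Set.univ (Real.toNNReal t * K) := by
    intro x _ y _
    have : F x - F y - (x - y) = t • (g x - g y) := by
      simp only [F, smul_sub]; abel
    simp only [ContinuousLinearEquiv.coe_refl, ContinuousLinearMap.coe_id', id]
    rw [this, norm_smul, Real.norm_of_nonneg ht]
    have := hg.dist_le_mul x y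
    rw [dist_eq_norm, dist_eq_norm] at this
    simp only [NNReal.coe_mul, Real.coe_toNNReal _ ht, mul_assoc]
    exact mul_le_mul_of_nonneg_left this ht
  have hc : Subsingleton (Vec m) ∨ Real.toNNReal t * K <
      ‖((ContinuousLinearEquiv.refl ℝ (Vec m)).symm : Vec m →L[ℝ] Vec m)‖₊⁻¹ := by
    rcases subsingleton_or_nontrivial (Vec m) with h | h
    · exact Or.inl h
    · right
      have : ‖((ContinuousLinearEquiv.refl ℝ (Vec m)).symm : Vec m →L[ℝ] Vec m)‖₊ = 1 := by
        apply NNReal.eq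
        exact ContinuousLinearMap.norm_id
      rw [this, inv_one, ← NNReal.coe_lt_coe]
      simpa [Real.coe_toNNReal _ ht] using htK
  have hinj : Function.Injective F := Set.injOn_univ.1 (happ.injOn hc)
  have hsurj : Function.Surjective F := happ.surjective hc
  have hout : ∀ x, R < ‖x‖ → F x = x := fun x hx => by simp [F, hsupp x hx]
  refine ⟨hinj, Set.Subset.antisymm ?_ ?_⟩
  · rintro _ ⟨x, hx, rfl⟩
    -- If `F x` lay outside the ball it would be a fixed point of `F`; injectivity would give `F x =
    -- x`, placing `x` outside as well.
    by_contra hy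
    simp only [mem_closedBall, dist_zero_right, not_le] at hx hy
    have : F (F x) = F x := hout _ hy
    exact absurd hx (not_le.2 (by rw [← hinj this]; exact hy))
  · intro y hy
    obtain ⟨x, rfl⟩ := hsurj y
    refine ⟨x, ?_, rfl⟩
    by_contra hx
    simp only [mem_closedBall, dist_zero_right, not_le] at hx hy
    rw [hout x hx] at hy
    exact absurd hy (not_le.2 hx)

/-- Change of variables for `id + g`, with densities that are powers of `1 - ‖y‖² / L²`. -/
lemma integral_comp_mul_det_eq {g : Vec m → Vec m} (hg : ContDiff ℝ 1 g)
    (hc : HasCompactSupport g) {R : ℝ} (hsupp : ∀ x, R < ‖x‖ → g x = 0) (L : ℝ) (N : ℕ) :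
    ∫ x in closedBall (0 : Vec m) R, (1 - ‖x + g x‖ ^ 2 / L ^ 2) ^ N *
        (ContinuousLinearMap.id ℝ (Vec m) + fderiv ℝ g x).det
      = ∫ y in closedBall (0 : Vec m) R, (1 - ‖y‖ ^ 2 / L ^ 2) ^ N := by
  obtain ⟨K, hK⟩ := hg.lipschitzWith_of_hasCompactSupport hc one_ne_zero
  have hdet : ∀ᶠ A : Vec m →L[ℝ] Vec m in nhds 0,
      0 < (ContinuousLinearMap.id ℝ (Vec m) + A).det := by
    have hcont : Continuous fun A : Vec m →L[ℝ] Vec m =>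
        (ContinuousLinearMap.id ℝ (Vec m) + A).det :=
      ContinuousLinearMap.continuous_det.comp (continuous_const.add continuous_id)
    have h0 : 0 < (ContinuousLinearMap.id ℝ (Vec m) + 0).det := by
      simp [ContinuousLinearMap.det]
    exact hcont.continuousAt.eventually (lt_mem_nhds h0)
  obtain ⟨ε, hε, hdet⟩ := Metric.eventually_nhds_iff.1 hdet
  have hcontF : Continuous (fderiv ℝ g) := hg.continuous_fderiv one_ne_zero
  -- Below `t₀` two things hold together: `t K < 1`, so that `id + t g` is bijective, and `‖t g'‖ <
  -- ε`, so that its Jacobian determinant is positive and the absolute value in the change of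
  -- variables can be dropped.
  let t₀ : ℝ := min 1 ε / (K + 1)
  have hK1 : (0 : ℝ) < K + 1 := by positivity
  have ht₀ : 0 < t₀ := div_pos (lt_min one_pos hε) hK1
  let J : ℝ → Vec m → ℝ := fun t x => (1 - ‖x + t • g x‖ ^ 2 / L ^ 2) ^ N *
        (ContinuousLinearMap.id ℝ (Vec m) + t • fderiv ℝ g x).det
  have hJcont : ∀ t, Continuous (J t) := by
    intro t
    have h1 := hg.continuous
    refine Continuous.mul (by fun_prop) ?_
    exact ContinuousLinearMap.continuous_det.comp (continuous_const.add (hcontF.const_smul t))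
  have hsmall : ∀ t, 0 ≤ t → t < t₀ → ∫ x in closedBall (0 : Vec m) R, J t x
      = ∫ y in closedBall (0 : Vec m) R, (1 - ‖y‖ ^ 2 / L ^ 2) ^ N := by
    intro t ht ht'
    have htK' : t * (K + 1) < min 1 ε := (lt_div_iff₀ hK1).1 ht'
    have htK : t * K < 1 := by
      have := min_le_left 1 ε
      nlinarith
    have htε : t * K < ε := by
      have := min_le_right 1 ε
      nlinarith
    obtain ⟨hinj, himg⟩ := image_closedBall_eq hK ht htK hsupp
    have hd : ∀ x ∈ closedBall (0 : Vec m) R, HasFDerivWithinAt (fun x => x + t • g x)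
        (ContinuousLinearMap.id ℝ (Vec m) + t • fderiv ℝ g x) (closedBall 0 R) x := by
      intro x _
      exact ((hasFDerivAt_id x).add
        (((hg.differentiable one_ne_zero) x).hasFDerivAt.const_smul t)).hasFDerivWithinAt
    have h := integral_image_eq_integral_abs_det_fderiv_smul volume
      isClosed_closedBall.measurableSet hd hinj.injOn
      (fun y => (1 - ‖y‖ ^ 2 / L ^ 2) ^ N)
    rw [himg] at h
    rw [h]
    refine integral_congr_ae (Filter.Eventually.of_forall fun x => ?_)
    have hpos : 0 < (ContinuousLinearMap.id ℝ (Vec m) + t • fderiv ℝ g x).det := by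
      apply hdet
      rw [dist_zero_right, norm_smul, Real.norm_of_nonneg ht]
      exact (mul_le_mul_of_nonneg_left (norm_fderiv_le_of_lipschitz ℝ hK) ht).trans_lt htε
    simp only [J, smul_eq_mul, abs_of_pos hpos]
    ring
  obtain ⟨τ, c, hτ, hp⟩ := exists_extrapolation (2 * N + m) ht₀
  -- Nodes and weights do not depend on `x`, so the pointwise extrapolation can be integrated term
  -- by term.
  have hJ1 : ∀ x, J 1 x = ∑ i, c i * J (τ i) x := by
    intro x
    obtain ⟨p, hdeg, hpe⟩ := exists_polynomial_eval_eq x (g x) (fderiv ℝ g x) L N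
    have := hp p hdeg
    simpa only [hpe] using this
  have hsum : ∑ i, c i = 1 := by
    have := hp 1 (by simp)
    simpa using this.symm
  have hint : ∀ t, IntegrableOn (J t) (closedBall 0 R) := fun t =>
    (hJcont t).continuousOn.integrableOn_compact (isCompact_closedBall _ _)
  calc _ = ∫ x in closedBall (0 : Vec m) R, J 1 x := by simp [J]
    _ = ∫ x in closedBall (0 : Vec m) R, ∑ i, c i * J (τ i) x := by simp_rw [hJ1]
    _ = ∑ i, c i * ∫ x in closedBall (0 : Vec m) R, J (τ i) x := by
      rw [integral_finsetSum _ fun i _ => (hint (τ i)).const_mul (c i)]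
      simp_rw [integral_const_mul]
    _ = _ := by
      rw [Finset.sum_congr rfl fun i _ => by rw [hsmall _ (hτ i).1 (hτ i).2], ← Finset.sum_mul,
        hsum, one_mul]

/-- A compactly supported `C¹` perturbation of the identity has a zero. -/
lemma exists_add_eq_zero {g : Vec m → Vec m} (hg : ContDiff ℝ 1 g)
    (hc : HasCompactSupport g) : ∃ x, x + g x = 0 := by
  by_contra! hne
  obtain ⟨R, hR, hsub⟩ := hc.isBounded.subset_closedBall_lt 0 (0 : Vec m)
  have hsupp : ∀ x, R < ‖x‖ → g x = 0 := by
    intro x hx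
    by_contra h
    have := hsub (subset_tsupport g h)
    rw [mem_closedBall, dist_zero_right] at this
    linarith
  have hBc : IsCompact (closedBall (0 : Vec m) R) := isCompact_closedBall _ _
  have hFc : Continuous fun x => ‖x + g x‖ := (continuous_id.add hg.continuous).norm
  have hBne : (closedBall (0 : Vec m) R).Nonempty := ⟨0, by simp [hR.le]⟩
  obtain ⟨x₀, _, hx₀⟩ := hBc.exists_isMinOn hBne hFc.continuousOn
  obtain ⟨x₁, _, hx₁⟩ := hBc.exists_isMaxOn hBne hFc.continuousOn
  -- `ε` is a lower bound for `‖x + g x‖` on the ball, capped by `R` so that the ball of radius `ε /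
  -- 2` fits inside. `L` is an upper bound for `‖x + g x‖` and for `‖x‖`, so the densities are
  -- nonnegative at all points in play.
  set ε := min (‖x₀ + g x₀‖) R with hε
  set L := max (‖x₁ + g x₁‖) R with hL
  have hεpos : 0 < ε := lt_min (norm_pos_iff.2 (hne x₀)) hR
  have hLpos : 0 < L := lt_max_of_lt_right hR
  have hεL : ε ≤ L := (min_le_right _ _).trans (le_max_right _ _)
  set a := 1 - ε ^ 2 / L ^ 2 with ha
  set b := 1 - (ε / 2) ^ 2 / L ^ 2 with hb
  have hdcont : Continuous fun x =>
      (ContinuousLinearMap.id ℝ (Vec m) + fderiv ℝ g x).det :=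
    ContinuousLinearMap.continuous_det.comp
      (continuous_const.add (hg.continuous_fderiv one_ne_zero))
  set Cd := ∫ x in closedBall (0 : Vec m) R,
    |(ContinuousLinearMap.id ℝ (Vec m) + fderiv ℝ g x).det| with hCd
  set v := volume.real (closedBall (0 : Vec m) (ε / 2)) with hv
  have hvpos : 0 < v := by
    refine ENNReal.toReal_pos ?_ ?_
    · exact (measure_closedBall_pos _ _ (by positivity)).ne'
    · exact measure_closedBall_lt_top.ne
  have ha0 : 0 ≤ a := by
    rw [ha, sub_nonneg, ← div_pow]
    exact pow_le_one₀ (by positivity) ((div_le_one hLpos).2 hεL)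
  have hab : a < b := by
    have : (ε / 2) ^ 2 / L ^ 2 < ε ^ 2 / L ^ 2 := by
      apply div_lt_div_of_pos_right _ (by positivity)
      nlinarith
    linarith
  have hden : ∀ y : Vec m, ‖y‖ ≤ L → 0 ≤ 1 - ‖y‖ ^ 2 / L ^ 2 := by
    intro y hy
    rw [sub_nonneg, ← div_pow]
    exact pow_le_one₀ (by positivity) ((div_le_one hLpos).2 hy)
  -- The density is at least `b ^ N` on the ball of radius `ε / 2`, but at most `a ^ N` on the image
  -- of `id + g`. As `a < b`, equality of the two integrals fails for large `N`.
  have key : ∀ N : ℕ, v * b ^ N ≤ Cd * a ^ N := by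
    intro N
    have h := integral_comp_mul_det_eq hg hc hsupp L N
    have hρc : Continuous fun y : Vec m => (1 - ‖y‖ ^ 2 / L ^ 2) ^ N := by fun_prop
    have lower : v * b ^ N ≤ ∫ y in closedBall (0 : Vec m) R, (1 - ‖y‖ ^ 2 / L ^ 2) ^ N := by
      have hss : closedBall (0 : Vec m) (ε / 2) ⊆ closedBall 0 R :=
        closedBall_subset_closedBall (by linarith [min_le_right (‖x₀ + g x₀‖) R])
      calc v * b ^ N = ∫ _ in closedBall (0 : Vec m) (ε / 2), b ^ N := by
            simp [hv, Measure.real]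
        _ ≤ ∫ y in closedBall (0 : Vec m) (ε / 2), (1 - ‖y‖ ^ 2 / L ^ 2) ^ N := by
            refine setIntegral_mono_on ?_ ?_ isClosed_closedBall.measurableSet ?_
            · exact continuous_const.continuousOn.integrableOn_compact (isCompact_closedBall _ _)
            · exact hρc.continuousOn.integrableOn_compact (isCompact_closedBall _ _)
            · intro y hy
              rw [mem_closedBall, dist_zero_right] at hy
              refine pow_le_pow_left₀ (ha0.trans hab.le) ?_ N
              rw [hb]
              gcongr
        _ ≤ _ := by
            refine setIntegral_mono_set ?_ ?_ hss.eventuallyLE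
            · exact hρc.continuousOn.integrableOn_compact hBc
            · filter_upwards [ae_restrict_mem isClosed_closedBall.measurableSet] with y hy
              rw [mem_closedBall, dist_zero_right] at hy
              exact pow_nonneg (hden y (hy.trans (le_max_right _ _))) N
    have upper : ∫ x in closedBall (0 : Vec m) R, (1 - ‖x + g x‖ ^ 2 / L ^ 2) ^ N *
        (ContinuousLinearMap.id ℝ (Vec m) + fderiv ℝ g x).det ≤ Cd * a ^ N := by
      rw [hCd, ← integral_mul_const]
      have hxc : Continuous fun x => x + g x := continuous_id.add hg.continuous
      refine setIntegral_mono_on ?_ ?_ isClosed_closedBall.measurableSet ?_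
      · exact ((hρc.comp hxc).mul hdcont).continuousOn.integrableOn_compact hBc
      · exact (hdcont.abs.mul continuous_const).continuousOn.integrableOn_compact hBc
      · intro x hx
        rw [mul_comm]
        have h1 : ‖x + g x‖ ≤ L := (hx₁ hx).trans (le_max_left _ _)
        have h2 : ε ≤ ‖x + g x‖ := (min_le_left _ _).trans (hx₀ hx)
        refine (mul_le_mul_of_nonneg_right (le_abs_self _) (pow_nonneg (hden _ h1) N)).trans ?_
        refine mul_le_mul_of_nonneg_left ?_ (abs_nonneg _)
        refine pow_le_pow_left₀ (hden _ h1) ?_ N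
        rw [ha]
        gcongr
    linarith
  have hb0 : 0 < b := ha0.trans_lt hab
  have hlim : Filter.Tendsto (fun N : ℕ => Cd * (a / b) ^ N) Filter.atTop (nhds (Cd * 0)) :=
    (tendsto_pow_atTop_nhds_zero_of_lt_one (by positivity) ((div_lt_one hb0).2 hab)).const_mul _
  rw [mul_zero] at hlim
  have := ge_of_tendsto' hlim (b := v) fun N => by
    rw [div_pow, ← mul_div_assoc, le_div_iff₀ (by positivity)]
    exact key N
  linarith

/-- A continuous vector field pointing outwards far from the origin has a zero. -/
theorem exists_eq_zero_of_inner_pos {P : Vec m → Vec m} (hP : Continuous P) {R : ℝ}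
    (h : ∀ x, R ≤ ‖x‖ → 0 < inner ℝ (P x) x) : ∃ x, P x = 0 := by
  by_contra! hne
  -- The cutoff deforms `P` into the identity across `R ≤ ‖x‖ ≤ R + 1`. No zero is created there,
  -- because both `P x` and `x` have positive inner product with `x`.
  let χ : Vec m → ℝ := fun x => max 0 (min 1 (‖x‖ - R))
  have hχ : Continuous χ := by fun_prop
  let f : Vec m → Vec m := fun x => χ x • x + (1 - χ x) • P x
  have hf : Continuous f := by fun_prop
  have hfne : ∀ x, f x ≠ 0 := by
    intro x hx
    by_cases hxR : R ≤ ‖x‖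
    · have hpos := h x hxR
      have hx0 : x ≠ 0 := by
        rintro rfl
        simp at hpos
      have h0 : inner ℝ (f x) x = 0 := by rw [hx, inner_zero_left]
      simp only [f, inner_add_left, inner_smul_left, real_inner_self_eq_norm_sq] at h0
      have hχ0 : 0 ≤ χ x := le_max_left _ _
      have hχ1 : χ x ≤ 1 := max_le zero_le_one (min_le_left _ _)
      have hn : 0 < ‖x‖ ^ 2 := by positivity
      simp only [conj_trivial] at h0
      rcases eq_or_lt_of_le hχ0 with h00 | h00
      · rw [← h00] at h0
        linarith
      · nlinarith [mul_pos h00 hn, mul_nonneg (sub_nonneg.2 hχ1) hpos.le]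
    · have : χ x = 0 := by
        simp only [χ]
        exact max_eq_left ((min_le_right _ _).trans (by linarith))
      simp [f, this, hne x] at hx
  have hfar : ∀ x, R + 1 ≤ ‖x‖ → f x = x := by
    intro x hx
    have : χ x = 1 := by
      simp only [χ]
      rw [min_eq_left (by linarith)]
      simp
    simp [f, this]
  have hS : IsClosed {x : Vec m | R + 2 ≤ ‖x‖} := isClosed_le continuous_const continuous_norm
  have hU : {x : Vec m | R + 1 < ‖x‖} ∈ nhdsSet {x : Vec m | R + 2 ≤ ‖x‖} := by
    refine (isOpen_lt continuous_const continuous_norm).mem_nhdsSet.2 fun x hx => ?_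
    simp only [Set.mem_ofPred_eq] at hx ⊢
    linarith
  have hfU : ContDiffOn ℝ 1 f {x : Vec m | R + 1 < ‖x‖} :=
    contDiff_id.contDiffOn.congr fun x hx => hfar x (le_of_lt hx)
  -- The admitted error at `x` is `‖f x‖` itself, so the smooth approximation has no zeros either;
  -- it equals the identity far out, so `F - id` has compact support.
  obtain ⟨F, hF, hFf, hFS, -⟩ := hf.exists_contDiff_approx_and_eqOn 1 hf.norm
    (fun x => norm_pos_iff.2 (hfne x)) hS hU hfU
  have hFne : ∀ x, F x ≠ 0 := by
    intro x hx
    have := hFf x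
    rw [hx, dist_zero_left] at this
    exact lt_irrefl _ this
  have hcs : HasCompactSupport fun x => F x - x := by
    refine HasCompactSupport.intro (isCompact_closedBall (0 : Vec m) (R + 2)) fun x hx => ?_
    rw [mem_closedBall, dist_zero_right, not_le] at hx
    rw [hFS (show x ∈ {x : Vec m | R + 2 ≤ ‖x‖} from hx.le), hfar x (by linarith), sub_self]
  obtain ⟨x, hx⟩ := exists_add_eq_zero (hF.sub contDiff_id) hcs
  exact hFne x (by simpa using hx)

end Brouwer

/-! ### Trilinear forms on `H¹₀` and their bounds -/

section Forms

variable {d : ℕ} {Ω : Set (Vec d)}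

lemma vel_sub (u v : H10 Ω) : vel (u - v) = vel u - vel v := rfl
lemma vel_zero : vel (0 : H10 Ω) = 0 := rfl
lemma grad_smul (a : ℝ) (u : H10 Ω) : grad (a • u) = a • grad u := rfl
lemma grad_zero : grad (0 : H10 Ω) = 0 := rfl

/-- The velocity field as a linear map. -/
def velₗ : H10 Ω →ₗ[ℝ] L2Vec Ω where
  toFun := vel
  map_add' _ _ := rfl
  map_smul' _ _ := rfl

/-- The weak gradient as a linear map. -/
def gradₗ : H10 Ω →ₗ[ℝ] L2Mat Ω where
  toFun := grad
  map_add' _ _ := rfl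
  map_smul' _ _ := rfl

@[simp] lemma gradₗ_apply (u : H10 Ω) : gradₗ u = grad u := rfl

lemma continuous_vel : Continuous (vel : H10 Ω → L2Vec Ω) :=
  continuous_fst.comp continuous_subtype_val

lemma continuous_grad : Continuous (grad : H10 Ω → L2Mat Ω) :=
  continuous_snd.comp continuous_subtype_val

lemma norm_eq_max (u : H10 Ω) : ‖u‖ = max ‖vel u‖ ‖grad u‖ := rfl

lemma ext_vel_grad {u v : H10 Ω} (h : vel u = vel v) (h' : grad u = grad v) : u = v :=
  Subtype.ext (Prod.ext h h')

lemma coeFn_vel_add (u v : H10 Ω) :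
    ∀ᵐ x ∂volume.restrict Ω, vel (u + v) x = vel u x + vel v x := Lp.coeFn_add _ _

lemma coeFn_vel_smul (a : ℝ) (u : H10 Ω) :
    ∀ᵐ x ∂volume.restrict Ω, vel (a • u) x = a • vel u x := Lp.coeFn_smul _ _

lemma coeFn_grad_add (u v : H10 Ω) :
    ∀ᵐ x ∂volume.restrict Ω, grad (u + v) x = grad u x + grad v x := Lp.coeFn_add _ _

lemma coeFn_grad_smul (a : ℝ) (u : H10 Ω) :
    ∀ᵐ x ∂volume.restrict Ω, grad (a • u) x = a • grad u x := Lp.coeFn_smul _ _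

/-- The velocity is bounded by `A` almost everywhere. -/
def VelBound (u : H10 Ω) (A : ℝ) : Prop := ∀ᵐ x ∂volume.restrict Ω, ‖vel u x‖ ≤ A

/-- The gradient is bounded by `A` almost everywhere. -/
def GradBound (u : H10 Ω) (A : ℝ) : Prop := ∀ᵐ x ∂volume.restrict Ω, ‖grad u x‖ ≤ A

section L2

variable {α E F : Type*} [MeasurableSpace α] {μ : Measure α} [NormedAddCommGroup E]
  [NormedAddCommGroup F]

lemma integrable_norm_mul_norm (f : Lp E 2 μ) (g : Lp F 2 μ) :
    Integrable (fun x => ‖f x‖ * ‖g x‖) μ :=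
  (Lp.memLp f).norm.integrable_mul (Lp.memLp g).norm

lemma integral_norm_mul_norm_le (f : Lp E 2 μ) (g : Lp F 2 μ) :
    ∫ x, ‖f x‖ * ‖g x‖ ∂μ ≤ ‖f‖ * ‖g‖ := by
  have hf := (Lp.memLp f).norm
  have hg := (Lp.memLp g).norm
  have h := real_inner_le_norm (hf.toLp) (hg.toLp)
  rw [L2.inner_def] at h
  have h1 : ‖hf.toLp‖ = ‖f‖ := by
    rw [Lp.norm_toLp, Lp.norm_def, eLpNorm_norm]
  have h2 : ‖hg.toLp‖ = ‖g‖ := by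
    rw [Lp.norm_toLp, Lp.norm_def, eLpNorm_norm]
  rw [h1, h2] at h
  refine le_trans (le_of_eq ?_) h
  refine integral_congr_ae ?_
  filter_upwards [hf.coeFn_toLp, hg.coeFn_toLp] with x h3 h4
  rw [h3, h4]
  simp [mul_comm]

lemma norm_sq_eq_integral [InnerProductSpace ℝ E] (f : Lp E 2 μ) :
    ‖f‖ ^ 2 = ∫ x, ‖f x‖ ^ 2 ∂μ := by
  rw [← real_inner_self_eq_norm_sq, L2.inner_def]
  simp

lemma integrable_norm_sq (f : Lp E 2 μ) : Integrable (fun x => ‖f x‖ ^ 2) μ := by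
  simpa [sq] using integrable_norm_mul_norm f f

lemma aestronglyMeasurable_trilinear {G : Type*} [NormedAddCommGroup G] [NormedSpace ℝ E]
    [NormedSpace ℝ F] [NormedSpace ℝ G] (Φ : E →L[ℝ] F →L[ℝ] G →L[ℝ] ℝ) (f : Lp E 2 μ)
    (g : Lp F 2 μ) (k : Lp G 2 μ) : AEStronglyMeasurable (fun x => Φ (f x) (g x) (k x)) μ :=
  ContinuousLinearMap.aestronglyMeasurable_comp₂ (ContinuousLinearMap.id ℝ (G →L[ℝ] ℝ))
    (ContinuousLinearMap.aestronglyMeasurable_comp₂ Φ (Lp.aestronglyMeasurable f)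
      (Lp.aestronglyMeasurable g)) (Lp.aestronglyMeasurable k)

end L2

/-- Trilinear forms in a velocity, a gradient and a velocity. -/
abbrev Tensor (d : ℕ) := Vec d →L[ℝ] Mat d →L[ℝ] Vec d →L[ℝ] ℝ

/-- A coordinate of a vector. -/
abbrev coordVec (i : Fin d) : Vec d →L[ℝ] ℝ := EuclideanSpace.proj i

/-- An entry of a matrix. -/
abbrev coordMat (p : Fin d × Fin d) : Mat d →L[ℝ] ℝ := EuclideanSpace.proj p

/-- `(a, G, c) ↦ ∑ G_{ij} a_j c_i`. -/
def convTensor (d : ℕ) : Tensor d :=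
  ∑ i, ∑ j, (coordVec j).smulRight
    ((coordMat (i, j)).smulRight
      (coordVec i))

/-- `(a, G, c) ↦ (tr G) ∑ a_k c_k`. -/
def divTensor (d : ℕ) : Tensor d :=
  ∑ i, ∑ k, (coordVec k).smulRight
    ((coordMat (i, i)).smulRight
      (coordVec k))

lemma convTensor_apply (a c : Vec d) (G : Mat d) :
    convTensor d a G c = ∑ i, (∑ j, a j * G (i, j)) * c i := by
  simp [convTensor, Finset.sum_mul, mul_assoc, _root_.sum_apply]

lemma divTensor_apply (a c : Vec d) (G : Mat d) :
    divTensor d a G c = (∑ i, G (i, i)) * ∑ k, a k * c k := by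
  simp only [divTensor, _root_.sum_apply, Finset.sum_mul_sum]
  refine Finset.sum_congr rfl fun i _ => Finset.sum_congr rfl fun k _ => ?_
  simp; ring

lemma Tensor.abs_le (Φ : Tensor d) (a c : Vec d) (G : Mat d) :
    |Φ a G c| ≤ ‖Φ‖ * ‖a‖ * ‖G‖ * ‖c‖ := by
  rw [← Real.norm_eq_abs]
  exact ((Φ a G).le_opNorm c).trans (mul_le_mul_of_nonneg_right (Φ.le_opNorm₂ a G)
    (norm_nonneg _))

/-- The integrand of a trilinear form on `H¹₀`. -/
def triFun (Φ : Tensor d) (u v w : H10 Ω) (x : Vec d) : ℝ := Φ (vel u x) (grad v x) (vel w x)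

/-- The trilinear form on `H¹₀` with a given tensor. -/
def tri (Φ : Tensor d) (u v w : H10 Ω) : ℝ := ∫ x in Ω, triFun Φ u v w x

lemma aestronglyMeasurable_triFun (Φ : Tensor d) (u v w : H10 Ω) :
    AEStronglyMeasurable (triFun Φ u v w) (volume.restrict Ω) :=
  aestronglyMeasurable_trilinear Φ _ _ _

section Bounds

variable (Φ : Tensor d) {u v w : H10 Ω} {A : ℝ}

/-- A product of three `L²` functions need not be integrable. If any one factor is bounded, the
Cauchy–Schwarz inequality handles the other two; this lemma and its two companions cover the three
choices. -/
lemma abs_triFun_le_of_velBound_left (hA : VelBound u A) : ∀ᵐ x ∂volume.restrict Ω,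
    ‖triFun Φ u v w x‖ ≤ ‖Φ‖ * A * (‖grad v x‖ * ‖vel w x‖) := by
  filter_upwards [hA] with x hx
  refine (Tensor.abs_le Φ _ _ _).trans ?_
  rw [← mul_assoc]
  gcongr

lemma abs_triFun_le_of_gradBound (hA : GradBound v A) : ∀ᵐ x ∂volume.restrict Ω,
    ‖triFun Φ u v w x‖ ≤ ‖Φ‖ * A * (‖vel u x‖ * ‖vel w x‖) := by
  filter_upwards [hA] with x hx
  refine (Tensor.abs_le Φ _ _ _).trans ?_
  calc _ = ‖Φ‖ * ‖grad v x‖ * (‖vel u x‖ * ‖vel w x‖) := by ring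
    _ ≤ _ := by gcongr

lemma abs_triFun_le_of_velBound_right (hA : VelBound w A) : ∀ᵐ x ∂volume.restrict Ω,
    ‖triFun Φ u v w x‖ ≤ ‖Φ‖ * A * (‖vel u x‖ * ‖grad v x‖) := by
  filter_upwards [hA] with x hx
  refine (Tensor.abs_le Φ _ _ _).trans ?_
  calc _ = ‖Φ‖ * ‖vel w x‖ * (‖vel u x‖ * ‖grad v x‖) := by ring
    _ ≤ _ := by gcongr

/-- Integrability of the integrand of a trilinear form. -/
def TriInt (Φ : Tensor d) (u v w : H10 Ω) : Prop :=
  Integrable (triFun Φ u v w) (volume.restrict Ω)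

lemma triInt_of_velBound_left (hA : VelBound u A) : TriInt Φ u v w :=
  ((integrable_norm_mul_norm _ _).const_mul _).mono' (aestronglyMeasurable_triFun Φ u v w)
    (abs_triFun_le_of_velBound_left Φ hA)

lemma triInt_of_gradBound (hA : GradBound v A) : TriInt Φ u v w :=
  ((integrable_norm_mul_norm _ _).const_mul _).mono' (aestronglyMeasurable_triFun Φ u v w)
    (abs_triFun_le_of_gradBound Φ hA)

lemma triInt_of_velBound_right (hA : VelBound w A) : TriInt Φ u v w :=
  ((integrable_norm_mul_norm _ _).const_mul _).mono' (aestronglyMeasurable_triFun Φ u v w)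
    (abs_triFun_le_of_velBound_right Φ hA)

lemma abs_integral_le_mul_norm {E F : Type*} [NormedAddCommGroup E] [NormedAddCommGroup F]
    {μ : Measure (Vec d)} {k : Vec d → ℝ} {c : ℝ} (hc : 0 ≤ c) (f : Lp E 2 μ) (g : Lp F 2 μ)
    (h : ∀ᵐ x ∂μ, ‖k x‖ ≤ c * (‖f x‖ * ‖g x‖)) : |∫ x, k x ∂μ| ≤ c * (‖f‖ * ‖g‖) := by
  rw [← Real.norm_eq_abs]
  refine (norm_integral_le_of_norm_le ((integrable_norm_mul_norm f g).const_mul c) h).trans ?_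
  rw [integral_const_mul]
  exact mul_le_mul_of_nonneg_left (integral_norm_mul_norm_le f g) hc

lemma abs_tri_le_of_velBound_left (hA0 : 0 ≤ A) (hA : VelBound u A) :
    |tri Φ u v w| ≤ ‖Φ‖ * A * (‖grad v‖ * ‖vel w‖) :=
  abs_integral_le_mul_norm (by positivity) _ _ (abs_triFun_le_of_velBound_left Φ hA)

lemma abs_tri_le_of_gradBound (hA0 : 0 ≤ A) (hA : GradBound v A) :
    |tri Φ u v w| ≤ ‖Φ‖ * A * (‖vel u‖ * ‖vel w‖) :=
  abs_integral_le_mul_norm (by positivity) _ _ (abs_triFun_le_of_gradBound Φ hA)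

lemma abs_tri_le_of_velBound_right (hA0 : 0 ≤ A) (hA : VelBound w A) :
    |tri Φ u v w| ≤ ‖Φ‖ * A * (‖vel u‖ * ‖grad v‖) :=
  abs_integral_le_mul_norm (by positivity) _ _ (abs_triFun_le_of_velBound_right Φ hA)

end Bounds

section Linearity

variable {Φ : Tensor d}

lemma tri_add_left {u u' v w : H10 Ω} (h : TriInt Φ u v w) (h' : TriInt Φ u' v w) :
    tri Φ (u + u') v w = tri Φ u v w + tri Φ u' v w := by
  rw [tri, tri, tri, ← integral_add h h']
  refine integral_congr_ae ?_
  filter_upwards [coeFn_vel_add u u'] with x hx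
  simp only [triFun, hx]
  simp

lemma tri_add_mid {u v v' w : H10 Ω} (h : TriInt Φ u v w) (h' : TriInt Φ u v' w) :
    tri Φ u (v + v') w = tri Φ u v w + tri Φ u v' w := by
  rw [tri, tri, tri, ← integral_add h h']
  refine integral_congr_ae ?_
  filter_upwards [coeFn_grad_add v v'] with x hx
  simp only [triFun, hx]
  simp

lemma tri_add_right {u v w w' : H10 Ω} (h : TriInt Φ u v w) (h' : TriInt Φ u v w') :
    tri Φ u v (w + w') = tri Φ u v w + tri Φ u v w' := by
  rw [tri, tri, tri, ← integral_add h h']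
  refine integral_congr_ae ?_
  filter_upwards [coeFn_vel_add w w'] with x hx
  simp only [triFun, hx]
  simp

lemma tri_smul_left (a : ℝ) (u v w : H10 Ω) : tri Φ (a • u) v w = a * tri Φ u v w := by
  rw [tri, tri, ← integral_const_mul]
  refine integral_congr_ae ?_
  filter_upwards [coeFn_vel_smul a u] with x hx
  simp only [triFun, hx]
  simp

lemma tri_smul_mid (a : ℝ) (u v w : H10 Ω) : tri Φ u (a • v) w = a * tri Φ u v w := by
  rw [tri, tri, ← integral_const_mul]
  refine integral_congr_ae ?_
  filter_upwards [coeFn_grad_smul a v] with x hx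
  simp only [triFun, hx]
  simp

lemma tri_smul_right (a : ℝ) (u v w : H10 Ω) : tri Φ u v (a • w) = a * tri Φ u v w := by
  rw [tri, tri, ← integral_const_mul]
  refine integral_congr_ae ?_
  filter_upwards [coeFn_vel_smul a w] with x hx
  simp only [triFun, hx]
  simp

end Linearity

/-- The elements of `H¹₀` with bounded velocity and bounded gradient. -/
def bddSubmodule (Ω : Set (Vec d)) : Submodule ℝ (H10 Ω) where
  carrier := {u | ∃ A, VelBound u A ∧ GradBound u A}
  zero_mem' := by
    refine ⟨0, ?_, ?_⟩
    · filter_upwards [Lp.coeFn_zero (Vec d) 2 (volume.restrict Ω)] with x hx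
      rw [vel_zero, hx]
      simp
    · filter_upwards [Lp.coeFn_zero (Mat d) 2 (volume.restrict Ω)] with x hx
      rw [grad_zero, hx]
      simp
  add_mem' := by
    rintro u v ⟨A, hA, hA'⟩ ⟨B, hB, hB'⟩
    refine ⟨A + B, ?_, ?_⟩
    · filter_upwards [hA, hB, coeFn_vel_add u v] with x h1 h2 h3
      rw [h3]
      exact (norm_add_le _ _).trans (add_le_add h1 h2)
    · filter_upwards [hA', hB', coeFn_grad_add u v] with x h1 h2 h3
      rw [h3]
      exact (norm_add_le _ _).trans (add_le_add h1 h2)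
  smul_mem' := by
    rintro a u ⟨A, hA, hA'⟩
    refine ⟨|a| * A, ?_, ?_⟩
    · filter_upwards [hA, coeFn_vel_smul a u] with x h1 h3
      rw [h3, norm_smul, Real.norm_eq_abs]
      exact mul_le_mul_of_nonneg_left h1 (abs_nonneg _)
    · filter_upwards [hA', coeFn_grad_smul a u] with x h1 h3
      rw [h3, norm_smul, Real.norm_eq_abs]
      exact mul_le_mul_of_nonneg_left h1 (abs_nonneg _)

lemma triInt_of_mem (Φ : Tensor d) {u : H10 Ω} (hu : u ∈ bddSubmodule Ω) (v w : H10 Ω) :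
    TriInt Φ u v w := by
  obtain ⟨A, hA, -⟩ := hu
  exact triInt_of_velBound_left Φ hA

lemma bForm_eq (u v w : H10 Ω) : bForm u v w = tri (convTensor d) u v w := by
  simp only [bForm, tri, triFun, convTensor_apply]

/-- Expanding the symmetric part, `2 (D(u) v, w) = (v · ∇u, w) + (w · ∇u, v)`. Thus EMAC uses the
same two tensors as SKEW and transport, with only the roles of the arguments changed. -/
lemma cForm_eq (u : H10 Ω) {v w : H10 Ω} (hv : v ∈ bddSubmodule Ω) (hw : w ∈ bddSubmodule Ω) :
    cForm u v w = tri (convTensor d) v u w + tri (convTensor d) w u v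
      + tri (divTensor d) v u w := by
  rw [cForm]
  congr 1
  · rw [tri, tri, ← integral_add (triInt_of_mem _ hv _ _) (triInt_of_mem _ hw _ _),
      ← integral_const_mul]
    refine integral_congr_ae (Filter.Eventually.of_forall fun x => ?_)
    simp only [triFun, convTensor_apply, symGrad, Finset.sum_mul, Finset.mul_sum]
    rw [Finset.sum_comm (f := fun i j => vel w x j * grad u x (i, j) * vel v x i)]
    simp only [← Finset.sum_add_distrib]
    refine Finset.sum_congr rfl fun i _ => Finset.sum_congr rfl fun j _ => ?_
    ring
  · simp only [tri, triFun, divTensor_apply, divg]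

lemma form_skew_eq (u v w : H10 Ω) : Formulation.skew.form u v w
    = (1 / 2) * (tri (convTensor d) u v w - tri (convTensor d) u w v) := by
  simp only [Formulation.form, bStar, bForm_eq]

lemma form_emac_eq (u : H10 Ω) {v w : H10 Ω} (hv : v ∈ bddSubmodule Ω)
    (hw : w ∈ bddSubmodule Ω) : Formulation.emac.form u v w
    = tri (convTensor d) v u w + tri (convTensor d) w u v + tri (divTensor d) v u w :=
  cForm_eq u hv hw

section FormLinearity

variable (F : Formulation) {u u' v v' w w' : H10 Ω}

/-- Additivity needs bounded arguments: the integral of a non-integrable function is zero by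
convention, so splitting a sum requires integrability of each part. -/
lemma form_add_left (hu : u ∈ bddSubmodule Ω) (hu' : u' ∈ bddSubmodule Ω)
    (hv : v ∈ bddSubmodule Ω) (hw : w ∈ bddSubmodule Ω) :
    F.form (u + u') v w = F.form u v w + F.form u' v w := by
  cases F
  · simp only [form_skew_eq]
    rw [tri_add_left (triInt_of_mem _ hu _ _) (triInt_of_mem _ hu' _ _),
      tri_add_left (triInt_of_mem _ hu _ _) (triInt_of_mem _ hu' _ _)]
    ring
  · simp only [form_emac_eq _ hv hw]
    rw [tri_add_mid (triInt_of_mem _ hv _ _) (triInt_of_mem _ hv _ _),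
      tri_add_mid (triInt_of_mem _ hw _ _) (triInt_of_mem _ hw _ _),
      tri_add_mid (triInt_of_mem _ hv _ _) (triInt_of_mem _ hv _ _)]
    ring

lemma form_add_mid (hu : u ∈ bddSubmodule Ω) (hv : v ∈ bddSubmodule Ω)
    (hv' : v' ∈ bddSubmodule Ω) (hw : w ∈ bddSubmodule Ω) :
    F.form u (v + v') w = F.form u v w + F.form u v' w := by
  cases F
  · simp only [form_skew_eq]
    rw [tri_add_mid (triInt_of_mem _ hu _ _) (triInt_of_mem _ hu _ _),
      tri_add_right (triInt_of_mem _ hu _ _) (triInt_of_mem _ hu _ _)]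
    ring
  · simp only [form_emac_eq _ hv hw, form_emac_eq _ hv' hw,
      form_emac_eq _ (Submodule.add_mem _ hv hv') hw]
    rw [tri_add_left (triInt_of_mem _ hv _ _) (triInt_of_mem _ hv' _ _),
      tri_add_right (triInt_of_mem _ hw _ _) (triInt_of_mem _ hw _ _),
      tri_add_left (triInt_of_mem _ hv _ _) (triInt_of_mem _ hv' _ _)]
    ring

lemma form_add_right (hu : u ∈ bddSubmodule Ω) (hv : v ∈ bddSubmodule Ω)
    (hw : w ∈ bddSubmodule Ω) (hw' : w' ∈ bddSubmodule Ω) :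
    F.form u v (w + w') = F.form u v w + F.form u v w' := by
  cases F
  · simp only [form_skew_eq]
    rw [tri_add_right (triInt_of_mem _ hu _ _) (triInt_of_mem _ hu _ _),
      tri_add_mid (triInt_of_mem _ hu _ _) (triInt_of_mem _ hu _ _)]
    ring
  · simp only [form_emac_eq _ hv hw, form_emac_eq _ hv hw',
      form_emac_eq _ hv (Submodule.add_mem _ hw hw')]
    rw [tri_add_right (triInt_of_mem _ hv _ _) (triInt_of_mem _ hv _ _),
      tri_add_left (triInt_of_mem _ hw _ _) (triInt_of_mem _ hw' _ _),
      tri_add_right (triInt_of_mem _ hv _ _) (triInt_of_mem _ hv _ _)]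
    ring

lemma form_smul_left (a : ℝ) (hv : v ∈ bddSubmodule Ω) (hw : w ∈ bddSubmodule Ω) :
    F.form (a • u) v w = a * F.form u v w := by
  cases F
  · simp only [form_skew_eq, tri_smul_left]
    ring
  · simp only [form_emac_eq _ hv hw, tri_smul_mid]
    ring

lemma form_smul_mid (a : ℝ) (hv : v ∈ bddSubmodule Ω) (hw : w ∈ bddSubmodule Ω) :
    F.form u (a • v) w = a * F.form u v w := by
  cases F
  · simp only [form_skew_eq, tri_smul_mid, tri_smul_right]
    ring
  · simp only [form_emac_eq _ hv hw, form_emac_eq _ (Submodule.smul_mem _ a hv) hw,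
      tri_smul_left, tri_smul_right]
    ring

lemma form_smul_right (a : ℝ) (hv : v ∈ bddSubmodule Ω) (hw : w ∈ bddSubmodule Ω) :
    F.form u v (a • w) = a * F.form u v w := by
  cases F
  · simp only [form_skew_eq, tri_smul_mid, tri_smul_right]
    ring
  · simp only [form_emac_eq _ hv hw, form_emac_eq _ hv (Submodule.smul_mem _ a hw),
      tri_smul_left, tri_smul_right]
    ring

end FormLinearity

end Forms

/-! ### Integration by parts, energy conservation, Poincaré inequality, dual norm -/

section Density

variable {d : ℕ} {Ω : Set (Vec d)}

/-- A closed property of `H¹₀` that holds for test fields holds everywhere. -/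
lemma test_induction {p : H10 Ω → Prop} (hp : IsClosed {u | p u})
    (h : ∀ u : H10 Ω, u.1 ∈ testGraph Ω → p u) (u : H10 Ω) : p u := by
  obtain ⟨x, hx, hlim⟩ := mem_closure_iff_seq_limit.1
    (show u.1 ∈ closure (testGraph Ω : Set _) from u.2)
  let y : ℕ → H10 Ω := fun n => ⟨x n, subset_closure (hx n)⟩
  have hy : Filter.Tendsto y Filter.atTop (nhds u) := tendsto_subtype_rng.2 hlim
  exact hp.mem_of_tendsto hy (Filter.Eventually.of_forall fun n => h (y n) (hx n))

lemma eq_zero_of_test (ℓ : H10 Ω →ₗ[ℝ] ℝ) (C : ℝ) (hC : ∀ u, |ℓ u| ≤ C * ‖u‖)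
    (h : ∀ u : H10 Ω, u.1 ∈ testGraph Ω → ℓ u = 0) (u : H10 Ω) : ℓ u = 0 := by
  have hcont : Continuous ℓ := (ℓ.mkContinuous C hC).continuous
  exact test_induction (isClosed_eq hcont continuous_const) h u

lemma norm_vel_le (u : H10 Ω) : ‖vel u‖ ≤ ‖u‖ := le_max_left _ _
lemma norm_grad_le (u : H10 Ω) : ‖grad u‖ ≤ ‖u‖ := le_max_right _ _

/-- The classical gradient of a smooth field. -/
lemma classicalGrad_apply {φ : Vec d → Vec d} {x : Vec d} (hφ : DifferentiableAt ℝ φ x)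
    (i j : Fin d) :
    classicalGrad φ x (i, j) = fderiv ℝ (fun y => φ y i) x (EuclideanSpace.single j 1) := by
  have h : HasFDerivAt (fun y => φ y i) ((coordVec i).comp (fderiv ℝ φ x)) x :=
    (coordVec i).hasFDerivAt.comp x hφ.hasFDerivAt
  rw [h.fderiv]
  simp [classicalGrad]

lemma continuous_classicalGrad {φ : Vec d → Vec d} (hφ : ContDiff ℝ ∞ φ) :
    Continuous (classicalGrad φ) := by
  have h := hφ.continuous_fderiv (by simp)
  refine (PiLp.continuous_toLp 2 _).comp (continuous_pi fun p => ?_)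
  exact (coordVec p.1).continuous.comp (h.clm_apply continuous_const)

lemma hasCompactSupport_classicalGrad {φ : Vec d → Vec d} (hc : HasCompactSupport φ) :
    HasCompactSupport (classicalGrad φ) := by
  refine (hc.fderiv (𝕜 := ℝ)).mono fun x hx => ?_
  rw [Function.mem_support] at hx ⊢
  intro h0
  apply hx
  ext p
  simp [classicalGrad, h0]

/-- Test fields are bounded with bounded gradients. -/
lemma test_mem_bddSubmodule {u : H10 Ω} (hu : u.1 ∈ testGraph Ω) : u ∈ bddSubmodule Ω := by
  obtain ⟨φ, hφ, hc, -, h1, h2⟩ := hu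
  obtain ⟨A, hA⟩ := hc.exists_bound_of_continuous hφ.continuous
  obtain ⟨B, hB⟩ := (hasCompactSupport_classicalGrad hc).exists_bound_of_continuous
    (continuous_classicalGrad hφ)
  refine ⟨max A B, ?_, ?_⟩
  · filter_upwards [h1] with x hx
    exact (congrArg norm hx).le.trans ((hA x).trans (le_max_left _ _))
  · filter_upwards [h2] with x hx
    exact (congrArg norm hx).le.trans ((hB x).trans (le_max_right _ _))

lemma integrable_mul_of_compactSupport {f g : Vec d → ℝ} (hf : Continuous f) (hg : Continuous g)
    (hc : HasCompactSupport f) : Integrable (fun x => f x * g x) :=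
  (hf.mul hg).integrable_of_hasCompactSupport hc.mul_right

/-- Integration by parts for smooth functions, one of them with compact support. -/
lemma integral_mul_fderiv_smooth {f g : Vec d → ℝ} (hf : ContDiff ℝ ∞ f) (hg : ContDiff ℝ ∞ g)
    (hc : HasCompactSupport f) (v : Vec d) :
    ∫ x, f x * fderiv ℝ g x v = -∫ x, fderiv ℝ f x v * g x := by
  have hf' : Continuous fun x => fderiv ℝ f x v :=
    (hf.continuous_fderiv (by simp)).clm_apply continuous_const
  have hg' : Continuous fun x => fderiv ℝ g x v :=
    (hg.continuous_fderiv (by simp)).clm_apply continuous_const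
  refine integral_mul_fderiv_eq_neg_fderiv_mul_of_integrable ?_ ?_ ?_ ?_ ?_
  · exact integrable_mul_of_compactSupport hf' hg.continuous (hc.fderiv_apply (𝕜 := ℝ) v)
  · exact integrable_mul_of_compactSupport hf.continuous hg' hc
  · exact integrable_mul_of_compactSupport hf.continuous hg.continuous hc
  · exact fun x _ => (hf.differentiable (by simp)) x
  · exact fun x _ => (hg.differentiable (by simp)) x

lemma setIntegral_eq_integral_of_tsupport_subset {f : Vec d → ℝ} (h : tsupport f ⊆ Ω) :
    ∫ x in Ω, f x = ∫ x, f x :=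
  setIntegral_eq_integral_of_forall_compl_eq_zero fun _ hx =>
    image_eq_zero_of_notMem_tsupport fun h' => hx (h h')

section CoordFunctional

variable {α ι : Type*} [MeasurableSpace α] {μ : Measure α} [Fintype ι]

/-- The functional is the `L²` inner product with the field `g e_i`. -/
lemma continuous_integral_coord_mul (i : ι) {g : α → ℝ} (hg : MemLp g 2 μ) :
    Continuous fun f : Lp (EuclideanSpace ℝ ι) 2 μ => ∫ x, f x i * g x ∂μ := by
  classical
  have hk : MemLp (fun x => g x • (EuclideanSpace.single i (1 : ℝ) : EuclideanSpace ℝ ι)) 2 μ :=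
    (ContinuousLinearMap.smulRight (ContinuousLinearMap.id ℝ ℝ) _).comp_memLp' hg
  have : (fun f : Lp (EuclideanSpace ℝ ι) 2 μ => ∫ x, f x i * g x ∂μ)
      = fun f => inner ℝ (hk.toLp) f := by
    funext f
    rw [L2.inner_def]
    refine integral_congr_ae ?_
    filter_upwards [hk.coeFn_toLp] with x hx
    rw [hx, inner_smul_left, EuclideanSpace.inner_single_left]
    simp [mul_comm]
  rw [this]
  exact continuous_const.inner continuous_id

end CoordFunctional

/-- The weak gradient of an element of `H¹₀`: integration by parts against smooth functions with
compact support in the whole space. -/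
lemma integral_vel_mul_fderiv (u : H10 Ω) {g : Vec d → ℝ} (hg : ContDiff ℝ ∞ g)
    (hc : HasCompactSupport g) (i j : Fin d) :
    ∫ x in Ω, vel u x i * fderiv ℝ g x (EuclideanSpace.single j 1)
      = -∫ x in Ω, grad u x (i, j) * g x := by
  have hg' : Continuous fun x => fderiv ℝ g x (EuclideanSpace.single j 1) :=
    (hg.continuous_fderiv (by simp)).clm_apply continuous_const
  have m1 : MemLp (fun x => fderiv ℝ g x (EuclideanSpace.single j 1)) 2 (volume.restrict Ω) :=
    (hg'.memLp_of_hasCompactSupport (hc.fderiv_apply (𝕜 := ℝ) _)).restrict _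
  have m2 : MemLp g 2 (volume.restrict Ω) :=
    (hg.continuous.memLp_of_hasCompactSupport hc).restrict _
  refine test_induction (p := fun u : H10 Ω =>
    ∫ x in Ω, vel u x i * fderiv ℝ g x (EuclideanSpace.single j 1)
      = -∫ x in Ω, grad u x (i, j) * g x) ?_ ?_ u
  · exact isClosed_eq ((continuous_integral_coord_mul i m1).comp continuous_vel)
      ((continuous_integral_coord_mul (i, j) m2).comp continuous_grad).neg
  · rintro u ⟨φ, hφ, hφc, hφs, h1, h2⟩
    have hφi : ContDiff ℝ ∞ fun x => φ x i := (coordVec i).contDiff.comp hφ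
    have hφic : HasCompactSupport fun x => φ x i := hφc.comp_left (g := fun v : Vec d => v i) rfl
    have hφis : tsupport (fun x => φ x i) ⊆ Ω :=
      (closure_mono fun x hx => by
        rw [Function.mem_support] at hx ⊢
        rintro h0
        exact hx (by rw [h0]; rfl)).trans hφs
    have e1 : ∫ x in Ω, vel u x i * fderiv ℝ g x (EuclideanSpace.single j 1)
        = ∫ x, φ x i * fderiv ℝ g x (EuclideanSpace.single j 1) := by
      rw [← setIntegral_eq_integral_of_tsupport_subset (Ω := Ω)
        ((tsupport_mul_subset_left).trans hφis)]
      refine integral_congr_ae ?_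
      filter_upwards [h1] with x hx
      rw [show vel u x = φ x from hx]
    have e2 : ∫ x in Ω, grad u x (i, j) * g x
        = ∫ x, fderiv ℝ (fun y => φ y i) x (EuclideanSpace.single j 1) * g x := by
      rw [← setIntegral_eq_integral_of_tsupport_subset (Ω := Ω)
        ((tsupport_mul_subset_left).trans ((tsupport_fderiv_apply_subset ℝ _).trans hφis))]
      refine integral_congr_ae ?_
      filter_upwards [h2] with x hx
      rw [show grad u x = classicalGrad φ x from hx,
        classicalGrad_apply ((hφ.differentiable (by simp)) x)]
    rw [e1, e2]
    exact integral_mul_fderiv_smooth hφi hg hφic _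

/-- `H¹₀` is the graph of the weak gradient: the velocity determines the gradient. -/
lemma fderiv_ae_eq_of_vel_eq (u : H10 Ω) {U : Set (Vec d)} (hU : IsOpen U) (hUΩ : U ⊆ Ω)
    {i : Fin d} {p : Vec d → ℝ} (hp : ContDiff ℝ ∞ p)
    (h : ∀ᵐ x ∂volume.restrict Ω, x ∈ U → vel u x i = p x) (j : Fin d) :
    ∀ᵐ x ∂volume.restrict Ω, x ∈ U →
      grad u x (i, j) = fderiv ℝ p x (EuclideanSpace.single j 1) := by
  have hp' : Continuous fun x => fderiv ℝ p x (EuclideanSpace.single j 1) :=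
    (hp.continuous_fderiv (by simp)).clm_apply continuous_const
  have hgi : LocallyIntegrable (fun x => grad u x (i, j)) (volume.restrict Ω) := by
    have : MemLp (fun x => grad u x (i, j)) 2 (volume.restrict Ω) :=
      (coordMat (i, j)).comp_memLp' (Lp.memLp (grad u))
    exact this.locallyIntegrable (by norm_num)
  have key : ∀ᵐ x ∂volume.restrict Ω, x ∈ U →
      grad u x (i, j) - fderiv ℝ p x (EuclideanSpace.single j 1) = 0 := by
    -- Fundamental lemma of the calculus of variations: it suffices to integrate against test
    -- functions supported in `U`, where the velocity component may be replaced by `p` and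
    -- integrated by parts classically.
    refine hU.ae_eq_zero_of_integral_contDiff_smul_eq_zero ?_ ?_
    · exact (hgi.sub hp'.locallyIntegrable).locallyIntegrableOn _
    · intro g hg hc hs
      have hgp : ContDiff ℝ ∞ fun x => p x * g x := hp.mul hg
      have hpc : HasCompactSupport fun x => g x * p x := hc.mul_right
      have hsΩ := hs.trans hUΩ
      have e1 := integral_vel_mul_fderiv u hg hc i j
      have hg' : Continuous fun x => fderiv ℝ g x (EuclideanSpace.single j 1) :=
        (hg.continuous_fderiv (by simp)).clm_apply continuous_const
      have e2 : ∫ x in Ω, vel u x i * fderiv ℝ g x (EuclideanSpace.single j 1)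
          = ∫ x in Ω, fderiv ℝ g x (EuclideanSpace.single j 1) * p x := by
        refine integral_congr_ae ?_
        filter_upwards [h] with x hx
        by_cases hxU : x ∈ U
        · rw [hx hxU, mul_comm]
        · have : fderiv ℝ g x (EuclideanSpace.single j 1) = 0 := by
            refine image_eq_zero_of_notMem_tsupport
              (f := fun x => fderiv ℝ g x (EuclideanSpace.single j 1)) fun h' => hxU ?_
            exact hs (tsupport_fderiv_apply_subset ℝ _ h')
          simp [this]
      have e3 : ∫ x in Ω, fderiv ℝ g x (EuclideanSpace.single j 1) * p x
          = -∫ x in Ω, g x * fderiv ℝ p x (EuclideanSpace.single j 1) := by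
        rw [setIntegral_eq_integral_of_tsupport_subset (tsupport_mul_subset_left.trans
          ((tsupport_fderiv_apply_subset ℝ _).trans hsΩ)),
          setIntegral_eq_integral_of_tsupport_subset (tsupport_mul_subset_left.trans hsΩ),
          integral_mul_fderiv_smooth hg hp hc, neg_neg]
      rw [e2, e3, neg_inj] at e1
      have i1 : Integrable (fun x => grad u x (i, j) * g x) (volume.restrict Ω) := by
        have m1 : MemLp (fun x => grad u x (i, j)) 2 (volume.restrict Ω) :=
          (coordMat (i, j)).comp_memLp' (Lp.memLp (grad u))
        exact m1.integrable_mul (q := 2) ((hg.continuous.memLp_of_hasCompactSupport hc).restrict _)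
      have i2 : Integrable (fun x => g x * fderiv ℝ p x (EuclideanSpace.single j 1))
          (volume.restrict Ω) :=
        (integrable_mul_of_compactSupport hg.continuous hp' hc).restrict
      have : ∀ x, g x • (grad u x (i, j) - fderiv ℝ p x (EuclideanSpace.single j 1))
          = grad u x (i, j) * g x - g x * fderiv ℝ p x (EuclideanSpace.single j 1) := by
        intro x
        rw [smul_eq_mul]; ring
      simp_rw [this]
      rw [integral_sub i1 i2, ← e1, sub_self]
  filter_upwards [key] with x hx hxU
  exact sub_eq_zero.1 (hx hxU)

/-- The sum of the three terms of the product rule for `∇ · ((u · v) w)`. -/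
def transport (u v w : H10 Ω) : ℝ :=
  tri (convTensor d) w u v + tri (convTensor d) w v u + tri (divTensor d) u w v

/-- With `u` and `v` test fields, `g = u · v` is an admissible test function for the weak gradient
of `w`. Summing `∫ w_j ∂_j g + ∫ (∂_j w_j) g = 0` over `j` and expanding `∂_j g` gives the three
terms. -/
lemma transport_eq_zero_of_test {u v : H10 Ω} (hu : u.1 ∈ testGraph Ω) (hv : v.1 ∈ testGraph Ω)
    (w : H10 Ω) : transport u v w = 0 := by
  obtain ⟨A, hA, hA'⟩ := test_mem_bddSubmodule hu
  obtain ⟨B, hB, hB'⟩ := test_mem_bddSubmodule hv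
  obtain ⟨φ, hφ, hφc, -, h1, h2⟩ := hu
  obtain ⟨ψ, hψ, hψc, -, h3, h4⟩ := hv
  let g : Vec d → ℝ := fun x => ∑ i, φ x i * ψ x i
  have hφi : ∀ i, ContDiff ℝ ∞ fun x => φ x i := fun i => (coordVec i).contDiff.comp hφ
  have hψi : ∀ i, ContDiff ℝ ∞ fun x => ψ x i := fun i => (coordVec i).contDiff.comp hψ
  have hg : ContDiff ℝ ∞ g := ContDiff.sum fun i _ => (hφi i).mul (hψi i)
  have hgc : HasCompactSupport g := by
    refine hφc.mono fun x hx => ?_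
    rw [Function.mem_support] at hx ⊢
    intro h0
    exact hx (by simp [g, h0])
  have hgd : ∀ x j, fderiv ℝ g x (EuclideanSpace.single j 1)
      = ∑ i, (classicalGrad φ x (i, j) * ψ x i + φ x i * classicalGrad ψ x (i, j)) := by
    intro x j
    have dφ := hφ.differentiable (by simp) x
    have dψ := hψ.differentiable (by simp) x
    have hd : ∀ i ∈ Finset.univ, DifferentiableAt ℝ (fun y => φ y i * ψ y i) x := fun i _ =>
      ((hφi i).differentiable (by simp) x).mul ((hψi i).differentiable (by simp) x)
    rw [show g = fun y => ∑ i, φ y i * ψ y i from rfl, fderiv_fun_sum hd, _root_.sum_apply]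
    refine Finset.sum_congr rfl fun i _ => ?_
    rw [fderiv_fun_mul ((hφi i).differentiable (by simp) x) ((hψi i).differentiable (by simp) x),
      classicalGrad_apply dφ, classicalGrad_apply dψ]
    simp only [_root_.add_apply, _root_.smul_apply, smul_eq_mul]
    ring
  have hg' : ∀ j, Continuous fun x => fderiv ℝ g x (EuclideanSpace.single j 1) := fun j =>
    (hg.continuous_fderiv (by simp)).clm_apply continuous_const
  have m1 : ∀ j, MemLp (fun x => fderiv ℝ g x (EuclideanSpace.single j 1)) 2
      (volume.restrict Ω) := fun j =>
    ((hg' j).memLp_of_hasCompactSupport (hgc.fderiv_apply (𝕜 := ℝ) _)).restrict _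
  have m2 : MemLp g 2 (volume.restrict Ω) :=
    (hg.continuous.memLp_of_hasCompactSupport hgc).restrict _
  have i1 : ∀ j, Integrable (fun x => vel w x j * fderiv ℝ g x (EuclideanSpace.single j 1))
      (volume.restrict Ω) := fun j => by
    have m3 : MemLp (fun x => vel w x j) 2 (volume.restrict Ω) :=
      (coordVec j).comp_memLp' (Lp.memLp (vel w))
    exact m3.integrable_mul (q := 2) (m1 j)
  have i2 : ∀ j, Integrable (fun x => grad w x (j, j) * g x) (volume.restrict Ω) := fun j => by
    have m3 : MemLp (fun x => grad w x (j, j)) 2 (volume.restrict Ω) :=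
      (coordMat (j, j)).comp_memLp' (Lp.memLp (grad w))
    exact m3.integrable_mul (q := 2) m2
  have hsum : ∫ x in Ω, ∑ j, (vel w x j * fderiv ℝ g x (EuclideanSpace.single j 1)
      + grad w x (j, j) * g x) = 0 := by
    have i3 : ∀ j ∈ Finset.univ, Integrable (fun x => vel w x j *
        fderiv ℝ g x (EuclideanSpace.single j 1) + grad w x (j, j) * g x)
        (volume.restrict Ω) := fun j _ => (i1 j).add (i2 j)
    rw [integral_finsetSum _ i3]
    refine Finset.sum_eq_zero fun j _ => ?_
    rw [integral_add (i1 j) (i2 j), integral_vel_mul_fderiv w hg hgc, neg_add_cancel]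
  have t1 : TriInt (convTensor d) w u v := triInt_of_gradBound _ hA'
  have t2 : TriInt (convTensor d) w v u := triInt_of_gradBound _ hB'
  have t3 : TriInt (divTensor d) u w v := triInt_of_velBound_left _ hA
  have t12 : Integrable (fun x => triFun (convTensor d) w u v x + triFun (convTensor d) w v u x)
      (volume.restrict Ω) := t1.add t2
  rw [transport, tri, tri, tri, ← integral_add t1 t2, ← integral_add t12 t3, ← hsum]
  refine integral_congr_ae ?_
  filter_upwards [h1, h2, h3, h4] with x e1 e2 e3 e4
  simp only [triFun, convTensor_apply, divTensor_apply, show vel u x = φ x from e1,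
    show grad u x = classicalGrad φ x from e2, show vel v x = ψ x from e3,
    show grad v x = classicalGrad ψ x from e4, hgd, g]
  rw [Finset.sum_add_distrib, ← Finset.sum_mul]
  congr 1
  simp only [Finset.sum_mul, Finset.mul_sum]
  rw [← Finset.sum_add_distrib, Finset.sum_comm]
  refine Finset.sum_congr rfl fun j _ => ?_
  rw [← Finset.sum_add_distrib]
  refine Finset.sum_congr rfl fun i _ => ?_
  ring

/-- Density is applied to one argument at a time: test fields converging in `H¹` need not be
uniformly bounded, so continuity in `v` has to come from the bounds on `u` and its gradient. The
extension in `u` then uses the bounds on `v` and `w`. -/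
lemma transport_eq_zero_of_test_left {u : H10 Ω} (hu : u.1 ∈ testGraph Ω) (v w : H10 Ω) :
    transport u v w = 0 := by
  obtain ⟨A, hA, hA'⟩ := test_mem_bddSubmodule hu
  have hA := hA.mono fun x hx => hx.trans (le_abs_self A)
  have hA' := hA'.mono fun x hx => hx.trans (le_abs_self A)
  have t1 : ∀ v, TriInt (convTensor d) w u v := fun v => triInt_of_gradBound _ hA'
  have t2 : ∀ v, TriInt (convTensor d) w v u := fun v => triInt_of_velBound_right _ hA
  have t3 : ∀ v, TriInt (divTensor d) u w v := fun v => triInt_of_velBound_left _ hA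
  let ℓ : H10 Ω →ₗ[ℝ] ℝ :=
    { toFun := fun v => transport u v w
      map_add' := fun v v' => by
        simp only [transport]
        rw [tri_add_right (t1 v) (t1 v'), tri_add_mid (t2 v) (t2 v'),
          tri_add_right (t3 v) (t3 v')]
        ring
      map_smul' := fun a v => by
        simp only [transport, tri_smul_right, tri_smul_mid, RingHom.id_apply, smul_eq_mul]
        ring }
  refine eq_zero_of_test ℓ (‖convTensor d‖ * |A| * ‖w‖ + ‖convTensor d‖ * |A| * ‖w‖
    + ‖divTensor d‖ * |A| * ‖w‖) (fun v => ?_)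
    (fun v hv => transport_eq_zero_of_test hu hv w) v
  have b1 := abs_tri_le_of_gradBound (convTensor d) (u := w) (w := v) (abs_nonneg A) hA'
  have b2 := abs_tri_le_of_velBound_right (convTensor d) (u := w) (v := v) (abs_nonneg A) hA
  have b3 := abs_tri_le_of_velBound_left (divTensor d) (v := w) (w := v) (abs_nonneg A) hA
  have c1 : ‖vel w‖ * ‖vel v‖ ≤ ‖w‖ * ‖v‖ := by
    gcongr <;> apply norm_vel_le
  have c2 : ‖vel w‖ * ‖grad v‖ ≤ ‖w‖ * ‖v‖ := by
    gcongr <;> [apply norm_vel_le; apply norm_grad_le]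
  have c3 : ‖grad w‖ * ‖vel v‖ ≤ ‖w‖ * ‖v‖ := by
    gcongr <;> [apply norm_grad_le; apply norm_vel_le]
  have d1 := b1.trans (mul_le_mul_of_nonneg_left c1 (by positivity))
  have d2 := b2.trans (mul_le_mul_of_nonneg_left c2 (by positivity))
  have d3 := b3.trans (mul_le_mul_of_nonneg_left c3 (by positivity))
  calc |ℓ v| ≤ _ := abs_add_three _ _ _
    _ ≤ _ := add_le_add (add_le_add d1 d2) d3
    _ = _ := by ring

/-- The product rule for `∇ · ((u · v) w)`, integrated over the domain. -/
lemma transport_eq_zero (u : H10 Ω) {v w : H10 Ω} (hv : v ∈ bddSubmodule Ω)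
    (hw : w ∈ bddSubmodule Ω) : transport u v w = 0 := by
  obtain ⟨A, hA, -⟩ := hv
  obtain ⟨B, hB, -⟩ := hw
  have hA := hA.mono fun x hx => hx.trans (le_abs_self A)
  have hB := hB.mono fun x hx => hx.trans (le_abs_self B)
  have t1 : ∀ u, TriInt (convTensor d) w u v := fun u => triInt_of_velBound_left _ hB
  have t2 : ∀ u, TriInt (convTensor d) w v u := fun u => triInt_of_velBound_left _ hB
  have t3 : ∀ u, TriInt (divTensor d) u w v := fun u => triInt_of_velBound_right _ hA
  let ℓ : H10 Ω →ₗ[ℝ] ℝ :=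
    { toFun := fun u => transport u v w
      map_add' := fun u u' => by
        simp only [transport]
        rw [tri_add_mid (t1 u) (t1 u'), tri_add_right (t2 u) (t2 u'),
          tri_add_left (t3 u) (t3 u')]
        ring
      map_smul' := fun a u => by
        simp only [transport, tri_smul_right, tri_smul_mid, tri_smul_left, RingHom.id_apply,
          smul_eq_mul]
        ring }
  refine eq_zero_of_test ℓ (‖convTensor d‖ * |B| * ‖v‖ + ‖convTensor d‖ * |B| * ‖v‖
    + ‖divTensor d‖ * |A| * ‖w‖) (fun u => ?_)
    (fun u hu => transport_eq_zero_of_test_left hu v w) u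
  have b1 := abs_tri_le_of_velBound_left (convTensor d) (v := u) (w := v) (abs_nonneg B) hB
  have b2 := abs_tri_le_of_velBound_left (convTensor d) (v := v) (w := u) (abs_nonneg B) hB
  have b3 := abs_tri_le_of_velBound_right (divTensor d) (u := u) (v := w) (abs_nonneg A) hA
  have c1 : ‖grad u‖ * ‖vel v‖ ≤ ‖u‖ * ‖v‖ := by
    gcongr <;> [apply norm_grad_le; apply norm_vel_le]
  have c2 : ‖grad v‖ * ‖vel u‖ ≤ ‖v‖ * ‖u‖ := by
    gcongr <;> [apply norm_grad_le; apply norm_vel_le]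
  have c3 : ‖vel u‖ * ‖grad w‖ ≤ ‖u‖ * ‖w‖ := by
    gcongr <;> [apply norm_vel_le; apply norm_grad_le]
  have d1 := b1.trans (mul_le_mul_of_nonneg_left c1 (by positivity))
  have d2 := b2.trans (mul_le_mul_of_nonneg_left c2 (by positivity))
  have d3 := b3.trans (mul_le_mul_of_nonneg_left c3 (by positivity))
  calc |ℓ u| ≤ _ := abs_add_three _ _ _
    _ ≤ _ := add_le_add (add_le_add d1 d2) d3
    _ = _ := by ring

/-- Both convective terms conserve the kinetic energy. -/
lemma form_self (F : Formulation) {u : H10 Ω} (hu : u ∈ bddSubmodule Ω) : F.form u u u = 0 := by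
  cases F
  · rw [form_skew_eq]
    ring
  · rw [form_emac_eq u hu hu]
    exact transport_eq_zero u hu hu

/-- The Poincaré inequality on a bounded domain. -/
lemma norm_vel_le_norm_grad (hd : 0 < d) {R : ℝ} (hR : ∀ x ∈ Ω, ‖x‖ ≤ R) (hΩ : MeasurableSet Ω)
    (u : H10 Ω) : ‖vel u‖ ≤ 2 * |R| * ‖grad u‖ := by
  refine test_induction (p := fun u : H10 Ω => ‖vel u‖ ≤ 2 * |R| * ‖grad u‖) ?_ ?_ u
  · exact isClosed_le continuous_vel.norm (continuous_const.mul continuous_grad.norm)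
  · rintro u ⟨φ, hφ, hφc, hφs, h1, h2⟩
    let j : Fin d := ⟨0, hd⟩
    let e : Vec d := EuclideanSpace.single j 1
    let g : Vec d → ℝ := fun x => ‖φ x‖ ^ 2
    have hg : ContDiff ℝ ∞ g := hφ.norm_sq ℝ
    have hgc : HasCompactSupport g := hφc.comp_left (g := fun v : Vec d => ‖v‖ ^ 2) (by simp)
    have hgs : tsupport g ⊆ Ω := (closure_mono fun x hx => by
      rw [Function.mem_support] at hx ⊢
      rintro h0
      exact hx (by simp [g, h0])).trans hφs
    have hc : ContDiff ℝ ∞ fun x : Vec d => x j := (coordVec j).contDiff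
    have hcd : ∀ x : Vec d, fderiv ℝ (fun x : Vec d => x j) x e = 1 := by
      intro x
      have : HasFDerivAt (fun x : Vec d => x j) (coordVec j) x := (coordVec j).hasFDerivAt
      rw [this.fderiv]
      simp [e]
    have hgd : ∀ x, fderiv ℝ g x e = 2 * inner ℝ (φ x) (fderiv ℝ φ x e) := by
      intro x
      have := (hφ.differentiable (by simp) x).hasFDerivAt.norm_sq
      rw [this.fderiv]
      simp
    have hφe : ∀ x, ‖fderiv ℝ φ x e‖ ≤ ‖classicalGrad φ x‖ := by
      intro x
      rw [EuclideanSpace.norm_eq, EuclideanSpace.norm_eq]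
      refine Real.sqrt_le_sqrt ?_
      rw [Fintype.sum_prod_type]
      refine Finset.sum_le_sum fun i _ => ?_
      exact Finset.single_le_sum (f := fun k => ‖classicalGrad φ x (i, k)‖ ^ 2)
        (fun k _ => by positivity) (Finset.mem_univ j)
    -- Since `∂_j x_j = 1`, `‖φ‖²` integrates to `-∫ x_j ∂_j |φ|²`, and `|x_j| ≤ |R|` on `Ω`. One
    -- factor `‖vel u‖` is cancelled at the end.
    have hibp := integral_mul_fderiv_smooth hg hc hgc e
    have e1 : ‖vel u‖ ^ 2 = ∫ x in Ω, g x * fderiv ℝ (fun x : Vec d => x j) x e := by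
      rw [norm_sq_eq_integral]
      refine integral_congr_ae ?_
      filter_upwards [h1] with x hx
      rw [hcd, mul_one, show vel u x = φ x from hx]
    have e2 : ‖vel u‖ ^ 2 = -∫ x in Ω, fderiv ℝ g x e * x j := by
      rw [e1, setIntegral_eq_integral_of_tsupport_subset (tsupport_mul_subset_left.trans hgs), hibp,
        setIntegral_eq_integral_of_tsupport_subset (tsupport_mul_subset_left.trans
          ((tsupport_fderiv_apply_subset ℝ _).trans hgs))]
    have e3 : |∫ x in Ω, fderiv ℝ g x e * x j| ≤ 2 * |R| * (‖vel u‖ * ‖grad u‖) := by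
      refine abs_integral_le_mul_norm (by positivity) _ _ ?_
      filter_upwards [h1, h2, ae_restrict_mem hΩ] with x hx hx' hxΩ
      rw [show vel u x = φ x from hx, show grad u x = classicalGrad φ x from hx', norm_mul, hgd,
        norm_mul]
      have a1 : ‖inner ℝ (φ x) (fderiv ℝ φ x e)‖ ≤ ‖φ x‖ * ‖classicalGrad φ x‖ :=
        (norm_inner_le_norm _ _).trans (mul_le_mul_of_nonneg_left (hφe x) (norm_nonneg _))
      have a2 : ‖x j‖ ≤ |R| := (PiLp.norm_apply_le x j).trans ((hR x hxΩ).trans (le_abs_self R))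
      have a3 : ‖(2 : ℝ)‖ = 2 := by simp
      rw [a3]
      calc 2 * ‖inner ℝ (φ x) (fderiv ℝ φ x e)‖ * ‖x j‖
          ≤ 2 * (‖φ x‖ * ‖classicalGrad φ x‖) * |R| := by gcongr
        _ = _ := by ring
    rcases eq_or_lt_of_le (norm_nonneg (vel u)) with h0 | h0
    · rw [← h0]; positivity
    · have e4 : ‖vel u‖ * ‖vel u‖ ≤ ‖vel u‖ * (2 * |R| * ‖grad u‖) := by
        rw [← sq, e2]
        refine (neg_le_abs _).trans (e3.trans (le_of_eq ?_))
        ring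
      exact le_of_mul_le_mul_left e4 h0

/-- The dual norm controls the functional. -/
lemma apply_le_hMinusNorm {C : ℝ} (hC : ∀ u : H10 Ω, ‖vel u‖ ≤ C * ‖grad u‖)
    (f : StrongDual ℝ (H10 Ω)) (v : H10 Ω) : f v ≤ hMinusNorm f * ‖grad v‖ := by
  -- The supremum of an unbounded set is zero by convention, so the dual norm is meaningful only
  -- once boundedness is known. The Poincaré inequality bounds the full `H¹` norm on the gradient
  -- unit ball.
  have hbdd : BddAbove {y | ∃ v : H10 Ω, ‖grad v‖ ≤ 1 ∧ y = f v} := by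
    refine ⟨‖f‖ * max |C| 1, ?_⟩
    rintro _ ⟨v, hv, rfl⟩
    refine (le_abs_self _).trans ((f.le_opNorm v).trans ?_)
    refine mul_le_mul_of_nonneg_left ?_ (norm_nonneg _)
    rw [norm_eq_max]
    refine max_le_max ((hC v).trans ?_) hv
    calc C * ‖grad v‖ ≤ |C| * 1 := mul_le_mul (le_abs_self C) hv (norm_nonneg _) (abs_nonneg _)
      _ = |C| := mul_one _
  rcases eq_or_lt_of_le (norm_nonneg (grad v)) with h0 | h0
  · have hv : v = 0 := by
      have h1 : vel v = 0 := by
        rw [← norm_le_zero_iff]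
        simpa [← h0] using hC v
      exact ext_vel_grad h1 (norm_eq_zero.1 h0.symm)
    simp [hv, grad_zero]
  · have := le_csSup hbdd ⟨‖grad v‖⁻¹ • v, ?_, rfl⟩
    · rw [map_smul, smul_eq_mul, inv_mul_le_iff₀ h0, mul_comm] at this
      exact this
    · rw [grad_smul, norm_smul, norm_inv, norm_norm, inv_mul_cancel₀ h0.ne']

end Density

/-! ### Polynomials as smooth functions -/

section Polynomials

variable {d : ℕ}

/-- The function defined by a polynomial. -/
def polyFun (P : MvPolynomial (Fin d) ℝ) (x : Vec d) : ℝ := MvPolynomial.eval (fun j => x j) P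

lemma contDiff_polyFun (P : MvPolynomial (Fin d) ℝ) : ContDiff ℝ ∞ (polyFun P) := by
  induction P using MvPolynomial.induction_on with
  | C a =>
    have : polyFun (MvPolynomial.C a) = fun _ : Vec d => a := by
      funext x; simp [polyFun]
    rw [this]; exact contDiff_const
  | add p q hp hq =>
    have : polyFun (p + q) = fun x => polyFun p x + polyFun q x := by
      funext x; simp [polyFun]
    rw [this]; exact hp.add hq
  | mul_X p i hp =>
    have : polyFun (p * MvPolynomial.X i) = fun x => polyFun p x * coordVec i x := by
      funext x; simp [polyFun]
    rw [this]; exact hp.mul (coordVec i).contDiff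

lemma continuous_polyFun (P : MvPolynomial (Fin d) ℝ) : Continuous (polyFun P) :=
  (contDiff_polyFun P).continuous

lemma differentiable_polyFun (P : MvPolynomial (Fin d) ℝ) : Differentiable ℝ (polyFun P) :=
  (contDiff_polyFun P).differentiable (by simp)

lemma fderiv_polyFun (P : MvPolynomial (Fin d) ℝ) (x : Vec d) (j : Fin d) :
    fderiv ℝ (polyFun P) x (EuclideanSpace.single j 1) = polyFun (MvPolynomial.pderiv j P) x := by
  induction P using MvPolynomial.induction_on with
  | C a =>
    have : polyFun (MvPolynomial.C a) = fun _ : Vec d => a := by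
      funext x; simp [polyFun]
    rw [this]; simp [polyFun]
  | add p q hp hq =>
    have : polyFun (p + q) = fun x => polyFun p x + polyFun q x := by
      funext x; simp [polyFun]
    rw [this, fderiv_fun_add (differentiable_polyFun p x) (differentiable_polyFun q x),
      _root_.add_apply, hp, hq]
    simp [polyFun]
  | mul_X p i hp =>
    have : polyFun (p * MvPolynomial.X i) = fun x => polyFun p x * coordVec i x := by
      funext x; simp [polyFun]
    rw [this, fderiv_fun_mul (differentiable_polyFun p x) (coordVec i).differentiableAt,
      (coordVec i).fderiv]
    simp only [_root_.add_apply, _root_.smul_apply, smul_eq_mul, hp]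
    rcases eq_or_ne i j with h | h
    · subst h
      simp [polyFun]
    · simp [polyFun, h]

lemma polyFun_add (P Q : MvPolynomial (Fin d) ℝ) (x : Vec d) :
    polyFun (P + Q) x = polyFun P x + polyFun Q x := by simp [polyFun]

lemma polyFun_smul (a : ℝ) (P : MvPolynomial (Fin d) ℝ) (x : Vec d) :
    polyFun (a • P) x = a * polyFun P x := by simp [polyFun, MvPolynomial.smul_eval]

lemma norm_le_card_mul {ι : Type*} [Fintype ι] (v : EuclideanSpace ℝ ι) {a : ℝ}
    (h : ∀ i, |v i| ≤ a) : ‖v‖ ≤ Fintype.card ι * a := by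
  rcases isEmpty_or_nonempty ι with hι | ⟨⟨i₀⟩⟩
  · have : v = 0 := by ext i; exact hι.elim i
    simp [this]
  have ha : 0 ≤ a := (abs_nonneg _).trans (h i₀)
  refine abs_le_of_sq_le_sq' ?_ (by positivity) |>.2
  rw [EuclideanSpace.norm_sq_eq]
  have hc : (1 : ℝ) ≤ Fintype.card ι := by
    exact_mod_cast Fintype.card_pos_iff.2 ⟨i₀⟩
  calc ∑ i, ‖v i‖ ^ 2 ≤ ∑ _i : ι, a ^ 2 :=
        Finset.sum_le_sum fun i _ => pow_le_pow_left₀ (norm_nonneg _) (h i) 2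
    _ = Fintype.card ι * a ^ 2 := by simp
    _ ≤ (Fintype.card ι * a) ^ 2 := by
      rw [mul_pow]
      refine mul_le_mul_of_nonneg_right ?_ (by positivity)
      nlinarith

end Polynomials

/-! ### Mesh geometry and boundedness of finite element functions -/

namespace Triangulation

variable {d : ℕ} {Ω : Set (Vec d)} (𝒯 : Triangulation Ω)

lemma finite_cells : 𝒯.cells.Finite := 𝒯.finite_faces.subset fun _ h => h.1

lemma isCompact_cell (K : Finset (Vec d)) : IsCompact (convexHull ℝ (K : Set (Vec d))) :=
  K.finite_toSet.isCompact_convexHull ℝ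

/-- Boundedness of `Ω` comes from the mesh: the closure is a finite union of compact simplices. -/
lemma isCompact_closure (𝒯 : Triangulation Ω) : IsCompact (closure Ω) := by
  rw [← 𝒯.space_eq]
  exact 𝒯.finite_faces.isCompact_biUnion fun K _ => isCompact_cell K

lemma exists_cell_mem {x : Vec d} (hx : x ∈ closure Ω) :
    ∃ K ∈ 𝒯.cells, x ∈ convexHull ℝ (K : Set (Vec d)) := by
  rw [← 𝒯.space_eq, Geometry.SimplicialComplex.mem_space_iff] at hx
  obtain ⟨t, ht, hxt⟩ := hx
  obtain ⟨K, hK, htK, hcard⟩ := 𝒯.pure t ht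
  exact ⟨K, ⟨hK, hcard⟩, convexHull_mono (by exact_mod_cast htK) hxt⟩

/-- The open simplex of a cell. -/
def openCell (K : Finset (Vec d)) : Set (Vec d) := interior (convexHull ℝ (K : Set (Vec d)))

lemma isOpen_openCell (K : Finset (Vec d)) : IsOpen (openCell K) := isOpen_interior

lemma openCell_subset {K : Finset (Vec d)} (hK : K ∈ 𝒯.cells) : openCell K ⊆ Ω :=
  𝒯.interior_subset K hK.1 hK.2

lemma openCell_subset_cell (K : Finset (Vec d)) :
    openCell K ⊆ convexHull ℝ (K : Set (Vec d)) := _root_.interior_subset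

/-- The boundary of a convex set is null, and there are finitely many cells. -/
lemma ae_mem_openCell : ∀ᵐ x ∂volume.restrict Ω, ∃ K ∈ 𝒯.cells, x ∈ openCell K := by
  have hfr : ∀ᵐ x ∂(volume : Measure (Vec d)), ∀ K ∈ 𝒯.cells,
      x ∉ frontier (convexHull ℝ (K : Set (Vec d))) := by
    rw [ae_ball_iff 𝒯.finite_cells.countable]
    intro K _
    exact measure_eq_zero_iff_ae_notMem.1 ((convex_convexHull ℝ _).addHaar_frontier _)
  have hΩ : ∀ᵐ x ∂volume.restrict Ω, x ∈ closure Ω :=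
    ae_restrict_of_ae_restrict_of_subset subset_closure
      (ae_restrict_mem isClosed_closure.measurableSet)
  filter_upwards [ae_restrict_of_ae hfr, hΩ] with x hx hxΩ
  obtain ⟨K, hK, hxK⟩ := 𝒯.exists_cell_mem hxΩ
  refine ⟨K, hK, ?_⟩
  by_contra h
  exact hx K hK ⟨subset_closure hxK, h⟩

/-- At most `d` points span a proper affine subspace. -/
lemma addHaar_convexHull_eq_zero {S : Finset (Vec d)} (hS : S.card ≤ d) :
    volume (convexHull ℝ (S : Set (Vec d))) = 0 := by
  rcases S.eq_empty_or_nonempty with rfl | hne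
  · simp
  refine measure_mono_null (convexHull_subset_affineSpan _) (Measure.addHaar_affineSubspace _ _ ?_)
  intro htop
  have h1 : vectorSpan ℝ (S : Set (Vec d)) = ⊤ := by
    rw [← direction_affineSpan, htop, AffineSubspace.direction_top]
  have : Nonempty S := hne.to_subtype
  have h2 := finrank_vectorSpan_range_add_one_le ℝ (fun x : S => (x : Vec d))
  rw [Subtype.range_coe_subtype] at h2
  have h3 : vectorSpan ℝ {x | x ∈ S} = ⊤ := h1
  rw [h3, finrank_top, finrank_euclideanSpace, Fintype.card_fin, Fintype.card_coe] at h2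
  omega

/-- By conformity two cells meet in the hull of their common vertices, and distinct cells share at
most `d` of them. -/
lemma openCell_inter_null {K L : Finset (Vec d)} (hK : K ∈ 𝒯.cells) (hL : L ∈ 𝒯.cells)
    (hKL : K ≠ L) : volume (openCell K ∩ openCell L) = 0 := by
  classical
  refine measure_mono_null ((Set.inter_subset_inter (openCell_subset_cell K)
    (openCell_subset_cell L)).trans (𝒯.complex.inter_subset_convexHull hK.1 hL.1)) ?_
  rw [← Finset.coe_inter]
  refine addHaar_convexHull_eq_zero ?_
  have h1 : K ∩ L ⊂ K := by
    refine Finset.inter_subset_left.ssubset_of_ne fun h => hKL ?_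
    exact Finset.eq_of_subset_of_card_le (Finset.inter_eq_left.1 h) (by rw [hK.2, hL.2])
  have := Finset.card_lt_card h1
  rw [hK.2] at this
  omega

variable {𝒯} {k : ℕ} {Xh : Submodule ℝ (H10 Ω)}

/-- On a cell a finite element function is a polynomial field and its weak gradient is the
classical one. -/
lemma IsFESpace.exists_polynomials (hX : 𝒯.IsFESpace k Xh) {u : H10 Ω} (hu : u ∈ Xh)
    {K : Finset (Vec d)} (hK : K ∈ 𝒯.cells) :
    ∃ P : Fin d → MvPolynomial (Fin d) ℝ, (∀ i, (P i).totalDegree ≤ k) ∧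
      ∀ᵐ x ∂volume.restrict Ω, x ∈ openCell K → ∀ i, vel u x i = polyFun (P i) x ∧
        ∀ j, grad u x (i, j) = polyFun (MvPolynomial.pderiv j (P i)) x := by
  obtain ⟨P, hdeg, hP⟩ := hX u hu K hK
  refine ⟨P, hdeg, ?_⟩
  have hvel : ∀ i, ∀ᵐ x ∂volume.restrict Ω, x ∈ openCell K → vel u x i = polyFun (P i) x := by
    intro i
    filter_upwards [hP] with x hx hxK
    exact hx (openCell_subset_cell K hxK) i
  have hgrad : ∀ i j, ∀ᵐ x ∂volume.restrict Ω, x ∈ openCell K →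
      grad u x (i, j) = polyFun (MvPolynomial.pderiv j (P i)) x := by
    intro i j
    filter_upwards [fderiv_ae_eq_of_vel_eq u (isOpen_openCell K) (𝒯.openCell_subset hK)
      (contDiff_polyFun (P i)) (hvel i) j] with x hx hxK
    rw [hx hxK, fderiv_polyFun]
  filter_upwards [ae_all_iff.2 hvel, ae_all_iff.2 fun i => ae_all_iff.2 (hgrad i)]
    with x h1 h2 hxK i
  exact ⟨h1 i hxK, fun j => h2 i j hxK⟩

lemma exists_bound_polyFun (K : Finset (Vec d)) (P : MvPolynomial (Fin d) ℝ) :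
    ∃ A, ∀ x ∈ openCell K, |polyFun P x| ≤ A := by
  obtain ⟨A, hA⟩ := (isCompact_cell K).exists_bound_of_continuousOn
    (continuous_polyFun P).continuousOn
  exact ⟨A, fun x hx => hA x (openCell_subset_cell K hx)⟩

/-- Finite element functions are bounded with bounded gradients. -/
lemma IsFESpace.le_bddSubmodule (hX : 𝒯.IsFESpace k Xh) : Xh ≤ bddSubmodule Ω := by
  intro u hu
  have hloc : ∀ K : 𝒯.cells, ∃ A, 0 ≤ A ∧ ∀ᵐ x ∂volume.restrict Ω, x ∈ openCell K.1 →
      ‖vel u x‖ ≤ A ∧ ‖grad u x‖ ≤ A := by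
    intro K
    obtain ⟨P, -, hP⟩ := hX.exists_polynomials hu K.2
    choose A hA using fun i => exists_bound_polyFun K.1 (P i)
    choose B hB using fun i j => exists_bound_polyFun K.1 (MvPolynomial.pderiv j (P i))
    set M := ∑ i, |A i| + ∑ i, ∑ j, |B i j|
    have hM : 0 ≤ M := by positivity
    have hAM : ∀ i, A i ≤ M := fun i => (le_abs_self _).trans
      ((Finset.single_le_sum (f := fun i => |A i|) (fun _ _ => abs_nonneg _)
        (Finset.mem_univ i)).trans (le_add_of_nonneg_right (by positivity)))
    have hBM : ∀ i j, B i j ≤ M := fun i j => (le_abs_self _).trans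
      (((Finset.single_le_sum (f := fun j => |B i j|) (fun _ _ => abs_nonneg _)
        (Finset.mem_univ j)).trans (Finset.single_le_sum (f := fun i => ∑ j, |B i j|)
          (fun _ _ => by positivity) (Finset.mem_univ i))).trans
            (le_add_of_nonneg_left (by positivity)))
    refine ⟨Fintype.card (Fin d) * M + Fintype.card (Fin d × Fin d) * M, by positivity, ?_⟩
    filter_upwards [hP] with x hx hxK
    constructor
    · refine (norm_le_card_mul (vel u x) fun i => ?_).trans
        (le_add_of_nonneg_right (by positivity))
      rw [(hx hxK i).1]
      exact (hA i x hxK).trans (hAM i)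
    · refine (norm_le_card_mul (grad u x) fun p => ?_).trans
        (le_add_of_nonneg_left (by positivity))
      rw [(hx hxK p.1).2 p.2]
      exact (hB p.1 p.2 x hxK).trans (hBM p.1 p.2)
  choose A hA0 hA using hloc
  have : Fintype 𝒯.cells := 𝒯.finite_cells.fintype
  have hall : ∀ᵐ x ∂volume.restrict Ω, ‖vel u x‖ ≤ ∑ K, A K ∧ ‖grad u x‖ ≤ ∑ K, A K := by
    filter_upwards [𝒯.ae_mem_openCell, ae_all_iff.2 hA] with x ⟨K, hK, hxK⟩ h
    have h1 := h ⟨K, hK⟩ hxK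
    have h2 : A ⟨K, hK⟩ ≤ ∑ K, A K :=
      Finset.single_le_sum (f := A) (fun K _ => hA0 K) (Finset.mem_univ _)
    exact ⟨h1.1.trans h2, h1.2.trans h2⟩
  exact ⟨∑ K, A K, hall.mono fun x hx => hx.1, hall.mono fun x hx => hx.2⟩

end Triangulation

/-! ### Velocity determines the element; finite dimension of the discrete space -/

section Injectivity

variable {d : ℕ} {Ω : Set (Vec d)}

lemma eq_zero_of_vel_eq_zero (hΩ : IsOpen Ω) {u : H10 Ω} (hu : vel u = 0) : u = 0 := by
  refine ext_vel_grad hu ?_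
  rw [grad_zero, Lp.eq_zero_iff_ae_eq_zero]
  have hv : ∀ᵐ x ∂volume.restrict Ω, vel u x = 0 := by
    rw [hu]
    exact Lp.coeFn_zero _ _ _
  have : ∀ i j, ∀ᵐ x ∂volume.restrict Ω, x ∈ Ω → grad u x (i, j) = 0 := by
    intro i j
    filter_upwards [fderiv_ae_eq_of_vel_eq u hΩ subset_rfl (i := i) (p := fun _ => 0)
      contDiff_const (hv.mono fun x hx _ => by rw [hx]; rfl) j] with x hx hxΩ
    rw [hx hxΩ]
    simp
  filter_upwards [ae_all_iff.2 fun i => ae_all_iff.2 (this i), ae_restrict_mem hΩ.measurableSet]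
    with x hx hxΩ
  ext p
  exact hx p.1 p.2 hxΩ

lemma vel_injective (hΩ : IsOpen Ω) : Function.Injective (vel : H10 Ω → L2Vec Ω) := fun u v h => by
  rw [← sub_eq_zero]
  exact eq_zero_of_vel_eq_zero hΩ (by rw [vel_sub, h, sub_self])

/-- A vector space that is the image of a finite-dimensional one under a linear relation. -/
lemma finiteDimensional_of_relation {E X : Type*} [AddCommGroup E] [Module ℝ E]
    [FiniteDimensional ℝ E] [AddCommGroup X] [Module ℝ X] (p : E → X → Prop) (zero : p 0 0)
    (add : ∀ e e' x x', p e x → p e' x' → p (e + e') (x + x'))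
    (smul : ∀ (a : ℝ) e x, p e x → p (a • e) (a • x)) (inj : ∀ x, p 0 x → x = 0)
    (surj : ∀ x, ∃ e, p e x) : FiniteDimensional ℝ X := by
  let Y : Submodule ℝ (E × X) :=
    { carrier := {y | p y.1 y.2}
      zero_mem' := zero
      add_mem' := fun {y z} hy hz => add _ _ _ _ hy hz
      smul_mem' := fun a y hy => smul a _ _ hy }
  have hinj : Function.Injective ((LinearMap.fst ℝ E X).comp Y.subtype) := by
    rw [← LinearMap.ker_eq_bot, LinearMap.ker_eq_bot']
    rintro ⟨⟨e, x⟩, hy⟩ he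
    have he : e = 0 := he
    subst he
    have hx : x = 0 := inj x hy
    subst hx
    rfl
  have hsurj : Function.Surjective ((LinearMap.snd ℝ E X).comp Y.subtype) := fun x => by
    obtain ⟨e, he⟩ := surj x
    exact ⟨⟨(e, x), he⟩, rfl⟩
  have : Module.Finite ℝ Y := Module.Finite.of_injective _ hinj
  exact Module.Finite.of_surjective _ hsurj

/-- A conforming finite element space is finite-dimensional. -/
lemma Triangulation.IsFESpace.finiteDimensional {𝒯 : Triangulation Ω} {k : ℕ}
    {Xh : Submodule ℝ (H10 Ω)} (hX : 𝒯.IsFESpace k Xh) (hΩ : IsOpen Ω) :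
    FiniteDimensional ℝ Xh := by
  have : Finite 𝒯.cells := 𝒯.finite_cells
  -- The relation pairs a function with any family of cellwise polynomials representing it, so no
  -- linear choice of representatives is required. Functions represented by zero vanish almost
  -- everywhere, because the open cells exhaust `Ω` up to a null set.
  refine finiteDimensional_of_relation
    (E := 𝒯.cells → Fin d → MvPolynomial.restrictTotalDegree (Fin d) ℝ k)
    (fun P u => ∀ K : 𝒯.cells, ∀ᵐ x ∂volume.restrict Ω, x ∈ openCell K.1 →
        ∀ i, vel u.1 x i = polyFun (P K i).1 x) ?_ ?_ ?_ ?_ ?_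
  · intro K
    filter_upwards [Lp.coeFn_zero (Vec d) 2 (volume.restrict Ω)] with x hx _ i
    have : vel ((0 : Xh).1) x = 0 := hx
    rw [this]
    simp [polyFun]
  · intro P Q u v hu hv K
    filter_upwards [hu K, hv K, coeFn_vel_add u.1 v.1] with x h1 h2 h3 hxK i
    have h4 : vel ((u + v).1) x = vel u.1 x + vel v.1 x := h3
    rw [h4, PiLp.add_apply, h1 hxK i, h2 hxK i]
    exact (polyFun_add _ _ _).symm
  · intro a P u hu K
    filter_upwards [hu K, coeFn_vel_smul a u.1] with x h1 h3 hxK i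
    have h4 : vel ((a • u).1) x = a • vel u.1 x := h3
    rw [h4, PiLp.smul_apply, h1 hxK i]
    exact (polyFun_smul _ _ _).symm
  · intro u hu
    refine Subtype.ext (eq_zero_of_vel_eq_zero hΩ ?_)
    rw [Lp.eq_zero_iff_ae_eq_zero]
    filter_upwards [𝒯.ae_mem_openCell, ae_all_iff.2 hu] with x ⟨K, hK, hxK⟩ h
    ext i
    exact (h ⟨K, hK⟩ hxK i).trans (by simp [polyFun])
  · intro u
    choose P hdeg hP using fun K : 𝒯.cells => hX.exists_polynomials u.2 K.2
    refine ⟨fun K i => ⟨P K i, (MvPolynomial.mem_restrictTotalDegree _ _ _).2 (hdeg K i)⟩,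
      fun K => ?_⟩
    filter_upwards [hP K] with x hx hxK i
    exact (hx hxK i).1

end Injectivity

/-! ### Inverse inequalities for polynomials on balls -/

section InverseInequality

open Metric

/-- An injective `J` makes `‖J x‖` a norm on a finite-dimensional space, and there every linear map
is bounded. This is the source of the inverse constants. -/
lemma exists_norm_le_of_injective {E N N' : Type*} [AddCommGroup E] [Module ℝ E]
    [FiniteDimensional ℝ E] [NormedAddCommGroup N] [NormedSpace ℝ N] [NormedAddCommGroup N']
    [NormedSpace ℝ N'] {J : E →ₗ[ℝ] N} (hJ : Function.Injective J) (T : E →ₗ[ℝ] N') :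
    ∃ C, 0 ≤ C ∧ ∀ x, ‖T x‖ ≤ C * ‖J x‖ := by
  let e := LinearEquiv.ofInjective J hJ
  have : FiniteDimensional ℝ (LinearMap.range J) := inferInstance
  let L := LinearMap.toContinuousLinearMap (T ∘ₗ e.symm.toLinearMap)
  refine ⟨‖L‖, norm_nonneg _, fun x => ?_⟩
  have h := L.le_opNorm (e x)
  have h1 : L (e x) = T x := by simp [L]
  rw [h1] at h
  exact h

variable {d : ℕ}

/-- The `L²` norm on the ball of radius `σ` is a norm on polynomials of degree at most `k`, so it
dominates the sup norms on the unit ball of a polynomial and of its derivatives. -/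
lemma exists_inverse_inequality_reference (d k : ℕ) {σ : ℝ} (hσ : 0 < σ) :
    ∃ C, 0 ≤ C ∧ ∀ P : MvPolynomial (Fin d) ℝ, P.totalDegree ≤ k → ∀ y : Vec d, ‖y‖ ≤ 1 →
      polyFun P y ^ 2 ≤ C * ∫ x in ball (0 : Vec d) σ, polyFun P x ^ 2 ∧
      ∀ j, polyFun (MvPolynomial.pderiv j P) y ^ 2 ≤
        C * ∫ x in ball (0 : Vec d) σ, polyFun P x ^ 2 := by
  let E := MvPolynomial.restrictTotalDegree (Fin d) ℝ k
  let μ : Measure (Vec d) := volume.restrict (ball 0 σ)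
  have : IsFiniteMeasure μ := ⟨by
    simpa [μ] using measure_ball_lt_top (μ := (volume : Measure (Vec d)))⟩
  have hmem : ∀ P : MvPolynomial (Fin d) ℝ, MemLp (polyFun P) 2 μ := by
    intro P
    obtain ⟨A, hA⟩ := (isCompact_closedBall (0 : Vec d) σ).exists_bound_of_continuousOn
      (continuous_polyFun P).continuousOn
    refine MemLp.of_bound (continuous_polyFun P).aestronglyMeasurable A ?_
    filter_upwards [ae_restrict_mem measurableSet_ball] with x hx
    exact hA x (ball_subset_closedBall hx)
  let J : E →ₗ[ℝ] Lp ℝ 2 μ :=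
    { toFun := fun P => (hmem P.1).toLp
      map_add' := fun P Q => by
        rw [← MemLp.toLp_add]
        exact MemLp.toLp_congr _ _ (Filter.Eventually.of_forall fun x => polyFun_add _ _ _)
      map_smul' := fun a P => by
        rw [RingHom.id_apply, ← MemLp.toLp_const_smul]
        exact MemLp.toLp_congr _ _ (Filter.Eventually.of_forall fun x => polyFun_smul _ _ _) }
  have hJnorm : ∀ P : E, ‖J P‖ ^ 2 = ∫ x in ball (0 : Vec d) σ, polyFun P.1 x ^ 2 := by
    intro P
    rw [norm_sq_eq_integral]
    refine integral_congr_ae ?_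
    filter_upwards [(hmem P.1).coeFn_toLp] with x hx
    have : J P x = polyFun P.1 x := hx
    rw [this, Real.norm_eq_abs, sq_abs]
  have hJ : Function.Injective J := by
    rw [← LinearMap.ker_eq_bot, LinearMap.ker_eq_bot']
    intro P hP
    have h0 : ∀ᵐ x ∂μ, polyFun P.1 x = 0 := by
      have h1 : (hmem P.1).toLp = 0 := hP
      have h2 := (hmem P.1).coeFn_toLp
      rw [h1] at h2
      filter_upwards [h2, Lp.coeFn_zero ℝ 2 μ] with x h3 h4
      rw [← h3, h4]
      rfl
    have hzero : Set.EqOn (polyFun P.1) (fun _ => 0) (ball (0 : Vec d) σ) :=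
      Measure.eqOn_open_of_ae_eq h0 isOpen_ball (continuous_polyFun P.1).continuousOn
        continuousOn_const
    -- A polynomial vanishing on a product of infinite sets is zero; the cube with sides `(0, σ / (d
    -- + 1))` lies in the ball, by the crude bound of the norm by `d` times the largest coordinate.
    have hδ : 0 < σ / (d + 1) := by positivity
    refine Subtype.ext ?_
    refine MvPolynomial.funext_set (fun _ => Set.Ioo 0 (σ / (d + 1)))
      (fun _ => Set.Ioo_infinite hδ) fun x hx => ?_
    have hx' : WithLp.toLp 2 x ∈ ball (0 : Vec d) σ := by
      rw [mem_ball_zero_iff]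
      refine (norm_le_card_mul _ (a := σ / (d + 1)) fun i => ?_).trans_lt ?_
      · have := hx i (Set.mem_univ i)
        exact (abs_of_pos this.1).le.trans this.2.le
      · rw [Fintype.card_fin, ← mul_div_assoc, div_lt_iff₀ (by positivity)]
        nlinarith
    have := hzero hx'
    simpa [polyFun] using this
  have : CompactSpace (closedBall (0 : Vec d) 1) :=
    isCompact_iff_compactSpace.1 (isCompact_closedBall _ _)
  let T₀ : E →ₗ[ℝ] C(closedBall (0 : Vec d) 1, ℝ) :=
    { toFun := fun P => ⟨fun x => polyFun P.1 x, (continuous_polyFun _).comp continuous_subtype_val⟩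
      map_add' := fun P Q => by ext x; exact polyFun_add _ _ _
      map_smul' := fun a P => by ext x; exact polyFun_smul _ _ _ }
  let T : Fin d → E →ₗ[ℝ] C(closedBall (0 : Vec d) 1, ℝ) := fun j =>
    { toFun := fun P => ⟨fun x => polyFun (MvPolynomial.pderiv j P.1) x,
        (continuous_polyFun _).comp continuous_subtype_val⟩
      map_add' := fun P Q => by
        ext x
        simp [polyFun_add]
      map_smul' := fun a P => by
        ext x
        simp [polyFun_smul] }
  obtain ⟨C₀, hC₀, h₀⟩ := exists_norm_le_of_injective hJ T₀
  choose C hC hT using fun j => exists_norm_le_of_injective hJ (T j)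
  set M := C₀ + ∑ j, C j with hM
  have hMpos : 0 ≤ M := add_nonneg hC₀ (Finset.sum_nonneg fun j _ => hC j)
  have hfin : ∀ (P : E) (c z : ℝ), c ≤ M → |z| ≤ c * ‖J P‖ → z ^ 2 ≤ M ^ 2 * ‖J P‖ ^ 2 := by
    intro P c z hc hz
    rw [← sq_abs, ← mul_pow]
    exact pow_le_pow_left₀ (abs_nonneg _)
      (hz.trans (mul_le_mul_of_nonneg_right hc (norm_nonneg _))) 2
  refine ⟨M ^ 2, by positivity, fun P hP y hy => ?_⟩
  let P' : E := ⟨P, (MvPolynomial.mem_restrictTotalDegree _ _ _).2 hP⟩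
  let y' : closedBall (0 : Vec d) 1 := ⟨y, by rwa [mem_closedBall_zero_iff]⟩
  have hn : ∫ x in ball (0 : Vec d) σ, polyFun P x ^ 2 = ‖J P'‖ ^ 2 := (hJnorm P').symm
  rw [hn]
  refine ⟨hfin P' C₀ _ ?_ ?_, fun j => hfin P' (C j) _ ?_ ?_⟩
  · exact le_add_of_nonneg_right (Finset.sum_nonneg fun j _ => hC j)
  · exact ((T₀ P').norm_coe_le_norm y').trans (h₀ P')
  · exact (Finset.single_le_sum (fun j _ => hC j) (Finset.mem_univ j)).trans
      (le_add_of_nonneg_left hC₀)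
  · exact ((T j P').norm_coe_le_norm y').trans (hT j P')

/-- The polynomial `y ↦ P (x₀ + h y)`. -/
def rescale (x₀ : Vec d) (h : ℝ) (P : MvPolynomial (Fin d) ℝ) : MvPolynomial (Fin d) ℝ :=
  MvPolynomial.bind₁ (fun i => MvPolynomial.C (x₀ i) + MvPolynomial.C h * MvPolynomial.X i) P

lemma polyFun_rescale (x₀ : Vec d) (h : ℝ) (P : MvPolynomial (Fin d) ℝ) (y : Vec d) :
    polyFun (rescale x₀ h P) y = polyFun P (x₀ + h • y) := by
  rw [polyFun, polyFun, rescale, MvPolynomial.eval, MvPolynomial.eval₂Hom_bind₁, MvPolynomial.eval]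
  congr 2
  funext i
  simp

lemma totalDegree_rescale_le (x₀ : Vec d) (h : ℝ) (P : MvPolynomial (Fin d) ℝ) :
    (rescale x₀ h P).totalDegree ≤ P.totalDegree := by
  rw [rescale]
  conv_lhs => rw [P.as_sum, map_sum]
  refine MvPolynomial.totalDegree_finsetSum_le fun s hs => ?_
  rw [MvPolynomial.bind₁_monomial]
  refine (MvPolynomial.totalDegree_mul _ _).trans ?_
  rw [MvPolynomial.totalDegree_C, zero_add]
  refine (MvPolynomial.totalDegree_finsetProd _ _).trans
    (le_trans ?_ (MvPolynomial.le_totalDegree hs))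
  refine Finset.sum_le_sum fun i _ => ?_
  refine (MvPolynomial.totalDegree_pow _ _).trans ?_
  have : (MvPolynomial.C (x₀ i) + MvPolynomial.C h * MvPolynomial.X i :
      MvPolynomial (Fin d) ℝ).totalDegree ≤ 1 := by
    refine (MvPolynomial.totalDegree_add _ _).trans (max_le ?_ ?_)
    · simp
    · refine (MvPolynomial.totalDegree_mul _ _).trans ?_
      simp
  calc s i * _ ≤ s i * 1 := Nat.mul_le_mul_left _ this
    _ = s i := mul_one _

lemma polyFun_pderiv_rescale (x₀ : Vec d) (h : ℝ) (P : MvPolynomial (Fin d) ℝ) (j : Fin d)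
    (y : Vec d) : polyFun (MvPolynomial.pderiv j (rescale x₀ h P)) y
      = h * polyFun (MvPolynomial.pderiv j P) (x₀ + h • y) := by
  have h1 : polyFun (rescale x₀ h P) = fun y => polyFun P (x₀ + h • y) :=
    funext (polyFun_rescale x₀ h P)
  have h2 : HasFDerivAt (fun y : Vec d => x₀ + h • y) (h • ContinuousLinearMap.id ℝ (Vec d)) y :=
    ((hasFDerivAt_id y).const_smul h).const_add x₀
  have h3 := (differentiable_polyFun P (x₀ + h • y)).hasFDerivAt.comp y h2
  rw [← fderiv_polyFun, ← fderiv_polyFun, h1]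
  rw [show (fun y => polyFun P (x₀ + h • y)) = polyFun P ∘ fun y => x₀ + h • y from rfl, h3.fderiv]
  simp

lemma integral_ball_rescale (x₀ : Vec d) {h : ℝ} (hh : 0 < h) (σ : ℝ)
    (P : MvPolynomial (Fin d) ℝ) : ∫ x in ball (0 : Vec d) σ, polyFun (rescale x₀ h P) x ^ 2
      = (h ^ d)⁻¹ * ∫ x in ball x₀ (h * σ), polyFun P x ^ 2 := by
  have h1 := Measure.setIntegral_comp_smul_of_pos (volume : Measure (Vec d))
    (fun z => polyFun P (x₀ + z) ^ 2) (ball 0 σ) hh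
  simp_rw [polyFun_rescale]
  rw [h1, finrank_euclideanSpace, Fintype.card_fin, smul_eq_mul, _root_.smul_ball hh.ne', smul_zero,
    Real.norm_of_nonneg hh.le]
  congr 1
  have h2 := (measurePreserving_add_left (volume : Measure (Vec d)) x₀).setIntegral_preimage_emb
    (measurableEmbedding_addLeft x₀) (fun z => polyFun P z ^ 2) (ball x₀ (h * σ))
  rw [← h2]
  congr 2
  ext z
  simp

/-- The inverse inequality on a ball of radius `h`, in terms of a concentric ball. -/
lemma exists_inverse_inequality (d k : ℕ) {σ : ℝ} (hσ : 0 < σ) :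
    ∃ C, 0 ≤ C ∧ ∀ P : MvPolynomial (Fin d) ℝ, P.totalDegree ≤ k → ∀ (h : ℝ), 0 < h →
      ∀ x₀ x : Vec d, ‖x - x₀‖ ≤ h →
      polyFun P x ^ 2 ≤ C * ((h ^ d)⁻¹ * ∫ x in ball x₀ (h * σ), polyFun P x ^ 2) ∧
      ∀ j, polyFun (MvPolynomial.pderiv j P) x ^ 2 ≤
        C * ((h ^ d)⁻¹ * ∫ x in ball x₀ (h * σ), polyFun P x ^ 2) / h ^ 2 := by
  obtain ⟨C, hC, hP⟩ := exists_inverse_inequality_reference d k hσ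
  refine ⟨C, hC, fun P hk h hh x₀ x hx => ?_⟩
  have hy : ‖h⁻¹ • (x - x₀)‖ ≤ 1 := by
    rw [norm_smul, norm_inv, Real.norm_of_nonneg hh.le, inv_mul_le_iff₀ hh, mul_one]
    exact hx
  have hxy : x₀ + h • h⁻¹ • (x - x₀) = x := by
    rw [smul_smul, mul_inv_cancel₀ hh.ne', one_smul, add_sub_cancel]
  obtain ⟨h1, h2⟩ := hP (rescale x₀ h P) ((totalDegree_rescale_le x₀ h P).trans hk) _ hy
  rw [polyFun_rescale, hxy, integral_ball_rescale x₀ hh] at h1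
  refine ⟨h1, fun j => ?_⟩
  have h3 := h2 j
  rw [polyFun_pderiv_rescale, hxy, integral_ball_rescale x₀ hh, mul_pow] at h3
  rw [le_div_iff₀ (by positivity), mul_comm]
  exact h3

end InverseInequality

/-! ### Mesh size and inverse estimates on quasi-uniform meshes -/

namespace Triangulation

open Metric

variable {d : ℕ} {Ω : Set (Vec d)} (𝒯 : Triangulation Ω)

lemma diam_cell_le_h {K : Finset (Vec d)} (hK : K ∈ 𝒯.cells) :
    diam (convexHull ℝ (K : Set (Vec d))) ≤ 𝒯.h := by
  refine le_csSup (Set.Finite.bddAbove ?_) ⟨K, hK, rfl⟩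
  exact (𝒯.finite_cells.image fun K : Finset (Vec d) =>
    diam (convexHull ℝ (K : Set (Vec d)))).subset
    fun y ⟨K, hK, hy⟩ => ⟨K, hK, hy.symm⟩

lemma h_nonneg : 0 ≤ 𝒯.h := Real.sSup_nonneg fun y ⟨K, _, hy⟩ => by
  rw [hy]; exact diam_nonneg

/-- Bounds `h` by a quantity of `Ω` alone, so that a power of `h` can be absorbed into a constant
independent of the mesh. -/
lemma h_le_diam : 𝒯.h ≤ diam (closure Ω) := Real.sSup_le (fun y ⟨K, hK, hy⟩ => by
  rw [hy, ← 𝒯.space_eq]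
  refine diam_mono (Geometry.SimplicialComplex.convexHull_subset_space hK.1) ?_
  rw [𝒯.space_eq]
  exact 𝒯.isCompact_closure.isBounded) diam_nonneg

lemma integral_eq_sum_cells (hΩ : IsOpen Ω) [Fintype 𝒯.cells] {f : Vec d → ℝ}
    (hf : IntegrableOn f Ω) : ∫ x in Ω, f x = ∑ K : 𝒯.cells, ∫ x in openCell K.1, f x := by
  have hsub : ⋃ K : 𝒯.cells, openCell K.1 ⊆ Ω :=
    Set.iUnion_subset fun K => 𝒯.openCell_subset K.2
  have hae : Ω =ᵐ[volume] ⋃ K : 𝒯.cells, openCell K.1 := by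
    refine Filter.EventuallyLE.antisymm ?_ hsub.eventuallyLE
    have := (ae_restrict_iff' hΩ.measurableSet).1 𝒯.ae_mem_openCell
    filter_upwards [this] with x hx hxΩ
    obtain ⟨K, hK, hxK⟩ := hx hxΩ
    exact Set.mem_iUnion.2 ⟨⟨K, hK⟩, hxK⟩
  have hm : ∀ K : 𝒯.cells, NullMeasurableSet (openCell K.1) volume := fun K =>
    (isOpen_openCell K.1).measurableSet.nullMeasurableSet
  have hdisj : Pairwise (Function.onFun (AEDisjoint volume) fun K : 𝒯.cells => openCell K.1) :=
    fun K L hKL => 𝒯.openCell_inter_null K.2 L.2 fun h => hKL (Subtype.ext h)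
  have h := integral_iUnion_ae hm hdisj (hf.mono_set hsub)
  rw [tsum_fintype] at h
  exact (setIntegral_congr_set hae).trans h

/-- The inverse inequalities on a quasi-uniform mesh, with a constant that depends on the mesh only
through the quasi-uniformity constant. -/
lemma exists_inverse_estimates (d k : ℕ) {σ : ℝ} (hσ : 0 < σ) :
    ∃ C, 0 ≤ C ∧ ∀ {Ω : Set (Vec d)} (_ : IsOpen Ω) (𝒯 : Triangulation Ω)
      (Xh : Submodule ℝ (H10 Ω)), 𝒯.IsQuasiUniform σ → 𝒯.IsFESpace k Xh → 0 < 𝒯.h →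
      ∀ u ∈ Xh, VelBound u (C * ((√(𝒯.h ^ d))⁻¹ * ‖vel u‖)) ∧
        GradBound u (C * ((√(𝒯.h ^ d))⁻¹ * ‖vel u‖) / 𝒯.h) ∧
        ‖grad u‖ ≤ C * ‖vel u‖ / 𝒯.h := by
  obtain ⟨C, hC, hinv⟩ := exists_inverse_inequality d k hσ
  set κ := volume.real (closedBall (0 : Vec d) 1) with hκ
  -- The factor `(d + 1) ^ 2` absorbs the number of components, `d` for the velocity and `d²` for
  -- the gradient.
  set D := (d + 1 : ℝ) ^ 2 * C with hD
  have hD0 : 0 ≤ D := by positivity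
  refine ⟨√D + √(κ * D), by positivity, fun {Ω} hΩ 𝒯 Xh hqu hX hh u hu => ?_⟩
  set h := 𝒯.h with hh'
  let I : Finset (Vec d) → ℝ := fun K => ∫ x in openCell K, ‖vel u x‖ ^ 2
  have hint : IntegrableOn (fun x => ‖vel u x‖ ^ 2) Ω := integrable_norm_sq (vel u)
  have hIle : ∀ K ∈ 𝒯.cells, I K ≤ ‖vel u‖ ^ 2 := fun K hK => by
    rw [norm_sq_eq_integral]
    exact setIntegral_mono_set hint (Filter.Eventually.of_forall fun x => sq_nonneg _)
      (𝒯.openCell_subset hK).eventuallyLE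
  have hI0 : ∀ K, 0 ≤ I K := fun K => integral_nonneg fun x => sq_nonneg _
  have hcell : ∀ K ∈ 𝒯.cells, (∀ᵐ x ∂volume.restrict Ω, x ∈ openCell K →
      ‖vel u x‖ ^ 2 ≤ D * ((h ^ d)⁻¹ * I K) ∧ ‖grad u x‖ ^ 2 ≤ D * ((h ^ d)⁻¹ * I K) / h ^ 2) ∧
      volume.real (openCell K) ≤ h ^ d * κ := by
    intro K hK
    obtain ⟨P, hdeg, hP⟩ := hX.exists_polynomials hu hK
    obtain ⟨x₀, hx₀⟩ := hqu K hK
    have hx₀K : x₀ ∈ convexHull ℝ (K : Set (Vec d)) :=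
      hx₀ (mem_closedBall_self (mul_nonneg hσ.le hh.le))
    -- The cell lies between concentric balls of radii `σ h` and `h`, so its shape affects the
    -- constants only through `σ`.
    have hball : ball x₀ (h * σ) ⊆ openCell K := by
      refine interior_maximal ?_ isOpen_ball
      rw [mul_comm]
      exact ball_subset_closedBall.trans hx₀
    have hdist : ∀ x ∈ openCell K, ‖x - x₀‖ ≤ h := by
      intro x hx
      rw [← dist_eq_norm]
      exact (dist_le_diam_of_mem (isCompact_cell K).isBounded (openCell_subset_cell K hx)
        hx₀K).trans (𝒯.diam_cell_le_h hK)
    have hPI : ∀ i, ∫ x in ball x₀ (h * σ), polyFun (P i) x ^ 2 ≤ I K := by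
      intro i
      have h1 : ∫ x in ball x₀ (h * σ), polyFun (P i) x ^ 2
          ≤ ∫ x in ball x₀ (h * σ), ‖vel u x‖ ^ 2 := by
        refine integral_mono_ae ?_ (hint.mono_set (hball.trans (𝒯.openCell_subset hK))) ?_
        · exact (((continuous_polyFun (P i)).pow 2).continuousOn.integrableOn_compact
            (isCompact_closedBall x₀ (h * σ))).mono_set ball_subset_closedBall
        · have := ae_restrict_of_ae_restrict_of_subset (hball.trans (𝒯.openCell_subset hK)) hP
          filter_upwards [this, ae_restrict_mem measurableSet_ball] with x hx hxb
          rw [← (hx (hball hxb) i).1, ← sq_abs]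
          exact pow_le_pow_left₀ (abs_nonneg _) (PiLp.norm_apply_le (vel u x) i) 2
      exact h1.trans (setIntegral_mono_set (hint.mono_set (𝒯.openCell_subset hK))
        (Filter.Eventually.of_forall fun x => sq_nonneg _) hball.eventuallyLE)
    have hmono : ∀ i, C * ((h ^ d)⁻¹ * ∫ x in ball x₀ (h * σ), polyFun (P i) x ^ 2)
        ≤ C * ((h ^ d)⁻¹ * I K) := fun i => by
      gcongr
      exact hPI i
    have hB0 : 0 ≤ C * ((h ^ d)⁻¹ * I K) :=
      mul_nonneg hC (mul_nonneg (by positivity) (hI0 K))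
    have hd0 : (0 : ℝ) ≤ d := Nat.cast_nonneg d
    refine ⟨?_, ?_⟩
    · filter_upwards [hP] with x hx hxK
      constructor
      · rw [EuclideanSpace.norm_sq_eq]
        calc ∑ i, ‖vel u x i‖ ^ 2 ≤ ∑ _i : Fin d, C * ((h ^ d)⁻¹ * I K) := by
              refine Finset.sum_le_sum fun i _ => ?_
              rw [Real.norm_eq_abs, sq_abs, (hx hxK i).1]
              exact ((hinv (P i) (hdeg i) h hh x₀ x (hdist x hxK)).1).trans (hmono i)
          _ = d * (C * ((h ^ d)⁻¹ * I K)) := by simp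
          _ ≤ (d + 1) ^ 2 * (C * ((h ^ d)⁻¹ * I K)) :=
              mul_le_mul_of_nonneg_right (by nlinarith) hB0
          _ = _ := by rw [hD]; ring
      · rw [EuclideanSpace.norm_sq_eq]
        calc ∑ p, ‖grad u x p‖ ^ 2
            ≤ ∑ _p : Fin d × Fin d, C * ((h ^ d)⁻¹ * I K) / h ^ 2 := by
              refine Finset.sum_le_sum fun p _ => ?_
              rw [Real.norm_eq_abs, sq_abs, (hx hxK p.1).2 p.2]
              refine ((hinv (P p.1) (hdeg p.1) h hh x₀ x (hdist x hxK)).2 p.2).trans ?_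
              exact div_le_div_of_nonneg_right (hmono p.1) (by positivity)
          _ = (d * d) * (C * ((h ^ d)⁻¹ * I K) / h ^ 2) := by simp
          _ ≤ (d + 1) ^ 2 * (C * ((h ^ d)⁻¹ * I K) / h ^ 2) :=
              mul_le_mul_of_nonneg_right (by nlinarith) (by positivity)
          _ = _ := by rw [hD]; ring
    · have hsub : openCell K ⊆ closedBall x₀ h := fun x hx => by
        rw [mem_closedBall, dist_eq_norm]
        exact hdist x hx
      refine (measureReal_mono hsub measure_closedBall_lt_top.ne).trans (le_of_eq ?_)
      rw [Measure.real, Measure.addHaar_closedBall' _ _ hh.le, finrank_euclideanSpace,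
        Fintype.card_fin, ENNReal.toReal_mul, ENNReal.toReal_ofReal (by positivity), hκ,
        Measure.real]
  have hCle : √D ≤ √D + √(κ * D) := le_add_of_nonneg_right (Real.sqrt_nonneg _)
  have hη : 0 ≤ (√(h ^ d))⁻¹ := by positivity
  have hsq : ∀ K ∈ 𝒯.cells, D * ((h ^ d)⁻¹ * I K) ≤ (√D * ((√(h ^ d))⁻¹ * ‖vel u‖)) ^ 2 := by
    intro K hK
    rw [mul_pow, mul_pow, inv_pow, Real.sq_sqrt hD0, Real.sq_sqrt (by positivity)]
    exact mul_le_mul_of_nonneg_left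
      (mul_le_mul_of_nonneg_left (hIle K hK) (by positivity)) hD0
  have hall := (ae_ball_iff 𝒯.finite_cells.countable).2 fun K hK => (hcell K hK).1
  refine ⟨?_, ?_, ?_⟩
  · filter_upwards [𝒯.ae_mem_openCell, hall] with x ⟨K, hK, hxK⟩ hx
    have h1 := ((hx K hK hxK).1).trans (hsq K hK)
    refine (abs_le_of_sq_le_sq' h1 (by positivity)).2.trans ?_
    exact mul_le_mul_of_nonneg_right hCle (by positivity)
  · filter_upwards [𝒯.ae_mem_openCell, hall] with x ⟨K, hK, hxK⟩ hx
    have h1 := ((hx K hK hxK).2).trans (div_le_div_of_nonneg_right (hsq K hK) (sq_nonneg h))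
    rw [← div_pow] at h1
    refine (abs_le_of_sq_le_sq' h1 (by positivity)).2.trans ?_
    exact div_le_div_of_nonneg_right (mul_le_mul_of_nonneg_right hCle (by positivity)) hh.le
  · have : Fintype 𝒯.cells := 𝒯.finite_cells.fintype
    have hgint : IntegrableOn (fun x => ‖grad u x‖ ^ 2) Ω := integrable_norm_sq (grad u)
    -- The cell volume, at most `κ h^d`, cancels the factor `h^{-d}` of the pointwise bound. Only
    -- `h^{-2}` remains, and the cellwise bounds add up.
    have hgK : ∀ K : 𝒯.cells, ∫ x in openCell K.1, ‖grad u x‖ ^ 2 ≤ κ * D / h ^ 2 * I K.1 := by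
      intro K
      obtain ⟨h1, h2⟩ := hcell K.1 K.2
      have hfin : volume (openCell K.1) ≠ ⊤ :=
        ((measure_mono (openCell_subset_cell K.1)).trans_lt (isCompact_cell K.1).measure_lt_top).ne
      have hKI := hI0 K.1
      calc ∫ x in openCell K.1, ‖grad u x‖ ^ 2
          ≤ ∫ _x in openCell K.1, D * ((h ^ d)⁻¹ * I K.1) / h ^ 2 := by
            refine integral_mono_ae (hgint.mono_set (𝒯.openCell_subset K.2))
              (integrableOn_const hfin) ?_
            filter_upwards [ae_restrict_of_ae_restrict_of_subset (𝒯.openCell_subset K.2) h1,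
              ae_restrict_mem (isOpen_openCell K.1).measurableSet] with x hx hxK
            exact (hx hxK).2
        _ = volume.real (openCell K.1) * (D * ((h ^ d)⁻¹ * I K.1) / h ^ 2) := by
            rw [setIntegral_const, smul_eq_mul]
        _ ≤ (h ^ d * κ) * (D * ((h ^ d)⁻¹ * I K.1) / h ^ 2) :=
            mul_le_mul_of_nonneg_right h2 (by positivity)
        _ = κ * D / h ^ 2 * I K.1 := by
            field_simp
    have hsum : ‖grad u‖ ^ 2 ≤ κ * D / h ^ 2 * ‖vel u‖ ^ 2 := by
      rw [norm_sq_eq_integral, norm_sq_eq_integral, 𝒯.integral_eq_sum_cells hΩ hgint,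
        𝒯.integral_eq_sum_cells hΩ hint, Finset.mul_sum]
      exact Finset.sum_le_sum fun K _ => hgK K
    have h1 : ‖grad u‖ ^ 2 ≤ (√(κ * D) * ‖vel u‖ / h) ^ 2 := by
      refine hsum.trans (le_of_eq ?_)
      rw [div_pow, mul_pow, Real.sq_sqrt (by positivity)]
      ring
    refine (abs_le_of_sq_le_sq' h1 (by positivity)).2.trans ?_
    refine div_le_div_of_nonneg_right (mul_le_mul_of_nonneg_right ?_ (norm_nonneg _)) hh.le
    exact le_add_of_nonneg_left (Real.sqrt_nonneg _)

end Triangulation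

/-! ### The power law: monotonicity and continuity -/

section PowerLaw

variable {E : Type*} [NormedAddCommGroup E] [InnerProductSpace ℝ E]

/-- The map `a ↦ ‖a‖^s a` is monotone. -/
lemma powerLaw_monotone {s : ℝ} (hs : 0 ≤ s) (a b : E) :
    0 ≤ ‖a‖ ^ s * inner ℝ a (a - b) - ‖b‖ ^ s * inner ℝ b (a - b) := by
  -- Polarization writes the expression as half of `(‖a‖^s - ‖b‖^s)(‖a‖² - ‖b‖²) + (‖a‖^s + ‖b‖^s)
  -- ‖a - b‖²`; the first product is nonnegative because both powers increase.
  have h1 : inner ℝ a (a - b) = (‖a‖ ^ 2 - ‖b‖ ^ 2 + ‖a - b‖ ^ 2) / 2 := by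
    rw [norm_sub_sq_real, inner_sub_right, real_inner_self_eq_norm_sq]
    ring
  have h2 : inner ℝ b (a - b) = (‖a‖ ^ 2 - ‖b‖ ^ 2 - ‖a - b‖ ^ 2) / 2 := by
    rw [norm_sub_sq_real, inner_sub_right, real_inner_self_eq_norm_sq, real_inner_comm]
    ring
  rw [h1, h2]
  have ha : 0 ≤ ‖a‖ ^ s := Real.rpow_nonneg (norm_nonneg _) _
  have hb : 0 ≤ ‖b‖ ^ s := Real.rpow_nonneg (norm_nonneg _) _
  have h3 : 0 ≤ (‖a‖ ^ s - ‖b‖ ^ s) * (‖a‖ ^ 2 - ‖b‖ ^ 2) := by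
    rcases le_total ‖a‖ ‖b‖ with h | h
    · exact mul_nonneg_of_nonpos_of_nonpos
        (sub_nonpos.2 (Real.rpow_le_rpow (norm_nonneg _) h hs))
        (sub_nonpos.2 (pow_le_pow_left₀ (norm_nonneg _) h 2))
    · exact mul_nonneg (sub_nonneg.2 (Real.rpow_le_rpow (norm_nonneg _) h hs))
        (sub_nonneg.2 (pow_le_pow_left₀ (norm_nonneg _) h 2))
  nlinarith [mul_nonneg (add_nonneg ha hb) (sq_nonneg ‖a - b‖)]

lemma rpow_mul_inner_self {s : ℝ} (hs : 0 ≤ s) (a : E) :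
    ‖a‖ ^ s * inner ℝ a a = ‖a‖ ^ (s + 2) := by
  rw [real_inner_self_eq_norm_sq, Real.rpow_add_of_nonneg (norm_nonneg _) hs (by norm_num),
    Real.rpow_two]

lemma norm_rpow_mul_inner_le {s A : ℝ} (hs : 0 ≤ s) {a : E} (b : E) (ha : ‖a‖ ≤ A) :
    ‖‖a‖ ^ s * inner ℝ a b‖ ≤ A ^ s * (‖a‖ * ‖b‖) := by
  rw [norm_mul, Real.norm_of_nonneg (Real.rpow_nonneg (norm_nonneg _) _)]
  exact mul_le_mul (Real.rpow_le_rpow (norm_nonneg _) ha hs) (norm_inner_le_norm _ _)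
    (norm_nonneg _) (Real.rpow_nonneg ((norm_nonneg _).trans ha) _)

/-- Testing the difference quotient with the midpoint yields an exact difference of squares;
stability therefore needs no restriction on the time step. -/
lemma inner_sub_half_add (a b : E) :
    inner ℝ (b - a) ((1 / 2 : ℝ) • (b + a)) = (‖b‖ ^ 2 - ‖a‖ ^ 2) / 2 := by
  rw [inner_smul_right, inner_sub_left, inner_add_right, inner_add_right,
    real_inner_self_eq_norm_sq, real_inner_self_eq_norm_sq, real_inner_comm a b]
  ring

variable {α : Type*} [MeasurableSpace α] {μ : Measure α}

lemma aestronglyMeasurable_rpow_mul_inner {s : ℝ} (hs : 0 ≤ s) {g k : α → E}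
    (hg : AEStronglyMeasurable g μ) (hk : AEStronglyMeasurable k μ) :
    AEStronglyMeasurable (fun x => ‖g x‖ ^ s * inner ℝ (g x) (k x)) μ :=
  ((Real.continuous_rpow_const hs).comp_aestronglyMeasurable hg.norm).mul (hg.inner hk)

lemma integrable_rpow_mul_inner {s A : ℝ} (hs : 0 ≤ s) {g : Lp E 2 μ} (k : Lp E 2 μ)
    (hA : ∀ᵐ x ∂μ, ‖g x‖ ≤ A) : Integrable (fun x => ‖g x‖ ^ s * inner ℝ (g x) (k x)) μ := by
  refine ((integrable_norm_mul_norm g k).const_mul (A ^ s)).mono'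
    (aestronglyMeasurable_rpow_mul_inner hs (Lp.aestronglyMeasurable _)
      (Lp.aestronglyMeasurable _)) ?_
  filter_upwards [hA] with x hx
  exact norm_rpow_mul_inner_le hs _ hx

/-- Continuity of the power-law form on finite-dimensional spaces of bounded functions. -/
lemma continuous_integral_rpow_mul_inner {m : ℕ} {s A : ℝ} (hs : 0 ≤ s) (G : Fin m → Lp E 2 μ)
    (hA : ∀ᵐ x ∂μ, ∀ i, ‖G i x‖ ≤ A) (H : Lp E 2 μ) :
    Continuous fun c : Vec m =>
      ∫ x, ‖∑ i, c i • G i x‖ ^ s * inner ℝ (∑ i, c i • G i x) (H x) ∂μ := by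
  have hmeas : ∀ c : Vec m, AEStronglyMeasurable (fun x => ∑ i, c i • G i x) μ := fun c =>
    Finset.aestronglyMeasurable_fun_sum _ fun i _ =>
      (Lp.aestronglyMeasurable (G i)).const_smul (c i)
  have hbd : ∀ (c : Vec m) (r : ℝ), ‖c‖ ≤ r → ∀ x, ‖∑ i, c i • G i x‖ ≤ r * ∑ i, ‖G i x‖ := by
    intro c r hc x
    rw [Finset.mul_sum]
    refine (norm_sum_le _ _).trans (Finset.sum_le_sum fun i _ => ?_)
    rw [norm_smul]
    exact mul_le_mul_of_nonneg_right ((PiLp.norm_apply_le c i).trans hc) (norm_nonneg _)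
  refine continuous_iff_continuousAt.2 fun c₀ => ?_
  set r := ‖c₀‖ + 1 with hr
  -- Near `c₀` the coefficients are bounded by `r = ‖c₀‖ + 1`, so the `s`-th power is bounded
  -- uniformly, and a finite sum of products of two `L²` functions dominates the integrand.
  refine continuousAt_of_dominated
    (bound := fun x => (r * ∑ _i : Fin m, A) ^ s * (r * ∑ i, ‖G i x‖ * ‖H x‖)) ?_ ?_ ?_ ?_
  · exact Filter.Eventually.of_forall fun c =>
      aestronglyMeasurable_rpow_mul_inner hs (hmeas c) (Lp.aestronglyMeasurable _)
  · filter_upwards [Metric.ball_mem_nhds c₀ one_pos] with c hc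
    have hcr : ‖c‖ ≤ r := by
      rw [Metric.mem_ball, dist_eq_norm] at hc
      calc ‖c‖ = ‖c₀ + (c - c₀)‖ := by rw [add_sub_cancel]
        _ ≤ ‖c₀‖ + ‖c - c₀‖ := norm_add_le _ _
        _ ≤ r := by rw [hr]; linarith
    have hr0 : 0 ≤ r := by positivity
    filter_upwards [hA] with x hx
    have h1 := hbd c r hcr x
    have h2 : ‖∑ i, c i • G i x‖ ≤ r * ∑ _i : Fin m, A :=
      h1.trans (mul_le_mul_of_nonneg_left (Finset.sum_le_sum fun i _ => hx i) hr0)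
    refine (norm_rpow_mul_inner_le hs (H x) h2).trans ?_
    refine mul_le_mul_of_nonneg_left ?_ (Real.rpow_nonneg ((norm_nonneg _).trans h2) _)
    rw [← Finset.sum_mul, ← mul_assoc]
    exact mul_le_mul_of_nonneg_right h1 (norm_nonneg _)
  · exact ((integrable_finsetSum _ fun i _ => integrable_norm_mul_norm (G i) H).const_mul
      r).const_mul _
  · refine Filter.Eventually.of_forall fun x => Continuous.continuousAt ?_
    have h1 : Continuous fun c : Vec m => ∑ i, c i • G i x :=
      continuous_finsetSum _ fun i _ => (coordVec i).continuous.smul continuous_const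
    exact ((Real.continuous_rpow_const hs).comp h1.norm).mul (h1.inner continuous_const)

end PowerLaw

/-! ### The Ladyzhenskaya term on bounded fields -/

section LadForm

variable {d : ℕ} {Ω : Set (Vec d)} {s : ℝ}

lemma integrable_lad (hs : 0 ≤ s) {u : H10 Ω} (hu : u ∈ bddSubmodule Ω) (v : H10 Ω) :
    Integrable (fun x => ‖grad u x‖ ^ s * inner ℝ (grad u x) (grad v x)) (volume.restrict Ω) := by
  obtain ⟨A, -, hA⟩ := hu
  exact integrable_rpow_mul_inner hs (grad v) hA

lemma ladForm_add_right (hs : 0 ≤ s) {u : H10 Ω} (hu : u ∈ bddSubmodule Ω) (v w : H10 Ω) :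
    ladForm s u (v + w) = ladForm s u v + ladForm s u w := by
  rw [ladForm, ladForm, ladForm, ← integral_add (integrable_lad hs hu v) (integrable_lad hs hu w)]
  refine integral_congr_ae ?_
  filter_upwards [coeFn_grad_add v w] with x hx
  rw [hx, inner_add_right, mul_add]

lemma ladForm_smul_right (a : ℝ) (u v : H10 Ω) : ladForm s u (a • v) = a * ladForm s u v := by
  rw [ladForm, ladForm, ← integral_const_mul]
  refine integral_congr_ae ?_
  filter_upwards [coeFn_grad_smul a v] with x hx
  rw [hx, inner_smul_right]
  ring

lemma ladForm_self (hs : 0 ≤ s) (u : H10 Ω) : ladForm s u u = gradPow s u := by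
  rw [ladForm, gradPow]
  exact integral_congr_ae (Filter.Eventually.of_forall fun x => rpow_mul_inner_self hs _)

lemma gradPow_nonneg (s : ℝ) (u : H10 Ω) : 0 ≤ gradPow s u :=
  integral_nonneg fun _ => Real.rpow_nonneg (norm_nonneg _) _

lemma ladForm_monotone (hs : 0 ≤ s) {u v : H10 Ω} (hu : u ∈ bddSubmodule Ω)
    (hv : v ∈ bddSubmodule Ω) : 0 ≤ ladForm s u (u - v) - ladForm s v (u - v) := by
  rw [ladForm, ladForm, ← integral_sub (integrable_lad hs hu _) (integrable_lad hs hv _)]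
  refine integral_nonneg_of_ae ?_
  have hsub : ∀ᵐ x ∂volume.restrict Ω, grad (u - v) x = grad u x - grad v x := Lp.coeFn_sub _ _
  filter_upwards [hsub] with x hx
  rw [hx]
  exact powerLaw_monotone hs _ _

lemma continuous_ladForm (hs : 0 ≤ s) {m : ℕ} (Ψ : Vec m →ₗ[ℝ] H10 Ω)
    (hΨ : ∀ c, Ψ c ∈ bddSubmodule Ω) (v : H10 Ω) : Continuous fun c => ladForm s (Ψ c) v := by
  let G : Fin m → L2Mat Ω := fun i => grad (Ψ (EuclideanSpace.single i 1))
  have hsum : ∀ c, Ψ c = ∑ i, c i • Ψ (EuclideanSpace.single i 1) := by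
    intro c
    conv_lhs => rw [← (EuclideanSpace.basisFun (Fin m) ℝ).sum_repr c]
    simp
  have hG : ∀ c, ∀ᵐ x ∂volume.restrict Ω, grad (Ψ c) x = ∑ i, c i • G i x := by
    intro c
    have h1 : grad (Ψ c) = ∑ i, c i • G i := by
      rw [← gradₗ_apply, hsum, map_sum]
      rfl
    have h2 : ∀ i, ∀ᵐ x ∂volume.restrict Ω, (c i • G i : L2Mat Ω) x = c i • G i x := fun i =>
      Lp.coeFn_smul _ _
    have h3 := Lp.coeFn_finsetSum Finset.univ fun i => c i • G i
    rw [h1]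
    filter_upwards [ae_all_iff.2 h2, h3] with x h4 h5
    rw [h5]
    simp only [Finset.sum_apply, h4]
  choose A hA using fun i => (hΨ (EuclideanSpace.single i 1))
  have hbound : ∀ᵐ x ∂volume.restrict Ω, ∀ i, ‖G i x‖ ≤ ∑ i, |A i| := by
    filter_upwards [ae_all_iff.2 fun i => (hA i).2] with x hx i
    exact (hx i).trans ((le_abs_self _).trans (Finset.single_le_sum (f := fun i => |A i|)
      (fun _ _ => abs_nonneg _) (Finset.mem_univ i)))
  have heq : (fun c => ladForm s (Ψ c) v) = fun c : Vec m =>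
      ∫ x in Ω, ‖∑ i, c i • G i x‖ ^ s * inner ℝ (∑ i, c i • G i x) (grad v x) := by
    funext c
    refine integral_congr_ae ?_
    filter_upwards [hG c] with x hx
    rw [hx]
  rw [heq]
  exact continuous_integral_rpow_mul_inner hs G hbound (grad v)

/-- The form is bilinear in its first two arguments on the image of `Ψ`, and bilinear maps on
finite-dimensional spaces are continuous. -/
lemma continuous_form (F : Formulation) {m : ℕ} (Ψ : Vec m →ₗ[ℝ] H10 Ω)
    (hΨ : ∀ c, Ψ c ∈ bddSubmodule Ω) {v : H10 Ω} (hv : v ∈ bddSubmodule Ω) :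
    Continuous fun c => F.form (Ψ c) (Ψ c) v := by
  let B : Vec m →ₗ[ℝ] Vec m →ₗ[ℝ] ℝ := LinearMap.mk₂ ℝ (fun c c' => F.form (Ψ c) (Ψ c') v)
    (fun c c' e => by rw [map_add]; exact form_add_left F (hΨ _) (hΨ _) (hΨ _) hv)
    (fun a c e => by rw [map_smul]; exact form_smul_left F a (hΨ _) hv)
    (fun c e e' => by rw [map_add]; exact form_add_mid F (hΨ _) (hΨ _) (hΨ _) hv)
    (fun a c e => by rw [map_smul]; exact form_smul_mid F a (hΨ _) hv)
  let L : Vec m →ₗ[ℝ] Vec m →L[ℝ] ℝ := LinearMap.toContinuousLinearMap.toLinearMap ∘ₗ B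
  exact L.continuous_of_finiteDimensional.clm_apply continuous_id

end LadForm

/-! ### Discretely divergence-free functions and the energy inequality -/

section Scheme

variable {d : ℕ} {Ω : Set (Vec d)}

lemma integrable_mul_divg (q : L2Scal Ω) (u : H10 Ω) :
    Integrable (fun x => q x * divg u x) (volume.restrict Ω) := by
  have h1 : MemLp (fun x => divg u x) 2 (volume.restrict Ω) :=
    memLp_finsetSum _ fun i _ => (coordMat (i, i)).comp_memLp' (Lp.memLp (grad u))
  exact (Lp.memLp q).integrable_mul (q := 2) h1

lemma integral_mul_divg_add (q : L2Scal Ω) (u v : H10 Ω) :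
    ∫ x in Ω, q x * divg (u + v) x = (∫ x in Ω, q x * divg u x) + ∫ x in Ω, q x * divg v x := by
  rw [← integral_add (integrable_mul_divg q u) (integrable_mul_divg q v)]
  refine integral_congr_ae ?_
  filter_upwards [coeFn_grad_add u v] with x hx
  simp only [divg, hx, PiLp.add_apply, Finset.sum_add_distrib, mul_add]

lemma integral_mul_divg_smul (q : L2Scal Ω) (a : ℝ) (u : H10 Ω) :
    ∫ x in Ω, q x * divg (a • u) x = a * ∫ x in Ω, q x * divg u x := by
  rw [← integral_const_mul]
  refine integral_congr_ae ?_
  filter_upwards [coeFn_grad_smul a u] with x hx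
  simp only [divg, hx, PiLp.smul_apply, smul_eq_mul, ← Finset.mul_sum]
  ring

lemma zero_mem_Vh (Xh : Submodule ℝ (H10 Ω)) (Qh : Submodule ℝ (L2Scal Ω)) :
    (0 : H10 Ω) ∈ Vh Xh Qh := by
  refine ⟨Xh.zero_mem, fun q _ => ?_⟩
  have h := integral_mul_divg_smul q 0 (0 : H10 Ω)
  rwa [zero_smul, zero_mul] at h

lemma add_mem_Vh {Xh : Submodule ℝ (H10 Ω)} {Qh : Submodule ℝ (L2Scal Ω)} {u v : H10 Ω}
    (hu : u ∈ Vh Xh Qh) (hv : v ∈ Vh Xh Qh) : u + v ∈ Vh Xh Qh := by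
  refine ⟨Xh.add_mem hu.1 hv.1, fun q hq => ?_⟩
  rw [integral_mul_divg_add, hu.2 q hq, hv.2 q hq, add_zero]

lemma smul_mem_Vh {Xh : Submodule ℝ (H10 Ω)} {Qh : Submodule ℝ (L2Scal Ω)} (a : ℝ) {u : H10 Ω}
    (hu : u ∈ Vh Xh Qh) : a • u ∈ Vh Xh Qh := by
  refine ⟨Xh.smul_mem a hu.1, fun q hq => ?_⟩
  rw [integral_mul_divg_smul, hu.2 q hq, mul_zero]

/-- The discretely divergence-free functions as a linear space. -/
def vhSubmodule (Xh : Submodule ℝ (H10 Ω)) (Qh : Submodule ℝ (L2Scal Ω)) :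
    Submodule ℝ (H10 Ω) where
  carrier := Vh Xh Qh
  zero_mem' := zero_mem_Vh Xh Qh
  add_mem' := add_mem_Vh
  smul_mem' := smul_mem_Vh

lemma vhSubmodule_le (Xh : Submodule ℝ (H10 Ω)) (Qh : Submodule ℝ (L2Scal Ω)) :
    vhSubmodule Xh Qh ≤ Xh := fun _ h => h.1

/-- Young's inequality with weight `Re` leaves half of the viscous term; multiplication by `2 Δt`
then gives the coefficients of the stability estimate. -/
lemma energy_arith {Re ν Δt x y g p Φ : ℝ} (hRe : 0 < Re) (hΔt : 0 < Δt)
    (h : 1 / Δt * ((x - y) / 2) + Re⁻¹ * g ^ 2 + ν * p ≤ Φ * g) :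
    x + Re⁻¹ * Δt * g ^ 2 + 2 * ν * Δt * p ≤ y + Δt * Re * Φ ^ 2 := by
  have hyoung : Φ * g ≤ Re / 2 * Φ ^ 2 + Re⁻¹ / 2 * g ^ 2 := by
    have h1 : 0 ≤ Re⁻¹ / 2 * (Re * Φ - g) ^ 2 := by positivity
    have h2 : Re⁻¹ / 2 * (Re * Φ - g) ^ 2 = Re / 2 * Φ ^ 2 + Re⁻¹ / 2 * g ^ 2 - Φ * g := by
      field_simp
      ring
    linarith
  have h3 := mul_le_mul_of_nonneg_left (h.trans hyoung) (by positivity : 0 ≤ 2 * Δt)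
  have h4 : 2 * Δt * (1 / Δt * ((x - y) / 2) + Re⁻¹ * g ^ 2 + ν * p) = x - y
        + 2 * Δt * (Re⁻¹ * g ^ 2) + 2 * Δt * (ν * p) := by
    field_simp
  rw [h4] at h3
  linarith

/-- The energy inequality for one time step. -/
lemma energy_step {F : Formulation} {Re ν s Δt C : ℝ} (hRe : 0 < Re) (hs : 0 ≤ s) (hΔt : 0 < Δt)
    (hC : ∀ u : H10 Ω, ‖vel u‖ ≤ C * ‖grad u‖) (f : StrongDual ℝ (H10 Ω)) {a b u : H10 Ω}
    (hab : vel u = (1 / 2 : ℝ) • (vel b + vel a)) (hu : u ∈ bddSubmodule Ω)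
    (heq : (1 / Δt) * inner ℝ (vel b - vel a) (vel u) + Re⁻¹ * inner ℝ (grad u) (grad u)
      + ν * ladForm s u u + F.form u u u = f u) :
    ‖vel b‖ ^ 2 + Re⁻¹ * Δt * ‖grad u‖ ^ 2 + 2 * ν * Δt * gradPow s u
      ≤ ‖vel a‖ ^ 2 + Δt * Re * hMinusNorm f ^ 2 := by
  have hf := apply_le_hMinusNorm hC f u
  rw [← heq, form_self F hu, ladForm_self hs, hab, inner_sub_half_add,
    real_inner_self_eq_norm_sq, add_zero] at hf
  exact energy_arith hRe hΔt hf

lemma vel_midpt (w : ℕ → H10 Ω) (n : ℕ) :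
    vel (midpt w n) = (1 / 2 : ℝ) • (vel (w (n + 1)) + vel (w n)) := rfl

variable {V : Submodule ℝ (H10 Ω)} {F : Formulation} {Re ν s Δt C : ℝ}
  {f : ℝ → StrongDual ℝ (H10 Ω)} {M : ℕ}

lemma midpt_mem {w : ℕ → H10 Ω} {n : ℕ} (h : w n ∈ V) (h' : w (n + 1) ∈ V) : midpt w n ∈ V :=
  V.smul_mem _ (V.add_mem h' h)

/-- Unconditional stability. -/
lemma IsDiscreteSolution.stability {w : ℕ → H10 Ω} (hw : IsDiscreteSolution F V Re ν s Δt f M w)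
    (hV : V ≤ bddSubmodule Ω) (hRe : 0 < Re) (hs : 0 ≤ s) (hΔt : 0 < Δt)
    (hC : ∀ u : H10 Ω, ‖vel u‖ ≤ C * ‖grad u‖) {m : ℕ} (hm : m ≤ M) :
    ‖vel (w m)‖ ^ 2 + Re⁻¹ * Δt * ∑ n ∈ Finset.range m, ‖grad (midpt w n)‖ ^ 2
      + 2 * ν * Δt * ∑ n ∈ Finset.range m, gradPow s (midpt w n)
      ≤ ‖vel (w 0)‖ ^ 2 + Δt * Re * ∑ n ∈ Finset.range m, hMinusNorm (f (tmid Δt n)) ^ 2 := by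
  induction m with
  | zero => simp
  | succ m ih =>
    have hmem : midpt w m ∈ V := midpt_mem (hw.1 m (by omega)) (hw.1 (m + 1) hm)
    have h1 := energy_step (u := midpt w m) hRe hs hΔt hC (f (tmid Δt m)) (vel_midpt w m)
      (hV hmem)
      (hw.2 m (by omega) (midpt w m) hmem)
    have h2 := ih (by omega)
    simp only [Finset.sum_range_succ, mul_add]
    linarith

/-- Dropping the dissipation leaves a bound common to all time levels. It fixes the radius in the
uniqueness argument. -/
lemma IsDiscreteSolution.norm_vel_sq_le {w : ℕ → H10 Ω}
    (hw : IsDiscreteSolution F V Re ν s Δt f M w) (hV : V ≤ bddSubmodule Ω) (hRe : 0 < Re)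
    (hν : 0 ≤ ν) (hs : 0 ≤ s) (hΔt : 0 < Δt) (hC : ∀ u : H10 Ω, ‖vel u‖ ≤ C * ‖grad u‖) {m : ℕ}
    (hm : m ≤ M) : ‖vel (w m)‖ ^ 2
      ≤ ‖vel (w 0)‖ ^ 2 + Δt * Re * ∑ n ∈ Finset.range M, hMinusNorm (f (tmid Δt n)) ^ 2 := by
  have h1 := hw.stability hV hRe hs hΔt hC hm
  have h2 : 0 ≤ Re⁻¹ * Δt * ∑ n ∈ Finset.range m, ‖grad (midpt w n)‖ ^ 2 := by positivity
  have h3 : 0 ≤ 2 * ν * Δt * ∑ n ∈ Finset.range m, gradPow s (midpt w n) :=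
    mul_nonneg (by positivity) (Finset.sum_nonneg fun n _ => gradPow_nonneg s _)
  have h4 : ∑ n ∈ Finset.range m, hMinusNorm (f (tmid Δt n)) ^ 2
      ≤ ∑ n ∈ Finset.range M, hMinusNorm (f (tmid Δt n)) ^ 2 :=
    Finset.sum_le_sum_of_subset_of_nonneg (Finset.range_mono hm) fun _ _ _ => sq_nonneg _
  have h5 := mul_le_mul_of_nonneg_left h4 (by positivity : 0 ≤ Δt * Re)
  linarith

end Scheme

/-! ### Coercive finite-dimensional variational problems -/

section Abstract

/-- A finite-dimensional variational problem that is coercive with respect to a Euclidean norm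
has a solution. -/
lemma exists_forall_eq_zero_of_coercive {V E : Type*} [AddCommGroup V] [Module ℝ V]
    [FiniteDimensional ℝ V] [NormedAddCommGroup E] [InnerProductSpace ℝ E] (e : V →ₗ[ℝ] E)
    (he : Function.Injective e) (res : V → V → ℝ)
    (hadd : ∀ u v w, res u (v + w) = res u v + res u w)
    (hsmul : ∀ (a : ℝ) (u v), res u (a • v) = a * res u v)
    (hcont : ∀ {m : ℕ} (Ψ : Vec m →ₗ[ℝ] V) (v : V), Continuous fun c => res (Ψ c) v)
    {R : ℝ} (hpos : ∀ u, R ≤ ‖e u‖ → 0 < res u u) : ∃ u, ∀ v, res u v = 0 := by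
  let L : V → V →ₗ[ℝ] ℝ := fun u =>
    { toFun := res u, map_add' := hadd u, map_smul' := fun a v => hsmul a u v }
  let eW : V ≃ₗ[ℝ] LinearMap.range e := LinearEquiv.ofInjective e he
  let b := stdOrthonormalBasis ℝ (LinearMap.range e)
  -- Coordinates orthonormal for `‖e ·‖` make the Euclidean norm agree with the norm in the
  -- coercivity hypothesis, and `P` is the residual in these coordinates.
  let Ψ : Vec (Module.finrank ℝ (LinearMap.range e)) ≃ₗ[ℝ] V :=
    b.repr.symm.toLinearEquiv.trans eW.symm
  have hnorm : ∀ c, ‖e (Ψ c)‖ = ‖c‖ := by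
    intro c
    have h1 : e (Ψ c) = (eW (eW.symm (b.repr.symm c)) : E) := rfl
    rw [h1, LinearEquiv.apply_symm_apply]
    exact b.repr.symm.norm_map c
  let P : Vec (Module.finrank ℝ (LinearMap.range e)) →
      Vec (Module.finrank ℝ (LinearMap.range e)) := fun c =>
    WithLp.toLp 2 fun i => res (Ψ c) (Ψ (EuclideanSpace.single i 1))
  have hP : Continuous P :=
    (PiLp.continuous_toLp 2 _).comp (continuous_pi fun i => hcont Ψ.toLinearMap _)
  have hinner : ∀ c c', inner ℝ (P c) c' = res (Ψ c) (Ψ c') := by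
    intro c c'
    have h1 : c' = ∑ i, c' i • EuclideanSpace.single i (1 : ℝ) := by
      conv_lhs => rw [← (EuclideanSpace.basisFun _ ℝ).sum_repr c']
      simp
    have h2 : res (Ψ c) (Ψ c') = L (Ψ c) (Ψ c') := rfl
    rw [h2]
    conv_rhs => rw [h1]
    rw [map_sum, map_sum, PiLp.inner_apply]
    refine Finset.sum_congr rfl fun i _ => ?_
    rw [map_smul, map_smul]
    rfl
  obtain ⟨c, hc⟩ := exists_eq_zero_of_inner_pos hP (R := R) fun c hc => by
    rw [hinner]
    exact hpos _ (by rwa [hnorm])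
  refine ⟨Ψ c, fun v => ?_⟩
  rw [← Ψ.apply_symm_apply v, ← hinner, hc, inner_zero_left]

end Abstract

/-! ### Existence of discrete solutions -/

section Existence

variable {d : ℕ} {Ω : Set (Vec d)} {F : Formulation} {Re ν s Δt C : ℝ}

/-- The residual of one step of the scheme, as a function of the midpoint value `u`. -/
def residual (F : Formulation) (Re ν s Δt : ℝ) (f : StrongDual ℝ (H10 Ω)) (a u v : H10 Ω) : ℝ :=
  2 / Δt * inner ℝ (vel u - vel a) (vel v) + Re⁻¹ * inner ℝ (grad u) (grad v)
    + ν * ladForm s u v + F.form u u v - f v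

lemma residual_add (hs : 0 ≤ s) (f : StrongDual ℝ (H10 Ω)) (a : H10 Ω) {u v w : H10 Ω}
    (hu : u ∈ bddSubmodule Ω) (hv : v ∈ bddSubmodule Ω) (hw : w ∈ bddSubmodule Ω) :
    residual F Re ν s Δt f a u (v + w)
      = residual F Re ν s Δt f a u v + residual F Re ν s Δt f a u w := by
  have h1 : inner ℝ (vel u - vel a) (vel (v + w))
      = inner ℝ (vel u - vel a) (vel v) + inner ℝ (vel u - vel a) (vel w) := inner_add_right _ _ _
  have h2 : inner ℝ (grad u) (grad (v + w))
      = inner ℝ (grad u) (grad v) + inner ℝ (grad u) (grad w) := inner_add_right _ _ _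
  have h3 : f (v + w) = f v + f w := map_add f v w
  unfold residual
  linear_combination 2 / Δt * h1 + Re⁻¹ * h2 - h3 + ν * ladForm_add_right hs hu v w
    + form_add_right F hu hu hv hw

lemma residual_smul (f : StrongDual ℝ (H10 Ω)) (a : H10 Ω) (t : ℝ) {u v : H10 Ω}
    (hu : u ∈ bddSubmodule Ω) (hv : v ∈ bddSubmodule Ω) :
    residual F Re ν s Δt f a u (t • v) = t * residual F Re ν s Δt f a u v := by
  have h1 : inner ℝ (vel u - vel a) (vel (t • v)) = t * inner ℝ (vel u - vel a) (vel v) :=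
    real_inner_smul_right _ _ _
  have h2 : inner ℝ (grad u) (grad (t • v)) = t * inner ℝ (grad u) (grad v) :=
    real_inner_smul_right _ _ _
  have h3 : f (t • v) = t * f v := map_smul f t v
  unfold residual
  linear_combination 2 / Δt * h1 + Re⁻¹ * h2 - h3 + ν * ladForm_smul_right (s := s) t u v
    + form_smul_right F t hu hv

lemma continuous_residual (hs : 0 ≤ s) (f : StrongDual ℝ (H10 Ω)) (a : H10 Ω) {m : ℕ}
    (Ψ : Vec m →ₗ[ℝ] H10 Ω) (hΨ : ∀ c, Ψ c ∈ bddSubmodule Ω) {v : H10 Ω}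
    (hv : v ∈ bddSubmodule Ω) : Continuous fun c => residual F Re ν s Δt f a (Ψ c) v := by
  have h1 : Continuous fun c => vel (Ψ c) :=
    (velₗ ∘ₗ Ψ).continuous_of_finiteDimensional
  have h2 : Continuous fun c => grad (Ψ c) :=
    (gradₗ ∘ₗ Ψ).continuous_of_finiteDimensional
  exact ((((continuous_const.mul ((h1.sub continuous_const).inner continuous_const)).add
    (continuous_const.mul (h2.inner continuous_const))).add
    (continuous_const.mul (continuous_ladForm hs Ψ hΨ v))).add
    (continuous_form F Ψ hΨ hv)).sub continuous_const

/-- Completing the square in `g` costs `Re Φ² / 4`. Since `x ≥ 1`, `x (x - α) ≥ x - α`, and the term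
`Δt Re Φ² / 8` in the threshold, times `2 / Δt`, pays for exactly that; the remaining `1` gives
strictness. -/
lemma coercive_arith {Re Δt ν p x α g Φ : ℝ} (hRe : 0 < Re) (hΔt : 0 < Δt) (hα : 0 ≤ α)
    (hνp : 0 ≤ ν * p) (hx : α + 1 + Δt * Re * Φ ^ 2 / 8 ≤ x) :
    0 < 2 / Δt * (x ^ 2 - α * x) + Re⁻¹ * g ^ 2 + ν * p - Φ * g := by
  have h1 : -(Re * Φ ^ 2 / 4) ≤ Re⁻¹ * g ^ 2 - Φ * g := by
    have h2 : 0 ≤ Re⁻¹ * (g - Re * Φ / 2) ^ 2 := by positivity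
    have h3 : Re⁻¹ * (g - Re * Φ / 2) ^ 2 = Re⁻¹ * g ^ 2 - Φ * g + Re * Φ ^ 2 / 4 := by
      field_simp
      ring
    linarith
  have h0 : 0 ≤ Δt * Re * Φ ^ 2 / 8 := by positivity
  have h4 : 1 + Δt * Re * Φ ^ 2 / 8 ≤ x ^ 2 - α * x := by nlinarith
  have h5 := mul_le_mul_of_nonneg_left h4 (by positivity : 0 ≤ 2 / Δt)
  have h6 : 2 / Δt * (1 + Δt * Re * Φ ^ 2 / 8) = 2 / Δt + Re * Φ ^ 2 / 4 := by
    field_simp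
    ring
  have h7 : 0 < 2 / Δt := by positivity
  linarith

lemma residual_self_pos (hRe : 0 < Re) (hν : 0 ≤ ν) (hs : 0 ≤ s) (hΔt : 0 < Δt)
    (hC : ∀ u : H10 Ω, ‖vel u‖ ≤ C * ‖grad u‖) (f : StrongDual ℝ (H10 Ω)) (a : H10 Ω) {u : H10 Ω}
    (hu : u ∈ bddSubmodule Ω) (hx : ‖vel a‖ + 1 + Δt * Re * hMinusNorm f ^ 2 / 8 ≤ ‖vel u‖) :
    0 < residual F Re ν s Δt f a u u := by
  have hf := apply_le_hMinusNorm hC f u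
  have h1 := coercive_arith (g := ‖grad u‖) hRe hΔt (norm_nonneg (vel a))
    (mul_nonneg hν (gradPow_nonneg s u)) hx
  have h2 := real_inner_le_norm (vel a) (vel u)
  have h3 : 2 / Δt * (‖vel u‖ ^ 2 - ‖vel a‖ * ‖vel u‖)
      ≤ 2 / Δt * (‖vel u‖ ^ 2 - inner ℝ (vel a) (vel u)) :=
    mul_le_mul_of_nonneg_left (by linarith) (by positivity)
  rw [residual, form_self F hu, ladForm_self hs, inner_sub_left, real_inner_self_eq_norm_sq,
    real_inner_self_eq_norm_sq]
  linarith

lemma half_smul_two_smul_sub_add {E : Type*} [AddCommGroup E] [Module ℝ E] (u a : E) :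
    (1 / 2 : ℝ) • ((2 : ℝ) • u - a + a) = u := by
  rw [sub_add_cancel, smul_smul]
  norm_num

lemma inner_two_smul_sub_sub {E : Type*} [NormedAddCommGroup E] [InnerProductSpace ℝ E]
    (u a v : E) : inner ℝ ((2 : ℝ) • u - a - a) v = 2 * inner ℝ (u - a) v := by
  rw [← real_inner_smul_left, smul_sub, two_smul ℝ a, sub_sub]

/-- The new value is the reflection `b = 2u - a`, for which `u` is the midpoint and `b - a = 2 (u -
a)`. -/
lemma exists_step_of_residual (V : Submodule ℝ (H10 Ω)) (f : StrongDual ℝ (H10 Ω))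
    {a u : H10 Ω} (ha : a ∈ V) (hu : u ∈ V) (h : ∀ v ∈ V, residual F Re ν s Δt f a u v = 0) :
    ∃ b ∈ V, ∀ v ∈ V, 1 / Δt * inner ℝ (vel b - vel a) (vel v)
        + Re⁻¹ * inner ℝ (grad ((1 / 2 : ℝ) • (b + a))) (grad v)
        + ν * ladForm s ((1 / 2 : ℝ) • (b + a)) v
        + F.form ((1 / 2 : ℝ) • (b + a)) ((1 / 2 : ℝ) • (b + a)) v = f v := by
  refine ⟨(2 : ℝ) • u - a, V.sub_mem (V.smul_mem _ hu) ha, fun v hv => ?_⟩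
  have h1 := h v hv
  have h2 : inner ℝ (vel ((2 : ℝ) • u - a) - vel a) (vel v) = 2 * inner ℝ (vel u - vel a) (vel v) :=
    inner_two_smul_sub_sub _ _ _
  rw [half_smul_two_smul_sub_add, h2, ← sub_eq_zero, ← h1]
  unfold residual
  ring

/-- Solvability of one time step. -/
lemma exists_step (hΩ : IsOpen Ω) (V : Submodule ℝ (H10 Ω)) [FiniteDimensional ℝ V]
    (hV : V ≤ bddSubmodule Ω) (F : Formulation) (hRe : 0 < Re) (hν : 0 ≤ ν) (hs : 0 ≤ s)
    (hΔt : 0 < Δt) (hC : ∀ u : H10 Ω, ‖vel u‖ ≤ C * ‖grad u‖) (f : StrongDual ℝ (H10 Ω))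
    {a : H10 Ω} (ha : a ∈ V) : ∃ b ∈ V, ∀ v ∈ V,
      1 / Δt * inner ℝ (vel b - vel a) (vel v)
        + Re⁻¹ * inner ℝ (grad ((1 / 2 : ℝ) • (b + a))) (grad v)
        + ν * ladForm s ((1 / 2 : ℝ) • (b + a)) v
        + F.form ((1 / 2 : ℝ) • (b + a)) ((1 / 2 : ℝ) • (b + a)) v = f v := by
  obtain ⟨u, hu⟩ := exists_forall_eq_zero_of_coercive (velₗ ∘ₗ V.subtype)
    ((vel_injective hΩ).comp Subtype.val_injective)
    (fun u v => residual F Re ν s Δt f a (u : H10 Ω) (v : H10 Ω))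
    (fun u v w => residual_add hs f a (hV u.2) (hV v.2) (hV w.2))
    (fun t u v => residual_smul f a t (hV u.2) (hV v.2))
    (fun Ψ v => continuous_residual hs f a (V.subtype ∘ₗ Ψ) (fun c => hV (Ψ c).2) (hV v.2))
    (fun u hu => residual_self_pos hRe hν hs hΔt hC f a (hV u.2) hu)
  exact exists_step_of_residual V f ha u.2 fun v hv => hu ⟨v, hv⟩

lemma exists_seq_of_forall_exists {α : Type*} {p : α → Prop} {r : ℕ → α → α → Prop} {a₀ : α}
    (h₀ : p a₀) (h : ∀ n a, p a → ∃ b, p b ∧ r n a b) :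
    ∃ w : ℕ → α, w 0 = a₀ ∧ ∀ n, p (w n) ∧ r n (w n) (w (n + 1)) := by
  choose step hstep hstep' using h
  let w : ℕ → {a // p a} := fun n =>
    Nat.rec ⟨a₀, h₀⟩ (fun n a => ⟨step n a a.2, hstep n a a.2⟩) n
  exact ⟨fun n => (w n).1, rfl, fun n => ⟨(w n).2, hstep' n (w n).1 (w n).2⟩⟩

lemma exists_isDiscreteSolution (hΩ : IsOpen Ω) (V : Submodule ℝ (H10 Ω)) [FiniteDimensional ℝ V]
    (hV : V ≤ bddSubmodule Ω) (F : Formulation) (hRe : 0 < Re) (hν : 0 ≤ ν) (hs : 0 ≤ s)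
    (hΔt : 0 < Δt) (hC : ∀ u : H10 Ω, ‖vel u‖ ≤ C * ‖grad u‖) (f : ℝ → StrongDual ℝ (H10 Ω))
    (M : ℕ) {w₀ : H10 Ω} (hw₀ : w₀ ∈ V) :
    ∃ w : ℕ → H10 Ω, w 0 = w₀ ∧ IsDiscreteSolution F V Re ν s Δt f M w := by
  obtain ⟨w, h0, hw⟩ := exists_seq_of_forall_exists (p := (· ∈ V)) hw₀ fun n a ha =>
    exists_step hΩ V hV F hRe hν hs hΔt hC (f (tmid Δt n)) ha
  exact ⟨w, h0, fun n _ => (hw n).1, fun n _ => (hw n).2⟩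

end Existence

/-! ### Comparison of two solutions over one step -/

section Uniqueness

variable {d : ℕ} {Ω : Set (Vec d)} {F : Formulation} {Re ν s Δt A A' : ℝ}

/-- The difference of the convective terms of two bounded fields. -/
lemma abs_form_sub_form_le (F : Formulation) {u u' e : H10 Ω} (hu : u ∈ bddSubmodule Ω)
    (hu' : u' ∈ bddSubmodule Ω) (he : u = u' + e) (hA : 0 ≤ A) (hA' : 0 ≤ A')
    (huA : VelBound u A) (huA' : GradBound u A') (huA'' : GradBound u' A') :
    |F.form u u e - F.form u' u' e| ≤ 6 * (‖convTensor d‖ + ‖divTensor d‖)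
      * (A' * ‖vel e‖ ^ 2 + A * (‖grad e‖ * ‖vel e‖)) := by
  have heb : e ∈ bddSubmodule Ω := by
    rw [eq_sub_of_add_eq' he.symm]
    exact Submodule.sub_mem _ hu hu'
  -- For SKEW the second summand vanishes. For EMAC each summand consists of three terms, whence the
  -- factor 6. When `e` fills both velocity slots the gradient bound applies; otherwise the velocity
  -- bound of `u` does.
  have hsplit : F.form u u e - F.form u' u' e = F.form e u e + F.form u' e e := by
    have h1 : F.form u u e = F.form u' u e + F.form e u e := by
      rw [← form_add_left F hu' heb hu heb, ← he]
    have h2 : F.form u' u e = F.form u' u' e + F.form u' e e := by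
      rw [← form_add_mid F hu' hu' heb heb, ← he]
    rw [h1, h2]
    ring
  rw [hsplit]
  set T := A' * ‖vel e‖ ^ 2 + A * (‖grad e‖ * ‖vel e‖) with hT
  have hle1 : A' * (‖vel e‖ * ‖vel e‖) ≤ T := by
    rw [hT, sq]
    exact le_add_of_nonneg_right (by positivity)
  have hle2 : A * (‖grad e‖ * ‖vel e‖) ≤ T := le_add_of_nonneg_left (by positivity)
  have hT0 : 0 ≤ T := by positivity
  have hκ : ∀ Φ : Tensor d, Φ = convTensor d ∨ Φ = divTensor d →
      ∀ y, y ≤ T → ‖Φ‖ * y ≤ (‖convTensor d‖ + ‖divTensor d‖) * T := by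
    rintro Φ hΦ y hy
    refine (mul_le_mul_of_nonneg_left hy (norm_nonneg Φ)).trans
      (mul_le_mul_of_nonneg_right ?_ hT0)
    rcases hΦ with rfl | rfl
    · exact le_add_of_nonneg_right (norm_nonneg _)
    · exact le_add_of_nonneg_left (norm_nonneg _)
  have b1 : ∀ Φ : Tensor d, Φ = convTensor d ∨ Φ = divTensor d → ∀ v, GradBound v A' →
      |tri Φ e v e| ≤ (‖convTensor d‖ + ‖divTensor d‖) * T := fun Φ hΦ v hv =>
    (abs_tri_le_of_gradBound Φ hA' hv).trans (by rw [mul_assoc]; exact hκ Φ hΦ _ hle1)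
  have b2 : ∀ Φ : Tensor d, Φ = convTensor d ∨ Φ = divTensor d →
      |tri Φ u e e| ≤ (‖convTensor d‖ + ‖divTensor d‖) * T := fun Φ hΦ =>
    (abs_tri_le_of_velBound_left Φ hA huA).trans (by rw [mul_assoc]; exact hκ Φ hΦ _ hle2)
  have b3 : |tri (convTensor d) e e u| ≤ (‖convTensor d‖ + ‖divTensor d‖) * T :=
    (abs_tri_le_of_velBound_right _ hA huA).trans (by
      rw [mul_assoc, mul_comm ‖vel e‖]; exact hκ _ (Or.inl rfl) _ hle2)
  have hκT : 0 ≤ (‖convTensor d‖ + ‖divTensor d‖) * T := by positivity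
  rw [mul_assoc]
  set K := (‖convTensor d‖ + ‖divTensor d‖) * T
  cases F
  · rw [form_skew_eq, form_skew_eq, sub_self, mul_zero, add_zero]
    have c1 := abs_le.1 (b1 _ (Or.inl rfl) u huA')
    have c2 := abs_le.1 b3
    rw [abs_le]
    constructor <;> linarith [c1.1, c1.2, c2.1, c2.2]
  · rw [form_emac_eq _ hu heb, form_emac_eq _ heb heb]
    have c1 := abs_le.1 (b2 _ (Or.inl rfl))
    have c2 := abs_le.1 b3
    have c3 := abs_le.1 (b2 _ (Or.inr rfl))
    have c4 := abs_le.1 (b1 _ (Or.inl rfl) u' huA'')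
    have c5 := abs_le.1 (b1 _ (Or.inr rfl) u' huA'')
    rw [abs_le]
    constructor <;> linarith [c1.1, c1.2, c2.1, c2.2, c3.1, c3.2, c4.1, c4.2, c5.1, c5.2]

lemma inner_sub_inner_eq_norm_sq {E : Type*} [NormedAddCommGroup E] [InnerProductSpace ℝ E]
    (x y : E) : inner ℝ x (x - y) - inner ℝ y (x - y) = ‖x - y‖ ^ 2 := by
  rw [← inner_sub_left, real_inner_self_eq_norm_sq]

lemma sub_eq_two_smul_of_half {E : Type*} [AddCommGroup E] [Module ℝ E] {a b b' u u' : E}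
    (h : u = (1 / 2 : ℝ) • (b + a)) (h' : u' = (1 / 2 : ℝ) • (b' + a)) :
    b - b' = (2 : ℝ) • (u - u') := by
  rw [h, h', ← smul_sub, smul_smul, add_sub_add_right_eq_sub]
  norm_num

lemma inner_sub_inner_eq_two_mul {E : Type*} [NormedAddCommGroup E] [InnerProductSpace ℝ E]
    {a b b' e : E} (h : b - b' = (2 : ℝ) • e) :
    inner ℝ (b - a) e - inner ℝ (b' - a) e = 2 * ‖e‖ ^ 2 := by
  rw [← inner_sub_left, sub_sub_sub_cancel_right, h, real_inner_smul_left,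
    real_inner_self_eq_norm_sq]

/-- In the difference of the two equations the viscous and power-law terms have the good sign and
are discarded, leaving `2 x² ≤ K Δt x²`. The threshold for `Δt` therefore does not involve `Re` or
`ν`. -/
lemma eq_zero_of_coercive_balance {Re ν Δt K x g l l' n n' i i' j j' y : ℝ} (hRe : 0 < Re)
    (hν : 0 ≤ ν) (hΔt : 0 < Δt) (hK : K * Δt < 2) (hlad : 0 ≤ l - l') (hi : i - i' = 2 * x ^ 2)
    (hj : j - j' = g ^ 2) (hn : |n - n'| ≤ K * x ^ 2)
    (h : 1 / Δt * i + Re⁻¹ * j + ν * l + n = y) (h' : 1 / Δt * i' + Re⁻¹ * j' + ν * l' + n' = y) :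
    x = 0 := by
  have hν' := mul_nonneg hν hlad
  have hRe' : 0 ≤ Re⁻¹ * g ^ 2 := by positivity
  have hsum : 1 / Δt * (2 * x ^ 2) + Re⁻¹ * g ^ 2 + ν * (l - l') + (n - n') = 0 := by
    rw [← hi, ← hj]
    linarith
  have hle : 1 / Δt * (2 * x ^ 2) ≤ K * x ^ 2 := by linarith [neg_abs_le (n - n')]
  have hle' : 2 * x ^ 2 ≤ K * Δt * x ^ 2 := by
    have h1 := mul_le_mul_of_nonneg_left hle hΔt.le
    have h2 : Δt * (1 / Δt * (2 * x ^ 2)) = 2 * x ^ 2 := by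
      field_simp
    linarith
  by_contra hne
  exact absurd hle' (not_le.2 (mul_lt_mul_of_pos_right hK (by positivity)))

/-- Uniqueness for one time step. -/
lemma vel_eq_of_step {K : ℝ} (hRe : 0 < Re) (hν : 0 ≤ ν) (hs : 0 ≤ s) (hΔt : 0 < Δt)
    (hK : K * Δt < 2) (f : StrongDual ℝ (H10 Ω)) {a b b' u u' : H10 Ω}
    (hub : vel u = (1 / 2 : ℝ) • (vel b + vel a)) (hub' : vel u' = (1 / 2 : ℝ) • (vel b' + vel a))
    (hu : u ∈ bddSubmodule Ω) (hu' : u' ∈ bddSubmodule Ω)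
    (hform : |F.form u u (u - u') - F.form u' u' (u - u')| ≤ K * ‖vel (u - u')‖ ^ 2)
    (h : 1 / Δt * inner ℝ (vel b - vel a) (vel (u - u')) + Re⁻¹ * inner ℝ (grad u) (grad (u - u'))
      + ν * ladForm s u (u - u') + F.form u u (u - u') = f (u - u'))
    (h' : 1 / Δt * inner ℝ (vel b' - vel a) (vel (u - u'))
      + Re⁻¹ * inner ℝ (grad u') (grad (u - u'))
      + ν * ladForm s u' (u - u') + F.form u' u' (u - u') = f (u - u')) : vel b = vel b' := by
  have hgrad : inner ℝ (grad u) (grad (u - u')) - inner ℝ (grad u') (grad (u - u'))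
      = ‖grad (u - u')‖ ^ 2 := inner_sub_inner_eq_norm_sq _ _
  have hb : vel b - vel b' = (2 : ℝ) • vel (u - u') := sub_eq_two_smul_of_half hub hub'
  have hvel : inner ℝ (vel b - vel a) (vel (u - u')) - inner ℝ (vel b' - vel a) (vel (u - u'))
      = 2 * ‖vel (u - u')‖ ^ 2 := inner_sub_inner_eq_two_mul hb
  have h0 := eq_zero_of_coercive_balance hRe hν hΔt hK (ladForm_monotone hs hu hu') hvel hgrad hform
    h h'
  rw [norm_eq_zero.1 h0, smul_zero] at hb
  exact sub_eq_zero.1 hb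

end Uniqueness

/-! ### Uniqueness over all steps and the choice of the time-step constant -/

variable {d : ℕ} {Ω : Set (Vec d)}

lemma Triangulation.exists_poincare (hd : 0 < d) (hΩ : IsOpen Ω) (𝒯 : Triangulation Ω) :
    ∃ C, ∀ u : H10 Ω, ‖vel u‖ ≤ C * ‖grad u‖ := by
  obtain ⟨R, hR⟩ := 𝒯.isCompact_closure.isBounded.exists_norm_le
  exact ⟨_, fun u => norm_vel_le_norm_grad hd (fun x hx => hR x (subset_closure hx))
    hΩ.measurableSet u⟩

lemma norm_half_smul_add_le {E : Type*} [NormedAddCommGroup E] [NormedSpace ℝ E] {a b : E} {R : ℝ}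
    (ha : ‖a‖ ≤ R) (hb : ‖b‖ ≤ R) : ‖(1 / 2 : ℝ) • (b + a)‖ ≤ R := by
  rw [norm_smul, Real.norm_of_nonneg (by norm_num)]
  linarith [norm_add_le b a]

lemma norm_vel_midpt_le {w : ℕ → H10 Ω} {n : ℕ} {R : ℝ} (h : ‖vel (w n)‖ ≤ R)
    (h' : ‖vel (w (n + 1))‖ ≤ R) : ‖vel (midpt w n)‖ ≤ R := by
  rw [vel_midpt]
  exact norm_half_smul_add_le h h'

lemma VelBound.mono {u : H10 Ω} {A A' : ℝ} (h : VelBound u A) (hA : A ≤ A') : VelBound u A' := by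
  filter_upwards [h] with x hx
  exact hx.trans hA

lemma GradBound.mono {u : H10 Ω} {A A' : ℝ} (h : GradBound u A) (hA : A ≤ A') :
    GradBound u A' := by
  filter_upwards [h] with x hx
  exact hx.trans hA

/-- With `η = h^{-d/2}`, each of the two convective contributions scales like `η / h = h^{-1-d/2}`,
which is the origin of the time-step exponent. -/
lemma inverse_arith {κ C η R h x g : ℝ} (hκ : 0 ≤ κ) (hR : 0 ≤ C * (η * R)) (hx : 0 ≤ x)
    (hg : g ≤ C * x / h) : κ * (C * (η * R) / h * x ^ 2 + C * (η * R) * (g * x))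
      ≤ κ * ((C + C ^ 2) * R) * (η / h) * x ^ 2 := by
  have h1 := mul_le_mul_of_nonneg_left (mul_le_mul_of_nonneg_left
    (mul_le_mul_of_nonneg_right hg hx) hR) hκ
  calc κ * (C * (η * R) / h * x ^ 2 + C * (η * R) * (g * x))
      ≤ κ * (C * (η * R) / h * x ^ 2) + κ * (C * (η * R) * (C * x / h * x)) := by
        rw [mul_add]
        exact add_le_add_right h1 _
    _ = κ * ((C + C ^ 2) * R) * (η / h) * x ^ 2 := by ring

/-- Two solutions coincide if the inverse estimates hold and the time step is small. -/
lemma IsDiscreteSolution.unique {F : Formulation} {V : Submodule ℝ (H10 Ω)} {Re ν s Δt : ℝ}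
    {f : ℝ → StrongDual ℝ (H10 Ω)} {M : ℕ} {w w' : ℕ → H10 Ω} {C R η h : ℝ}
    (hw : IsDiscreteSolution F V Re ν s Δt f M w) (hw' : IsDiscreteSolution F V Re ν s Δt f M w')
    (hΩ : IsOpen Ω) (hV : V ≤ bddSubmodule Ω) (hRe : 0 < Re) (hν : 0 ≤ ν) (hs : 0 ≤ s)
    (hΔt : 0 < Δt) (hC : 0 ≤ C) (hR : 0 ≤ R) (hη : 0 ≤ η) (hh : 0 < h)
    (hest : ∀ u ∈ V, VelBound u (C * (η * ‖vel u‖)) ∧ GradBound u (C * (η * ‖vel u‖) / h) ∧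
      ‖grad u‖ ≤ C * ‖vel u‖ / h)
    (hwR : ∀ n ≤ M, ‖vel (w n)‖ ≤ R) (hwR' : ∀ n ≤ M, ‖vel (w' n)‖ ≤ R)
    (hK : 6 * (‖convTensor d‖ + ‖divTensor d‖) * ((C + C ^ 2) * R) * (η / h) * Δt < 2)
    (h0 : w 0 = w' 0) : ∀ n ≤ M, w n = w' n := by
  intro n
  induction n with
  | zero => exact fun _ => h0
  | succ n ih =>
    intro hn
    have ha := ih (by omega)
    have hu : midpt w n ∈ V := midpt_mem (hw.1 n (by omega)) (hw.1 (n + 1) hn)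
    have hu' : midpt w' n ∈ V := midpt_mem (hw'.1 n (by omega)) (hw'.1 (n + 1) hn)
    have he : midpt w n - midpt w' n ∈ V := V.sub_mem hu hu'
    have hnorm : ‖vel (midpt w n)‖ ≤ R := norm_vel_midpt_le (hwR n (by omega)) (hwR (n + 1) hn)
    have hnorm' : ‖vel (midpt w' n)‖ ≤ R :=
      norm_vel_midpt_le (hwR' n (by omega)) (hwR' (n + 1) hn)
    have hmono : ∀ x, x ≤ R → C * (η * x) ≤ C * (η * R) := fun x hx => by gcongr
    have hmono' : ∀ x, x ≤ R → C * (η * x) / h ≤ C * (η * R) / h := fun x hx => by gcongr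
    obtain ⟨e1, e2, -⟩ := hest _ hu
    obtain ⟨-, e3, -⟩ := hest _ hu'
    obtain ⟨-, -, e4⟩ := hest _ he
    have hform := abs_form_sub_form_le F (hV hu) (hV hu') (add_sub_cancel _ _).symm
      (by positivity : 0 ≤ C * (η * R)) (by positivity : 0 ≤ C * (η * R) / h)
      (e1.mono (hmono _ hnorm)) (e2.mono (hmono' _ hnorm)) (e3.mono (hmono' _ hnorm'))
    have hform' := hform.trans (inverse_arith (by positivity) (by positivity) (norm_nonneg _) e4)
    have hveln : vel (midpt w' n) = (1 / 2 : ℝ) • (vel (w' (n + 1)) + vel (w n)) := by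
      rw [vel_midpt, ha]
    have hstep' := hw'.2 n (by omega) _ he
    rw [← ha] at hstep'
    exact vel_injective hΩ (vel_eq_of_step hRe hν hs hΔt hK (f (tmid Δt n)) (vel_midpt w n) hveln
      (hV hu) (hV hu') hform' (hw.2 n (by omega) _ he) hstep')

lemma finiteDimensional_vhSubmodule {𝒯 : Triangulation Ω} {k : ℕ} {Xh : Submodule ℝ (H10 Ω)}
    (hX : 𝒯.IsFESpace k Xh) (hΩ : IsOpen Ω) (Qh : Submodule ℝ (L2Scal Ω)) :
    FiniteDimensional ℝ (vhSubmodule Xh Qh) :=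
  haveI := hX.finiteDimensional hΩ
  Submodule.finiteDimensional_of_le (vhSubmodule_le Xh Qh)

/-- `h^{1+d/2} = h √(h^d)`. -/
lemma rpow_one_add_half {h : ℝ} (hh : 0 < h) (d : ℕ) :
    h ^ (1 + (d : ℝ) / 2) = h * √(h ^ d) := by
  rw [Real.rpow_add hh, Real.rpow_one, Real.sqrt_eq_rpow, ← Real.rpow_natCast,
    ← Real.rpow_mul hh.le]
  congr 2
  ring

/-- The excess power `h^{2 - d/2}` has exponent in `[0, 1]` for these dimensions, so it is at most
`D`. -/
lemma cube_le_rpow_mul {h D : ℝ} (hh : 0 < h) (hD : 1 ≤ D) (hhD : h ≤ D) {d : ℕ} (hd : 2 ≤ d)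
    (hd' : d ≤ 4) : h ^ 3 ≤ h ^ (1 + (d : ℝ) / 2) * D := by
  have hd1 : (2 : ℝ) ≤ d := by exact_mod_cast hd
  have hd2 : (d : ℝ) ≤ 4 := by exact_mod_cast hd'
  have h1 : h ^ 3 = h ^ (1 + (d : ℝ) / 2) * h ^ (2 - (d : ℝ) / 2) := by
    rw [← Real.rpow_add hh, ← Real.rpow_natCast]
    norm_num
  rw [h1]
  refine mul_le_mul_of_nonneg_left ?_ (Real.rpow_nonneg hh.le _)
  calc h ^ (2 - (d : ℝ) / 2) ≤ D ^ (2 - (d : ℝ) / 2) :=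
        Real.rpow_le_rpow hh.le hhD (by linarith)
    _ ≤ D ^ (1 : ℝ) := Real.rpow_le_rpow_of_exponent_le hD (by linarith)
    _ = D := Real.rpow_one D

/-- A mesh size of zero would make both conditions contradict `Δt > 0`; this rules out the default
value of `h` for a mesh without cells. -/
lemma pos_of_lt_mul_rpow {h c Δt : ℝ} {d : ℕ} (hh : 0 ≤ h) (hΔt : 0 < Δt) {P : Prop}
    (h' : Δt < c * h ^ (1 + (d : ℝ) / 2) ∨ (P ∧ Δt ≤ c * h ^ 3)) : 0 < h := by
  refine lt_of_le_of_ne hh fun h0 => ?_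
  rw [← h0, Real.zero_rpow (by positivity), zero_pow three_ne_zero, mul_zero] at h'
  rcases h' with h' | h'
  · exact absurd h' hΔt.not_gt
  · exact absurd h'.2 hΔt.not_ge

lemma small_step_arith {Q D h Δt : ℝ} (hQ : 0 ≤ Q) (hD : 1 ≤ D) (hh : 0 < h) (hhD : h ≤ D)
    {d : ℕ} (hd : 2 ≤ d) (hd' : d ≤ 4) {P : Prop}
    (h' : Δt < 1 / ((Q + 1) * D) * h ^ (1 + (d : ℝ) / 2) ∨
      (P ∧ Δt ≤ 1 / ((Q + 1) * D) * h ^ 3)) :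
    Q * ((√(h ^ d))⁻¹ / h) * Δt < 2 := by
  have hsq : 0 < √(h ^ d) := Real.sqrt_pos.2 (pow_pos hh d)
  have hpow := rpow_one_add_half hh d
  have hle : Δt ≤ 1 / (Q + 1) * (h * √(h ^ d)) := by
    rcases h' with h' | h'
    · refine h'.le.trans ?_
      rw [hpow]
      refine mul_le_mul_of_nonneg_right ?_ (by positivity)
      exact one_div_le_one_div_of_le (by positivity) (le_mul_of_one_le_right (by positivity) hD)
    · refine h'.2.trans ((mul_le_mul_of_nonneg_left (cube_le_rpow_mul hh hD hhD hd hd')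
        (by positivity)).trans (le_of_eq ?_))
      rw [hpow]
      have : D ≠ 0 := by positivity
      field_simp
  calc Q * ((√(h ^ d))⁻¹ / h) * Δt
      ≤ Q * ((√(h ^ d))⁻¹ / h) * (1 / (Q + 1) * (h * √(h ^ d))) :=
        mul_le_mul_of_nonneg_left hle (by positivity)
    _ = Q / (Q + 1) := by field_simp
    _ < 2 := by rw [div_lt_iff₀ (by positivity)]; linarith

/-- Uniqueness of the discrete solution for time steps small relative to the mesh size. -/
theorem exists_unique_timestep_const (hd : 2 ≤ d) (hd' : d ≤ 4) (hΩ : IsOpen Ω) (k : ℕ) {σ : ℝ}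
    (B : ℝ) (hσ : 0 < σ) : ∃ c : ℝ, 0 < c ∧ ∀ (𝒯 : Triangulation Ω)
      (Xh : Submodule ℝ (H10 Ω)) (Qh : Submodule ℝ (L2Scal Ω)),
      𝒯.IsQuasiUniform σ → 𝒯.IsFESpace k Xh →
      ∀ (F : Formulation) {Re ν s Δt : ℝ}, 0 < Re → 0 ≤ ν → 0 ≤ s → 0 < Δt →
      (Δt < c * 𝒯.h ^ (1 + (d : ℝ) / 2) ∨ (F = Formulation.skew ∧ Δt ≤ c * 𝒯.h ^ 3)) →
      ∀ (f : ℝ → StrongDual ℝ (H10 Ω)) (M : ℕ) (w w' : ℕ → H10 Ω),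
        IsDiscreteSolution F (Vh Xh Qh) Re ν s Δt f M w →
        IsDiscreteSolution F (Vh Xh Qh) Re ν s Δt f M w' → w 0 = w' 0 →
        ‖vel (w 0)‖ ^ 2 + Δt * Re * ∑ n ∈ Finset.range M, hMinusNorm (f (tmid Δt n)) ^ 2 ≤ B →
        ∀ n ≤ M, w n = w' n := by
  obtain ⟨C, hC, hinv⟩ := Triangulation.exists_inverse_estimates d k hσ
  set Q := 6 * (‖convTensor d‖ + ‖divTensor d‖) * ((C + C ^ 2) * √B) with hQ
  have hQ0 : 0 ≤ Q := by positivity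
  set D := Metric.diam (closure Ω) + 1 with hD
  have hD1 : 1 ≤ D := le_add_of_nonneg_left Metric.diam_nonneg
  -- The factor `Q + 1` makes `K Δt ≤ Q / (Q + 1)`, which is below 2 even when the time-step
  -- condition is not strict; `D` absorbs the change from `h³` to `h^{1+d/2}`. The dependence on `B`
  -- enters through the radius `√B` in `Q`.
  refine ⟨1 / ((Q + 1) * D), by positivity, ?_⟩
  intro 𝒯 Xh Qh hqu hX F Re ν s Δt hRe hν hs hΔt hsmall f M w w' hw hw' h0 hB
  have hh : 0 < 𝒯.h := pos_of_lt_mul_rpow 𝒯.h_nonneg hΔt hsmall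
  have hhD : 𝒯.h ≤ D := 𝒯.h_le_diam.trans (le_add_of_nonneg_right zero_le_one)
  have hV : vhSubmodule Xh Qh ≤ bddSubmodule Ω :=
    (vhSubmodule_le Xh Qh).trans hX.le_bddSubmodule
  obtain ⟨C', hC'⟩ := 𝒯.exists_poincare (by omega) hΩ
  change IsDiscreteSolution F (vhSubmodule Xh Qh : Set (H10 Ω)) Re ν s Δt f M w at hw
  change IsDiscreteSolution F (vhSubmodule Xh Qh : Set (H10 Ω)) Re ν s Δt f M w' at hw'
  refine hw.unique (C := C) (R := √B) (η := (√(𝒯.h ^ d))⁻¹) (h := 𝒯.h) hw' hΩ hV hRe hν hs hΔt hC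
    (Real.sqrt_nonneg _) (by positivity) hh
    (fun u hu => hinv hΩ 𝒯 Xh hqu hX hh u (vhSubmodule_le Xh Qh hu)) ?_ ?_ ?_ h0
  · exact fun n hn => Real.le_sqrt_of_sq_le
      ((hw.norm_vel_sq_le hV hRe hν hs hΔt hC' hn).trans hB)
  · exact fun n hn => Real.le_sqrt_of_sq_le
      ((hw'.norm_vel_sq_le hV hRe hν hs hΔt hC' hn).trans (by rw [← h0]; exact hB))
  · exact small_step_arith hQ0 hD1 hh hhD hd hd' hsmall

end LadyzhenskayaFE

end

/-! ### Main theorem -/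

theorem mainTheorem2 {d : ℕ} (hd : d = 2 ∨ d = 3) (Ω : Set (LadyzhenskayaFE.Vec d))
    (hΩ : IsOpen Ω) (k : ℕ) :
    -- stability and existence, for every time step
    (∀ (𝒯 : LadyzhenskayaFE.Triangulation Ω)
      (Xh : Submodule ℝ (LadyzhenskayaFE.H10 Ω)) (Qh : Submodule ℝ (LadyzhenskayaFE.L2Scal Ω)),
      𝒯.IsFESpace k Xh → LadyzhenskayaFE.IsPressureSpace Qh →
      ∀ (F : LadyzhenskayaFE.Formulation) (Re CS δ r s Δt : ℝ),
      0 < Re → 0 < CS → 0 < δ → 0 ≤ s → 0 < Δt →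
      ∀ (f : ℝ → StrongDual ℝ (LadyzhenskayaFE.H10 Ω)) (M : ℕ),
        (∀ w : ℕ → LadyzhenskayaFE.H10 Ω,
          LadyzhenskayaFE.IsDiscreteSolution F (LadyzhenskayaFE.Vh Xh Qh) Re ((CS * δ) ^ r) s Δt
            f M w →
          ‖LadyzhenskayaFE.vel (w M)‖ ^ 2
            + Re⁻¹ * Δt * ∑ n ∈ Finset.range M,
                ‖LadyzhenskayaFE.grad (LadyzhenskayaFE.midpt w n)‖ ^ 2
            + 2 * (CS * δ) ^ r * Δt * ∑ n ∈ Finset.range M,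
                LadyzhenskayaFE.gradPow s (LadyzhenskayaFE.midpt w n)
            ≤ ‖LadyzhenskayaFE.vel (w 0)‖ ^ 2
              + Δt * Re * ∑ n ∈ Finset.range M,
                  LadyzhenskayaFE.hMinusNorm (f (LadyzhenskayaFE.tmid Δt n)) ^ 2) ∧
        (∀ w₀ ∈ LadyzhenskayaFE.Vh Xh Qh, ∃ w : ℕ → LadyzhenskayaFE.H10 Ω, w 0 = w₀ ∧
          LadyzhenskayaFE.IsDiscreteSolution F (LadyzhenskayaFE.Vh Xh Qh) Re ((CS * δ) ^ r) s Δt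
            f M w)) ∧
    -- uniqueness, for time steps that are small relative to the mesh size
    (∀ σ B : ℝ, 0 < σ → ∃ c : ℝ, 0 < c ∧
      ∀ (𝒯 : LadyzhenskayaFE.Triangulation Ω)
      (Xh : Submodule ℝ (LadyzhenskayaFE.H10 Ω)) (Qh : Submodule ℝ (LadyzhenskayaFE.L2Scal Ω)),
      𝒯.IsQuasiUniform σ → 𝒯.IsFESpace k Xh → LadyzhenskayaFE.IsPressureSpace Qh →
      ∀ (F : LadyzhenskayaFE.Formulation) (Re CS δ r s Δt : ℝ),
      0 < Re → 0 < CS → 0 < δ → 0 ≤ s → 0 < Δt →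
      (Δt < c * 𝒯.h ^ (1 + (d : ℝ) / 2) ∨
        (F = LadyzhenskayaFE.Formulation.skew ∧ Δt ≤ c * 𝒯.h ^ 3)) →
      ∀ (f : ℝ → StrongDual ℝ (LadyzhenskayaFE.H10 Ω)) (M : ℕ)
        (w w' : ℕ → LadyzhenskayaFE.H10 Ω),
        LadyzhenskayaFE.IsDiscreteSolution F (LadyzhenskayaFE.Vh Xh Qh) Re ((CS * δ) ^ r) s Δt
          f M w →
        LadyzhenskayaFE.IsDiscreteSolution F (LadyzhenskayaFE.Vh Xh Qh) Re ((CS * δ) ^ r) s Δt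
          f M w' →
        w 0 = w' 0 →
        ‖LadyzhenskayaFE.vel (w 0)‖ ^ 2
          + Δt * Re * ∑ n ∈ Finset.range M,
              LadyzhenskayaFE.hMinusNorm (f (LadyzhenskayaFE.tmid Δt n)) ^ 2 ≤ B →
        ∀ n ≤ M, w n = w' n) := by
  have hd2 : 2 ≤ d := by omega
  refine ⟨fun 𝒯 Xh Qh hX _ F Re CS δ r s Δt hRe hCS hδ hs hΔt f M => ?_, fun σ B hσ => ?_⟩
  · have hν : 0 ≤ (CS * δ) ^ r := Real.rpow_nonneg (mul_nonneg hCS.le hδ.le) r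
    obtain ⟨C, hC⟩ := 𝒯.exists_poincare (by omega) hΩ
    have hV := (LadyzhenskayaFE.vhSubmodule_le Xh Qh).trans hX.le_bddSubmodule
    have := LadyzhenskayaFE.finiteDimensional_vhSubmodule hX hΩ Qh
    exact ⟨fun w hw => LadyzhenskayaFE.IsDiscreteSolution.stability
        (V := LadyzhenskayaFE.vhSubmodule Xh Qh) hw hV hRe hs hΔt hC le_rfl,
      fun w₀ hw₀ => LadyzhenskayaFE.exists_isDiscreteSolution hΩ
        (LadyzhenskayaFE.vhSubmodule Xh Qh) hV F hRe hν hs hΔt hC f M hw₀⟩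
  · obtain ⟨c, hc, h⟩ :=
      LadyzhenskayaFE.exists_unique_timestep_const hd2 (by omega) hΩ k B hσ
    exact ⟨c, hc, fun 𝒯 Xh Qh hqu hX _ F Re CS δ r s Δt hRe hCS hδ hs hΔt =>
      h 𝒯 Xh Qh hqu hX F hRe (Real.rpow_nonneg (mul_nonneg hCS.le hδ.le) r) hs hΔt⟩
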